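/- **Proposition 4.5 (complex Riesz space on a ball).** Let $X$ be a real Banach lattice and let $E=X_{\mathbb C}=X+iX$ be its complexification, a complex Banach lattice with modulus $|x+iy|=\sup_{\theta\in\mathbb R}(x\cos\theta+y\sin\theta)\in X$ and norm $\|z\|=\|\,|z|\,\|$. A real $m$-homogeneous polynomial on $X$, generated by the symmetric $m$-linear form $A$, is *positive* if $A(x_1,\dots,x_m)\ge 0$ for all $x_1,\dots,x_m\ge 0$, and *regular* if it is a difference of two positive ones; regular polynomials are ordered by $P\le Q$ iff $Q-P$ is positive. A complex $m$-homogeneous polynomial $P\colon E\to\mathbb C$ is *regular* if the real polynomials $P_0=\operatorname{Re}P|_X$ and $P_1=\operatorname{Im}P|_X$ are regular. Its modulus is $|P|=\sup_{\theta\in\mathbb R}(\cos\theta\,P_0+\sin\theta\,P_1)$, the supremum in the space of real regular $m$-homogeneous polynomials, extended to $E$ by complexification, and its regular norm is $\|P\|_r=\sup_{\|z\|\le 1}\bigl||P|(z)\bigr|$. Let $U\subseteq E$ be open. A function $f\colon U\to\mathbb C$ is *regularly holomorphic* if it is holomorphic, all $\frac1{m!}\hat d^mf(z)$ ($z\in U$,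 $m\ge 0$) are regular, and for every $z\in U$ the series $\sum_m\bigl|\frac1{m!}\hat d^mf(z)\bigr|(|w-z|)$ converges for all $w$ in some neighbourhood of $z$. It is *of bounded type* if, moreover, for every $z\in U$ $$\Bigl(\limsup_{m\to\infty}\bigl\|\tfrac1{m!}\hat d^mf(z)\bigr\|_r^{1/m}\Bigr)^{-1}\ge d(z,\partial U)$$ (with $0^{-1}=\infty$ and $d(z,\emptyset)=\infty$). Now let $U$ be the open ball in $E$ with centre $z_0$ and radius $r>0$. Then the regularly holomorphic functions of bounded type on $U$ form a complex vector space $G$. For each $f\in G$ the moduli $\bigl|\frac1{m!}\hat d^mf(z_0)\bigr|$ exist, and the series $$|f|(z):=\sum_{m=0}^\infty\Bigl|\frac1{m!}\hat d^mf(z_0)\Bigr|(z-z_0)\qquad(z\in U)$$ converges absolutely and defines an element $|f|$ of $G$. The map $\mu(f)=|f|$ is an Archimedean modulus on $G$ in the sense of Mittelmeyer and Wolff, so that $G$ is a complex Archimedean vector lattice: for all $f,g\in G$ and $\alpha\in\mathbb C$, - $\mu(\mu(f))=\mu(f)$; - $\mu(\alpha f)=|\alpha|\,\mu(f)$; - $\mu\bigl(\mu(\mu(f)+\mu(g))-\mu(f+g)\bigr)=\mu(f)+\mu(g)-\mu(f+g)$;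 - $G$ is the linear span of $\mu(G)$; - if $\mu(\mu(g)-k\mu(f))=\mu(g)-k\mu(f)$ for every $k\in\mathbb N$, then $f=0$. -/

import Mathlib

open scoped Topology ENNReal

noncomputable section

/-- The elements `cos θ • x + sin θ • y`, `θ ∈ ℝ`.  In a real vector lattice the modulus of
`x + i y` is the supremum of this set. -/
def angularSet {V : Type*} [AddCommGroup V] [Module ℝ V] (x y : V) : Set V :=
  Set.range fun θ : ℝ => Real.cos θ • x + Real.sin θ • y

/-! ### Complex Banach lattices

A complex Banach lattice is the complexification of a real Banach lattice `X`, with the modulus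
`|x + i y| = sup_θ (cos θ • x + sin θ • y) ∈ X` and the norm `‖z‖ = ‖ |z| ‖`. -/

theorem angular_sub_le {X : Type*} [AddCommGroup X] [Lattice X] [IsOrderedAddMonoid X]
    [Module ℝ X] [IsOrderedModule ℝ X] (x y : X) (θ φ : ℝ) :
    (Real.cos θ • x + Real.sin θ • y) - (Real.cos φ • x + Real.sin φ • y)
      ≤ |θ - φ| • (|x| + |y|) := by
  have key : ∀ (c : ℝ) (v : X), |c| ≤ |θ - φ| → c • v ≤ |θ - φ| • |v| := by
    intro c v hc
    have h1 : c • v ≤ |c| • |v| := by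
      rcases le_total 0 c with h | h
      · rw [abs_of_nonneg h]
        exact smul_le_smul_of_nonneg_left (le_abs_self v) h
      · rw [abs_of_nonpos h]
        have : c • v = (-c) • (-v) := by simp
        rw [this]
        exact smul_le_smul_of_nonneg_left (neg_le_abs v) (by linarith)
    exact h1.trans (smul_le_smul_of_nonneg_right hc (abs_nonneg v))
  have hc : |Real.cos θ - Real.cos φ| ≤ |θ - φ| := by
    have := Real.lipschitzWith_cos.dist_le_mul θ φ
    simpa [Real.dist_eq] using this
  have hs : |Real.sin θ - Real.sin φ| ≤ |θ - φ| := by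
    have := Real.lipschitzWith_sin.dist_le_mul θ φ
    simpa [Real.dist_eq] using this
  have e : (Real.cos θ • x + Real.sin θ • y) - (Real.cos φ • x + Real.sin φ • y)
      = (Real.cos θ - Real.cos φ) • x + (Real.sin θ - Real.sin φ) • y := by
    simp only [sub_smul]; abel
  rw [e, smul_add]
  exact add_le_add (key _ _ hc) (key _ _ hs)

/-- The underlying set of the complexification `X_ℂ`; the pair `(x, y)` stands for `x + i y`. -/
def LatticeComplexification (X : Type*) : Type _ := X × X

namespace LatticeComplexification

variable {X : Type*} [AddCommGroup X] [Module ℝ X]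

instance : AddCommGroup (LatticeComplexification X) := inferInstanceAs (AddCommGroup (X × X))

/-- The real part of `z = x + i y`. -/
def re (z : LatticeComplexification X) : X := z.1

/-- The imaginary part of `z = x + i y`. -/
def im (z : LatticeComplexification X) : X := z.2

/-- `(a + i b) (x + i y) = (a x - b y) + i (a y + b x)`. -/
instance : Module ℂ (LatticeComplexification X) where
  smul α z := (α.re • z.1 - α.im • z.2, α.re • z.2 + α.im • z.1)
  one_smul z := Prod.ext
    (show (1 : ℂ).re • z.1 - (1 : ℂ).im • z.2 = z.1 by simp)
    (show (1 : ℂ).re • z.2 + (1 : ℂ).im • z.1 = z.2 by simp)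
  mul_smul α β z := Prod.ext
    (show (α * β).re • z.1 - (α * β).im • z.2
        = α.re • (β.re • z.1 - β.im • z.2) - α.im • (β.re • z.2 + β.im • z.1) by
      simp only [Complex.mul_re, Complex.mul_im]; module)
    (show (α * β).re • z.2 + (α * β).im • z.1
        = α.re • (β.re • z.2 + β.im • z.1) + α.im • (β.re • z.1 - β.im • z.2) by
      simp only [Complex.mul_re, Complex.mul_im]; module)
  smul_zero α := Prod.ext
    (show α.re • (0 : X) - α.im • (0 : X) = 0 by simp)
    (show α.re • (0 : X) + α.im • (0 : X) = 0 by simp)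
  smul_add α z w := Prod.ext
    (show α.re • (z.1 + w.1) - α.im • (z.2 + w.2)
        = (α.re • z.1 - α.im • z.2) + (α.re • w.1 - α.im • w.2) by module)
    (show α.re • (z.2 + w.2) + α.im • (z.1 + w.1)
        = (α.re • z.2 + α.im • z.1) + (α.re • w.2 + α.im • w.1) by module)
  add_smul α β z := Prod.ext
    (show (α + β).re • z.1 - (α + β).im • z.2
        = (α.re • z.1 - α.im • z.2) + (β.re • z.1 - β.im • z.2) by
      simp only [Complex.add_re, Complex.add_im]; module)
    (show (α + β).re • z.2 + (α + β).im • z.1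
        = (α.re • z.2 + α.im • z.1) + (β.re • z.2 + β.im • z.1) by
      simp only [Complex.add_re, Complex.add_im]; module)
  zero_smul z := Prod.ext
    (show (0 : ℂ).re • z.1 - (0 : ℂ).im • z.2 = 0 by simp)
    (show (0 : ℂ).re • z.2 + (0 : ℂ).im • z.1 = 0 by simp)

theorem re_add (z w : LatticeComplexification X) : (z + w).re = z.re + w.re := rfl

theorem im_add (z w : LatticeComplexification X) : (z + w).im = z.im + w.im := rfl

theorem re_smul (α : ℂ) (z : LatticeComplexification X) :
    (α • z).re = α.re • z.re - α.im • z.im := rfl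

theorem im_smul (α : ℂ) (z : LatticeComplexification X) :
    (α • z).im = α.re • z.im + α.im • z.re := rfl

/-- The inclusion `x ↦ x + i 0` of the real part `X` into the complex Banach lattice. -/
def ofReal : X →ₗ[ℝ] LatticeComplexification X where
  toFun x := (x, 0)
  map_add' x y := Prod.ext rfl (show (0 : X) = 0 + 0 by simp)
  map_smul' c x := Prod.ext
    (show c • x = (c : ℂ).re • x - (c : ℂ).im • (0 : X) by simp)
    (show (0 : X) = (c : ℂ).re • (0 : X) + (c : ℂ).im • x by simp)

end LatticeComplexification

section BanachLattice

variable {X : Type*} [NormedAddCommGroup X] [Lattice X] [HasSolidNorm X] [IsOrderedAddMonoid X]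
  [NormedSpace ℝ X] [IsOrderedModule ℝ X]

/-- In a Banach lattice the supremum defining the modulus of `x + i y` exists. -/
theorem exists_isLUB_angularSet [CompleteSpace X] (x y : X) :
    ∃ u : X, IsLUB (angularSet x y) u := by
  set g : ℝ → X := fun θ => Real.cos θ • x + Real.sin θ • y with hg
  set a : X := |x| + |y| with ha
  have ha0 : 0 ≤ a := add_nonneg (abs_nonneg x) (abs_nonneg y)
  let p : ℕ → ℕ → ℝ := fun n j => (j : ℝ) / (n + 1) * (2 * Real.pi)
  let v : ℕ → X := fun n =>
    (Finset.range (n + 1)).sup' (by simp) fun j => g (p n j)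
  let c : ℕ → ℝ := fun n => 2 * Real.pi * (1 / ((n : ℝ) + 1))
  have hper : ∀ t : ℝ, g (t * (2 * Real.pi)) = g (Int.fract t * (2 * Real.pi)) := by
    intro t
    have : Int.fract t * (2 * Real.pi) = t * (2 * Real.pi) - (⌊t⌋ : ℤ) * (2 * Real.pi) := by
      rw [Int.fract]; ring
    simp only [hg, this, Real.cos_sub_int_mul_two_pi, Real.sin_sub_int_mul_two_pi]
  have hub : ∀ θ n, g θ ≤ v n + c n • a := by
    intro θ n
    set t := θ / (2 * Real.pi) with ht
    have hθ : g θ = g (Int.fract t * (2 * Real.pi)) := by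
      rw [← hper, ht, div_mul_cancel₀]
      positivity
    have hn : (0 : ℝ) < n + 1 := by positivity
    set s := Int.fract t with hs
    have hs0 : 0 ≤ s := Int.fract_nonneg t
    have hs1 : s < 1 := Int.fract_lt_one t
    set j := ⌊((n : ℝ) + 1) * s⌋₊ with hj
    have hjle : (j : ℝ) ≤ (n + 1) * s := Nat.floor_le (by positivity)
    have hjlt : (n + 1) * s < (j : ℝ) + 1 := Nat.lt_floor_add_one _
    have hjn : j < n + 1 := by
      have : (j : ℝ) < (n : ℝ) + 1 := by nlinarith
      exact_mod_cast this
    have hd : |s * (2 * Real.pi) - p n j| ≤ c n := by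
      have e : s * (2 * Real.pi) - p n j
          = 2 * Real.pi * ((((n : ℝ) + 1) * s - j) / (n + 1)) := by
        simp only [p]; field_simp
      rw [e, abs_of_nonneg]
      · apply mul_le_mul_of_nonneg_left _ (by positivity)
        apply div_le_div_of_nonneg_right _ hn.le
        linarith
      · apply mul_nonneg (by positivity)
        apply div_nonneg _ hn.le
        linarith
    have h1 := angular_sub_le x y (s * (2 * Real.pi)) (p n j)
    have h2 : g (s * (2 * Real.pi)) ≤ g (p n j) + c n • a := by
      have h3 : g (s * (2 * Real.pi)) - g (p n j) ≤ c n • a :=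
        h1.trans (smul_le_smul_of_nonneg_right hd ha0)
      rw [add_comm]
      exact sub_le_iff_le_add.mp h3
    rw [hθ]
    refine h2.trans ?_
    have : g (p n j) ≤ v n :=
      Finset.le_sup' (fun j => g (p n j)) (Finset.mem_range.mpr hjn)
    gcongr
  have hvv : ∀ k n, v k ≤ v n + c n • a := fun k n =>
    Finset.sup'_le _ _ fun j _ => hub _ n
  have hc0 : ∀ n, 0 ≤ c n := fun n => by
    simp only [c]; positivity
  have hcanti : ∀ N n, N ≤ n → c n ≤ c N := by
    intro N n h
    simp only [c]
    gcongr
  have hct : Filter.Tendsto c Filter.atTop (𝓝 0) := by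
    have := (tendsto_one_div_add_atTop_nhds_zero_nat (𝕜 := ℝ)).const_mul (2 * Real.pi)
    simpa [c] using this
  have hcauchy : CauchySeq v := by
    refine cauchySeq_of_le_tendsto_0 (fun N => c N * ‖a‖) ?_ ?_
    · intro n m N hn hm
      rw [dist_eq_norm]
      have habs : |v n - v m| ≤ |c N • a| := by
        rw [abs_of_nonneg (smul_nonneg (hc0 N) ha0), abs_le']
        constructor
        · rw [sub_le_iff_le_add']
          refine (hvv n m).trans ?_
          gcongr
          exact hcanti N m hm
        · rw [neg_sub, sub_le_iff_le_add']
          refine (hvv m n).trans ?_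
          gcongr
          exact hcanti N n hn
      have := norm_le_norm_of_abs_le_abs habs
      rwa [norm_smul, Real.norm_of_nonneg (hc0 N)] at this
    · simpa using hct.mul_const ‖a‖
  obtain ⟨u, hu⟩ := cauchySeq_tendsto_of_complete hcauchy
  refine ⟨u, ?_, ?_⟩
  · rintro _ ⟨θ, rfl⟩
    have hlim : Filter.Tendsto (fun n => v n + c n • a) Filter.atTop (𝓝 (u + (0 : ℝ) • a)) :=
      hu.add (hct.smul_const a)
    rw [zero_smul, add_zero] at hlim
    exact ge_of_tendsto' hlim fun n => hub θ n
  · intro b hb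
    refine le_of_tendsto' hu fun n => Finset.sup'_le _ _ fun j _ => hb ⟨p n j, rfl⟩

namespace LatticeComplexification

variable [CompleteSpace X]

/-- The modulus `|z| = sup_θ (cos θ • x + sin θ • y) ∈ X` of `z = x + i y`. -/
def modulus (z : LatticeComplexification X) : X :=
  Classical.choose (exists_isLUB_angularSet z.re z.im)

theorem isLUB_modulus (z : LatticeComplexification X) :
    IsLUB (angularSet z.re z.im) z.modulus :=
  Classical.choose_spec (exists_isLUB_angularSet z.re z.im)

theorem le_modulus (z : LatticeComplexification X) (θ : ℝ) :
    Real.cos θ • z.re + Real.sin θ • z.im ≤ z.modulus :=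
  (isLUB_modulus z).1 ⟨θ, rfl⟩

theorem modulus_nonneg (z : LatticeComplexification X) : 0 ≤ z.modulus := by
  have h0 := le_modulus z 0
  have h1 := le_modulus z Real.pi
  simp only [Real.cos_zero, Real.sin_zero, Real.cos_pi, Real.sin_pi, one_smul, zero_smul,
    add_zero, neg_smul] at h0 h1
  exact (abs_nonneg z.re).trans (abs_le'.mpr ⟨h0, h1⟩)

theorem modulus_add_le (z w : LatticeComplexification X) :
    (z + w).modulus ≤ z.modulus + w.modulus := by
  refine (isLUB_modulus (z + w)).2 ?_
  rintro _ ⟨θ, rfl⟩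
  have := add_le_add (le_modulus z θ) (le_modulus w θ)
  refine le_trans (le_of_eq ?_) this
  simp only [re_add, im_add]
  module

theorem modulus_smul_le (α : ℂ) (z : LatticeComplexification X) :
    (α • z).modulus ≤ ‖α‖ • z.modulus := by
  refine (isLUB_modulus (α • z)).2 ?_
  rintro _ ⟨θ, rfl⟩
  have := smul_le_smul_of_nonneg_left (le_modulus z (θ - Complex.arg α)) (norm_nonneg α)
  refine le_trans (le_of_eq ?_) this
  have hre : α.re = ‖α‖ * Real.cos (Complex.arg α) := (Complex.norm_mul_cos_arg α).symm
  have him : α.im = ‖α‖ * Real.sin (Complex.arg α) := (Complex.norm_mul_sin_arg α).symm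
  simp only [re_smul, im_smul]
  rw [hre, him, Real.cos_sub, Real.sin_sub]
  module

/-- The norm `‖z‖ = ‖ |z| ‖`. -/
instance : Norm (LatticeComplexification X) := ⟨fun z => ‖z.modulus‖⟩

theorem norm_def (z : LatticeComplexification X) : ‖z‖ = ‖z.modulus‖ := rfl

theorem norm_smul_le_aux (α : ℂ) (z : LatticeComplexification X) : ‖α • z‖ ≤ ‖α‖ * ‖z‖ := by
  rw [norm_def, norm_def, ← Real.norm_of_nonneg (norm_nonneg α), ← norm_smul]
  apply norm_le_norm_of_abs_le_abs
  rw [abs_of_nonneg (modulus_nonneg _),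
    abs_of_nonneg (smul_nonneg (norm_nonneg _) (modulus_nonneg _))]
  simpa using modulus_smul_le α z

theorem core : NormedSpace.Core ℂ (LatticeComplexification X) where
  norm_nonneg z := norm_nonneg z.modulus
  norm_smul α z := by
    refine le_antisymm (norm_smul_le_aux α z) ?_
    rcases eq_or_ne α 0 with rfl | hα
    · rw [norm_zero, zero_mul]
      exact norm_nonneg ((0 : ℂ) • z).modulus
    · have h := norm_smul_le_aux α⁻¹ (α • z)
      rw [smul_smul, inv_mul_cancel₀ hα, one_smul, norm_inv] at h
      have hpos : 0 < ‖α‖ := norm_pos_iff.mpr hα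
      calc ‖α‖ * ‖z‖ ≤ ‖α‖ * (‖α‖⁻¹ * ‖α • z‖) := by gcongr
        _ = ‖α • z‖ := by rw [← mul_assoc, mul_inv_cancel₀ hpos.ne', one_mul]
  norm_triangle z w := by
    rw [norm_def, norm_def, norm_def]
    refine le_trans ?_ (norm_add_le _ _)
    apply norm_le_norm_of_abs_le_abs
    rw [abs_of_nonneg (modulus_nonneg _),
      abs_of_nonneg (add_nonneg (modulus_nonneg _) (modulus_nonneg _))]
    exact modulus_add_le z w
  norm_eq_zero_iff z := by
    constructor
    · intro h
      have hm : z.modulus = 0 := norm_eq_zero.mp h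
      have h0 := le_modulus z 0
      have h1 := le_modulus z Real.pi
      have h2 := le_modulus z (Real.pi / 2)
      have h3 := le_modulus z (-(Real.pi / 2))
      simp only [hm, Real.cos_zero, Real.sin_zero, Real.cos_pi, Real.sin_pi, Real.cos_neg,
        Real.sin_neg, Real.cos_pi_div_two, Real.sin_pi_div_two, one_smul, zero_smul,
        add_zero, zero_add, neg_smul, Left.neg_nonpos_iff] at h0 h1 h2 h3
      exact Prod.ext (le_antisymm h0 h1) (le_antisymm h2 h3)
    · rintro rfl
      have h : (0 : LatticeComplexification X).modulus = 0 := by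
        refine (isLUB_modulus (0 : LatticeComplexification X)).unique ?_
        have : angularSet (0 : LatticeComplexification X).re (0 : LatticeComplexification X).im
            = {(0 : X)} := by
          have e : ∀ θ : ℝ, Real.cos θ • (0 : LatticeComplexification X).re
              + Real.sin θ • (0 : LatticeComplexification X).im = (0 : X) := fun θ => by
            change Real.cos θ • (0 : X) + Real.sin θ • (0 : X) = 0
            simp
          simp [angularSet, e]
        rw [this]
        exact isLUB_singleton
      rw [norm_def, h, norm_zero]

instance : NormedAddCommGroup (LatticeComplexification X) := NormedAddCommGroup.ofCore core

instance : NormedSpace ℂ (LatticeComplexification X) := NormedSpace.ofCore core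

end LatticeComplexification

end BanachLattice

/-! ### Regular homogeneous polynomials

An `m`-homogeneous polynomial is handled through the symmetric `m`-linear form generating it. -/

section RegularForms

variable {X : Type*} [AddCommGroup X] [PartialOrder X] [Module ℝ X] {m : ℕ}

/-- `A` is symmetric and generates a positive `m`-homogeneous polynomial:
`A (x₁, …, xₘ) ≥ 0` whenever `x₁, …, xₘ ≥ 0`. -/
def IsPositiveForm (A : MultilinearMap ℝ (fun _ : Fin m => X) ℝ) : Prop :=
  (∀ (σ : Equiv.Perm (Fin m)) (x : Fin m → X), A (fun i => x (σ i)) = A x) ∧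
    ∀ x : Fin m → X, (∀ i, 0 ≤ x i) → 0 ≤ A x

theorem IsPositiveForm.add {A B : MultilinearMap ℝ (fun _ : Fin m => X) ℝ}
    (hA : IsPositiveForm A) (hB : IsPositiveForm B) : IsPositiveForm (A + B) :=
  ⟨fun σ x => by simp [hA.1 σ x, hB.1 σ x], fun x hx => add_nonneg (hA.2 x hx) (hB.2 x hx)⟩

theorem IsPositiveForm.smul {A : MultilinearMap ℝ (fun _ : Fin m => X) ℝ}
    (hA : IsPositiveForm A) {c : ℝ} (hc : 0 ≤ c) : IsPositiveForm (c • A) :=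
  ⟨fun σ x => by simp [hA.1 σ x], fun x hx => mul_nonneg hc (hA.2 x hx)⟩

theorem IsPositiveForm.zero : IsPositiveForm (0 : MultilinearMap ℝ (fun _ : Fin m => X) ℝ) :=
  ⟨fun _ _ => rfl, fun _ _ => le_rfl⟩

variable (X m) in
/-- The real vector space of regular `m`-homogeneous real polynomials on `X`: the differences
of two positive ones. -/
def regularForms : Submodule ℝ (MultilinearMap ℝ (fun _ : Fin m => X) ℝ) where
  carrier := {A | ∃ B C, IsPositiveForm B ∧ IsPositiveForm C ∧ A = B - C}
  zero_mem' := ⟨0, 0, .zero, .zero, by simp⟩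
  add_mem' := by
    rintro _ _ ⟨B, C, hB, hC, rfl⟩ ⟨B', C', hB', hC', rfl⟩
    exact ⟨B + B', C + C', hB.add hB', hC.add hC', by abel⟩
  smul_mem' := by
    rintro c _ ⟨B, C, hB, hC, rfl⟩
    rcases le_total 0 c with hc | hc
    · exact ⟨c • B, c • C, hB.smul hc, hC.smul hc, by module⟩
    · exact ⟨(-c) • C, (-c) • B, hC.smul (by linarith), hB.smul (by linarith), by module⟩

/-- The order of the space of regular polynomials: `A ≤ B` if `B - A` is positive. -/
instance : Preorder (regularForms X m) where
  le A B := IsPositiveForm (B.1 - A.1)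
  le_refl A := by
    rw [sub_self]
    exact .zero
  le_trans A B C hAB hBC := by
    have := hBC.add hAB
    rwa [sub_add_sub_cancel] at this

end RegularForms

/-! ### Complex regular polynomials on a complex Banach lattice -/

section ComplexForms

variable {X : Type*} [NormedAddCommGroup X] [Lattice X] [HasSolidNorm X] [IsOrderedAddMonoid X]
  [NormedSpace ℝ X] [IsOrderedModule ℝ X] [CompleteSpace X] {m : ℕ}

/-- The restriction of a complex `m`-linear form on `X_ℂ` to the real arguments. -/
def restrictReal (P : MultilinearMap ℂ (fun _ : Fin m => LatticeComplexification X) ℂ) :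
    MultilinearMap ℝ (fun _ : Fin m => X) ℂ :=
  (P.restrictScalars ℝ).compLinearMap fun _ => LatticeComplexification.ofReal

/-- The real part `P₀` in `P = P₀ + i P₁`, as a real form on `X`. -/
def realPartForm (P : MultilinearMap ℂ (fun _ : Fin m => LatticeComplexification X) ℂ) :
    MultilinearMap ℝ (fun _ : Fin m => X) ℝ :=
  Complex.reLm.compMultilinearMap (restrictReal P)

/-- The imaginary part `P₁` in `P = P₀ + i P₁`, as a real form on `X`. -/
def imPartForm (P : MultilinearMap ℂ (fun _ : Fin m => LatticeComplexification X) ℂ) :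
    MultilinearMap ℝ (fun _ : Fin m => X) ℝ :=
  Complex.imLm.compMultilinearMap (restrictReal P)

/-- A complex `m`-homogeneous polynomial on `X_ℂ` is regular if its real and imaginary parts
are regular on `X`. -/
def IsRegularForm (P : MultilinearMap ℂ (fun _ : Fin m => LatticeComplexification X) ℂ) : Prop :=
  realPartForm P ∈ regularForms X m ∧ imPartForm P ∈ regularForms X m

/-- `P` is regular and `B` is its modulus `|P|`, that is
`B = sup_θ (cos θ • P₀ + sin θ • P₁)` in the ordered space of real regular polynomials. -/
def IsFormModulus (P : MultilinearMap ℂ (fun _ : Fin m => LatticeComplexification X) ℂ)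
    (B : regularForms X m) : Prop :=
  ∃ (h₀ : realPartForm P ∈ regularForms X m) (h₁ : imPartForm P ∈ regularForms X m),
    IsLUB (angularSet (⟨realPartForm P, h₀⟩ : regularForms X m) ⟨imPartForm P, h₁⟩) B

open Classical in
/-- The modulus `|P|` of a regular polynomial (and `0` if there is none). -/
def formModulus (P : MultilinearMap ℂ (fun _ : Fin m => LatticeComplexification X) ℂ) :
    regularForms X m :=
  if h : ∃ B, IsFormModulus P B then h.choose else 0

/-- The values of the complexification of a real `m`-linear form `B`:
`B_ℂ (x₁ + i y₁, …, xₘ + i yₘ) = ∑_s i ^ |s| B (the yⱼ for j ∈ s, the xⱼ for j ∉ s)`. -/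
def complexifyForm (B : MultilinearMap ℝ (fun _ : Fin m => X) ℝ)
    (z : Fin m → LatticeComplexification X) : ℂ :=
  ∑ s : Finset (Fin m),
    Complex.I ^ s.card * (B (s.piecewise (fun j => (z j).im) (fun j => (z j).re)) : ℂ)

/-- The regular norm `‖P‖_r = ‖ |P| ‖`, the supremum of `| |P|(z) |` over `‖z‖ ≤ 1`. -/
def regularNorm (P : MultilinearMap ℂ (fun _ : Fin m => LatticeComplexification X) ℂ) : ℝ≥0∞ :=
  ⨆ (z : LatticeComplexification X) (_ : ‖z‖ ≤ 1),
    ‖complexifyForm (formModulus P : MultilinearMap ℝ (fun _ : Fin m => X) ℝ) fun _ => z‖ₑ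

/-! ### Regularly holomorphic functions -/

open Classical in
/-- The extension by `0` of a function on a subset. It only serves to differentiate functions
on an open set. -/
def extendZero {E : Type*} {U : Set E} (f : U → ℂ) : E → ℂ :=
  fun z => if h : z ∈ U then f ⟨z, h⟩ else 0

/-- The symmetric `m`-linear form generating the Taylor polynomial `(1 / m!) d^m f(z)`. -/
def taylorForm {U : Set (LatticeComplexification X)} (f : U → ℂ)
    (z : LatticeComplexification X) (m : ℕ) :
    MultilinearMap ℂ (fun _ : Fin m => LatticeComplexification X) ℂ :=
  ((m.factorial : ℂ)⁻¹) • (iteratedFDeriv ℂ m (extendZero f) z).toMultilinearMap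

/-- `f : U → ℂ` is regularly holomorphic: it is holomorphic (locally the sum of a power series of
continuous polynomials), its Taylor polynomials at each point of `U` are regular, and its
Taylor series at each `z ∈ U` is regularly convergent near `z`, i.e.
`∑ₘ |(1 / m!) d^m f(z)| (|w - z|)` converges for `w` near `z`. -/
structure IsRegularlyHolomorphic (U : Set (LatticeComplexification X)) (f : U → ℂ) : Prop where
  holomorphic : AnalyticOnNhd ℂ (extendZero f) U
  regular : ∀ z ∈ U, ∀ m, IsRegularForm (taylorForm f z m)
  convergent : ∀ z ∈ U, ∀ᶠ w in 𝓝 z, Summable fun m : ℕ =>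
    (formModulus (taylorForm f z m) : MultilinearMap ℝ (fun _ : Fin m => X) ℝ)
      fun _ => (w - z).modulus

/-- The radius of regular convergence `(limsup ‖(1 / m!) d^m f(z)‖_r ^ (1 / m))⁻¹`. -/
def regularRadius {U : Set (LatticeComplexification X)} (f : U → ℂ)
    (z : LatticeComplexification X) : ℝ≥0∞ :=
  (Filter.limsup (fun m : ℕ => regularNorm (taylorForm f z m) ^ (1 / (m : ℝ))) Filter.atTop)⁻¹

/-- `f` is regularly holomorphic of bounded type on `U`: it is regularly holomorphic and its
radius of regular convergence at each `z ∈ U` is at least `d(z, ∂U)`. -/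
structure IsRegularlyHolomorphicOfBoundedType (U : Set (LatticeComplexification X))
    (f : U → ℂ) : Prop extends IsRegularlyHolomorphic U f where
  radius : ∀ z ∈ U, Metric.infEDist z (frontier U) ≤ regularRadius f z

end ComplexForms

/-- An Archimedean modulus on a complex vector space `G`, in the sense of Mittelmeyer and Wolff.
A complex vector space with such a modulus is a complex Archimedean vector lattice. -/
structure IsArchimedeanModulus {G : Type*} [AddCommGroup G] [Module ℂ G] (μ : G → G) : Prop where
  idem : ∀ x, μ (μ x) = μ x
  smul : ∀ (α : ℂ) (x : G), μ (α • x) = ((‖α‖ : ℝ) : ℂ) • μ x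
  triangle : ∀ x y, μ (μ (μ x + μ y) - μ (x + y)) = μ x + μ y - μ (x + y)
  span : Submodule.span ℂ (Set.range μ) = ⊤
  archimedean : ∀ x y, (∀ k : ℕ, μ (μ y - (k : ℂ) • μ x) = μ y - (k : ℂ) • μ x) → x = 0

end

/-! ### Riesz decomposition and cone-additive envelopes -/

section RieszDecomposition

variable {X : Type*} [AddCommGroup X] [Lattice X] [IsOrderedAddMonoid X]

/-! A function of bounded type on the ball is determined by its Taylor forms at the centre. Those
forms are exactly the sequences `R m` of symmetric complex forms dominated by positive forms `B m`
whose diagonal values are bounded, uniformly in `m`, on each smaller ball (`IsDominatedFamily`). The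
modulus acts on each coefficient separately, so the axioms become statements about single forms,
read off on the positive cone.

Three facts carry the argument. The first is that a regular form `P` has a modulus. A form is an
upper bound of the rotations of `P` exactly when it dominates `‖P x‖` for positive `x`
(`mem_upperBounds_angularSet_iff`), so the least such form is needed. It is built by treating one
variable at a time: the function is replaced by the supremum of its sums over decompositions of that
variable into positive summands, and Riesz decomposition keeps the additivity already gained in the
other variables. The result extends from the cone to a multilinear form (`exists_least_dominating`).

The second is that domination on the cone passes to all complex arguments: `‖R z‖ ≤ B (|z₁|, …,
|zₘ|)` (`norm_le_of_formDominates`). Each `zᵢ` is a sum of unimodular multiples of positive vectors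
whose total is at most `|zᵢ|` divided by a cosine tending to `1`. In a vector lattice this
decomposition is an identity of plane trigonometry, checked modulo every prime ideal.

The third is that dominated families can be expanded again at any point `v` of the ball. By the
binomial formula the new Taylor forms of `∑ R m` are dominated by those of `∑ B m` at `|v|`, which
gives holomorphy, regularity and the radius condition
(`IsDominatedFamily.isRegularlyHolomorphicOfBoundedType`). Conversely, the root test and the
boundedness of positive forms show that the Taylor forms at the centre of a function of bounded type
are a dominated family, and the identity theorem shows that their series represents the function on
the whole ball. -/

theorem exists_add_eq_of_le_add {x a b : X} (hx : 0 ≤ x) (ha : 0 ≤ a) (hb : 0 ≤ b)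
    (h : x ≤ a + b) : ∃ y z, 0 ≤ y ∧ y ≤ a ∧ 0 ≤ z ∧ z ≤ b ∧ y + z = x := by
  refine ⟨x ⊓ a, x - x ⊓ a, le_inf hx ha, inf_le_right, sub_nonneg.2 inf_le_left, ?_, by abel⟩
  rw [sub_le_comm]
  exact le_inf (sub_le_self _ hb) (sub_le_iff_le_add.2 h)

/-- The head is cut by Riesz decomposition into a part below `a` and a part below `b`; the tail is
then split along what remains of `a` and `b`. -/
theorem List.exists_split_of_sum_eq_add (l : List X) (hl : ∀ u ∈ l, 0 ≤ u) {a b : X}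
    (ha : 0 ≤ a) (hb : 0 ≤ b) (h : l.sum = a + b) :
    ∃ p : List (X × X), (∀ q ∈ p, 0 ≤ q.1 ∧ 0 ≤ q.2) ∧ p.map (fun q => q.1 + q.2) = l ∧
      (p.map Prod.fst).sum = a ∧ (p.map Prod.snd).sum = b := by
  induction l generalizing a b with
  | nil =>
    have h' : a + b = 0 := by simpa using h.symm
    have := (add_eq_zero_iff_of_nonneg ha hb).1 h'
    exact ⟨[], by simp, by simp, by simp [this.1], by simp [this.2]⟩
  | cons u t ih =>
    have hu : 0 ≤ u := hl u (by simp)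
    have ht : ∀ v ∈ t, 0 ≤ v := fun v hv => hl v (by simp [hv])
    rw [List.sum_cons] at h
    have hle : u ≤ a + b := by
      rw [← h]; exact le_add_of_nonneg_right (List.sum_nonneg ht)
    obtain ⟨y, z, hy, hya, hz, hzb, hyz⟩ := exists_add_eq_of_le_add hu ha hb hle
    have hs : t.sum = (a - y) + (b - z) := by
      have : t.sum = a + b - u := by rw [← h]; abel
      rw [this, ← hyz]; abel
    obtain ⟨p, hp, hpl, h1, h2⟩ := ih ht (sub_nonneg.2 hya) (sub_nonneg.2 hzb) hs
    refine ⟨(y, z) :: p, ?_, by simp [hpl, hyz], by simp [h1], by simp [h2]⟩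
    intro q hq
    rcases List.mem_cons.1 hq with rfl | hq
    · exact ⟨hy, hz⟩
    · exact hp q hq

/-- A nonnegative subadditive function on the positive cone with a cone-additive majorant. -/
structure IsConeSubadditive (g : X → ℝ) : Prop where
  nonneg : ∀ a, 0 ≤ a → 0 ≤ g a
  zero : g 0 = 0
  sub : ∀ a b, 0 ≤ a → 0 ≤ b → g (a + b) ≤ g a + g b
  bdd : ∃ h : X → ℝ, h 0 = 0 ∧ (∀ a b, 0 ≤ a → 0 ≤ b → h (a + b) = h a + h b) ∧
    ∀ a, 0 ≤ a → g a ≤ h a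

theorem List.map_sum_le_of_le_additive {g h : X → ℝ} (h0 : h 0 = 0)
    (hadd : ∀ a b, 0 ≤ a → 0 ≤ b → h (a + b) = h a + h b) (hgh : ∀ a, 0 ≤ a → g a ≤ h a)
    (l : List X) (hl : ∀ u ∈ l, 0 ≤ u) : (l.map g).sum ≤ h l.sum := by
  induction l with
  | nil => simp [h0]
  | cons u t ih =>
    have hu : 0 ≤ u := hl u (by simp)
    have ht : ∀ v ∈ t, 0 ≤ v := fun v hv => hl v (by simp [hv])
    rw [List.map_cons, List.sum_cons, List.sum_cons, hadd _ _ hu (List.sum_nonneg ht)]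
    exact add_le_add (hgh u hu) (ih ht)

theorem IsConeSubadditive.le_map_sum {g : X → ℝ} (hg : IsConeSubadditive g) (l : List X)
    (hl : ∀ u ∈ l, 0 ≤ u) : g l.sum ≤ (l.map g).sum := by
  induction l with
  | nil => simp [hg.zero]
  | cons u t ih =>
    have hu : 0 ≤ u := hl u (by simp)
    have ht : ∀ v ∈ t, 0 ≤ v := fun v hv => hl v (by simp [hv])
    rw [List.map_cons, List.sum_cons, List.sum_cons]
    exact (hg.sub _ _ hu (List.sum_nonneg ht)).trans (by linarith [ih ht])

theorem List.map_nonneg_sum {g : X → ℝ} (hg : ∀ a, 0 ≤ a → 0 ≤ g a) (l : List X)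
    (hl : ∀ u ∈ l, 0 ≤ u) : 0 ≤ (l.map g).sum := by
  apply List.sum_nonneg
  intro x hx
  obtain ⟨u, hu, rfl⟩ := List.mem_map.1 hx
  exact hg u (hl u hu)

/-- Refining a decomposition never decreases the sum of a subadditive function, so one common
refinement does at least as well as `l₁` for `g` and as `l₂` for `k`. -/
theorem exists_common_refinement {g k : X → ℝ} (hg : IsConeSubadditive g)
    (hk : IsConeSubadditive k) (l₁ l₂ : List X) (h₁ : ∀ u ∈ l₁, 0 ≤ u) (h₂ : ∀ u ∈ l₂, 0 ≤ u)
    (h : l₁.sum = l₂.sum) : ∃ l : List X, (∀ u ∈ l, 0 ≤ u) ∧ l.sum = l₁.sum ∧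
      (l₁.map g).sum ≤ (l.map g).sum ∧ (l₂.map k).sum ≤ (l.map k).sum := by
  induction l₁ generalizing l₂ with
  | nil => exact ⟨l₂, h₂, h.symm, by simpa using List.map_nonneg_sum hg.nonneg l₂ h₂, le_rfl⟩
  | cons u t ih =>
    have hu : 0 ≤ u := h₁ u (by simp)
    have ht : ∀ v ∈ t, 0 ≤ v := fun v hv => h₁ v (by simp [hv])
    rw [List.sum_cons] at h
    obtain ⟨p, hp, hpl, hp1, hp2⟩ :=
      l₂.exists_split_of_sum_eq_add h₂ hu (List.sum_nonneg ht) h.symm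
    have hf : ∀ v ∈ p.map Prod.fst, 0 ≤ v := by
      intro v hv
      obtain ⟨q, hq, rfl⟩ := List.mem_map.1 hv
      exact (hp q hq).1
    have hs : ∀ v ∈ p.map Prod.snd, 0 ≤ v := by
      intro v hv
      obtain ⟨q, hq, rfl⟩ := List.mem_map.1 hv
      exact (hp q hq).2
    obtain ⟨l, hl, hls, hlg, hlk⟩ := ih (p.map Prod.snd) ht hs hp2.symm
    refine ⟨p.map Prod.fst ++ l, ?_, by simp [hp1, hls], ?_, ?_⟩
    · intro v hv
      rcases List.mem_append.1 hv with hv | hv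
      · exact hf v hv
      · exact hl v hv
    · rw [List.map_cons, List.sum_cons, List.map_append, List.sum_append]
      have := hg.le_map_sum _ hf
      rw [hp1] at this
      exact add_le_add this hlg
    · rw [List.map_append, List.sum_append, ← hpl]
      have key : ∀ p : List (X × X), (∀ q ∈ p, 0 ≤ q.1 ∧ 0 ≤ q.2) →
          ((p.map fun q => q.1 + q.2).map k).sum
            ≤ ((p.map Prod.fst).map k).sum + ((p.map Prod.snd).map k).sum := by
        intro p hp
        induction p with
        | nil => simp
        | cons q s ihs =>
          have h3 := ihs fun r hr => hp r (by simp [hr])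
          have h4 := hk.sub q.1 q.2 (hp q (by simp)).1 (hp q (by simp)).2
          simp only [List.map_cons, List.sum_cons]
          linarith
      exact (key p hp).trans (by linarith)

/-- The least cone-additive majorant of a function on the positive cone, as the supremum over the
decompositions of `x` into positive summands. -/
noncomputable def coneEnvelope (g : X → ℝ) (x : X) : ℝ :=
  sSup {t | ∃ l : List X, (∀ u ∈ l, 0 ≤ u) ∧ l.sum = x ∧ t = (l.map g).sum}

theorem coneEnvelope_le {g : X → ℝ} {x : X} {c : ℝ} (hx : 0 ≤ x)
    (h : ∀ l : List X, (∀ u ∈ l, 0 ≤ u) → l.sum = x → (l.map g).sum ≤ c) :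
    coneEnvelope g x ≤ c := by
  apply csSup_le
  · exact ⟨_, [x], by simpa using hx, by simp, rfl⟩
  · rintro _ ⟨l, hl, hs, rfl⟩
    exact h l hl hs

theorem IsConeSubadditive.le_coneEnvelope {g : X → ℝ} (hg : IsConeSubadditive g) (l : List X)
    (hl : ∀ u ∈ l, 0 ≤ u) : (l.map g).sum ≤ coneEnvelope g l.sum := by
  apply le_csSup
  · obtain ⟨h, h0, hadd, hgh⟩ := hg.bdd
    refine ⟨h l.sum, ?_⟩
    rintro _ ⟨l', hl', hs, rfl⟩
    rw [← hs]
    exact List.map_sum_le_of_le_additive h0 hadd hgh l' hl'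
  · exact ⟨l, hl, rfl, rfl⟩

theorem IsConeSubadditive.le_coneEnvelope_self {g : X → ℝ} (hg : IsConeSubadditive g) {x : X}
    (hx : 0 ≤ x) : g x ≤ coneEnvelope g x := by
  simpa using hg.le_coneEnvelope [x] (by simpa using hx)

/-- Every decomposition of `a + b` refines to one of `a` followed by one of `b`, and subadditivity
makes the refinement no worse. Conversely, decompositions of `a` and `b` concatenate. -/
theorem IsConeSubadditive.coneEnvelope_add {g : X → ℝ} (hg : IsConeSubadditive g) {a b : X}
    (ha : 0 ≤ a) (hb : 0 ≤ b) :
    coneEnvelope g (a + b) = coneEnvelope g a + coneEnvelope g b := by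
  apply le_antisymm
  · apply coneEnvelope_le (add_nonneg ha hb)
    intro l hl hs
    obtain ⟨p, hp, hpl, h1, h2⟩ := l.exists_split_of_sum_eq_add hl ha hb hs
    have key : ∀ p : List (X × X), (∀ q ∈ p, 0 ≤ q.1 ∧ 0 ≤ q.2) →
        ((p.map fun q => q.1 + q.2).map g).sum
          ≤ ((p.map Prod.fst).map g).sum + ((p.map Prod.snd).map g).sum := by
      intro p hp
      induction p with
      | nil => simp
      | cons q s ihs =>
        have h3 := ihs fun r hr => hp r (by simp [hr])
        have h4 := hg.sub q.1 q.2 (hp q (by simp)).1 (hp q (by simp)).2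
        simp only [List.map_cons, List.sum_cons]
        linarith
    rw [← hpl]
    refine (key p hp).trans (add_le_add ?_ ?_)
    · rw [← h1]
      refine hg.le_coneEnvelope _ fun v hv => ?_
      obtain ⟨q, hq, rfl⟩ := List.mem_map.1 hv
      exact (hp q hq).1
    · rw [← h2]
      refine hg.le_coneEnvelope _ fun v hv => ?_
      obtain ⟨q, hq, rfl⟩ := List.mem_map.1 hv
      exact (hp q hq).2
  · rw [← le_sub_iff_add_le]
    refine coneEnvelope_le ha fun l₁ h₁ hs₁ => ?_
    rw [le_sub_comm]
    refine coneEnvelope_le hb fun l₂ h₂ hs₂ => ?_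
    have := hg.le_coneEnvelope (l₁ ++ l₂) (by
      intro v hv
      rcases List.mem_append.1 hv with hv | hv
      · exact h₁ v hv
      · exact h₂ v hv)
    simp only [List.map_append, List.sum_append, hs₁, hs₂] at this
    linarith

/-- The two suprema on the left may be approached along different decompositions of `x`; a common
refinement serves both at once. -/
theorem add_coneEnvelope_le {g k f : X → ℝ} (hg : IsConeSubadditive g)
    (hk : IsConeSubadditive k) (hf : IsConeSubadditive f)
    (hgk : ∀ u, 0 ≤ u → g u + k u ≤ f u) {x : X} (hx : 0 ≤ x) :
    coneEnvelope g x + coneEnvelope k x ≤ coneEnvelope f x := by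
  rw [← le_sub_iff_add_le]
  refine coneEnvelope_le hx fun l₁ h₁ hs₁ => ?_
  rw [le_sub_comm]
  refine coneEnvelope_le hx fun l₂ h₂ hs₂ => ?_
  obtain ⟨l, hl, hs, h3, h4⟩ := exists_common_refinement hg hk l₁ l₂ h₁ h₂ (hs₁.trans hs₂.symm)
  have h5 := hf.le_coneEnvelope l hl
  rw [hs, hs₁] at h5
  have key : ∀ l : List X, (∀ u ∈ l, 0 ≤ u) →
      (l.map g).sum + (l.map k).sum ≤ (l.map f).sum := by
    intro l hl
    induction l with
    | nil => simp
    | cons u t ih =>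
      have := ih fun v hv => hl v (by simp [hv])
      have := hgk u (hl u (by simp))
      simp only [List.map_cons, List.sum_cons]
      linarith
  linarith [key l hl]

theorem coneEnvelope_le_add {g k f : X → ℝ} (hg : IsConeSubadditive g)
    (hk : IsConeSubadditive k) (hgk : ∀ u, 0 ≤ u → f u ≤ g u + k u) {x : X} (hx : 0 ≤ x) :
    coneEnvelope f x ≤ coneEnvelope g x + coneEnvelope k x := by
  refine coneEnvelope_le hx fun l hl hs => ?_
  have h1 := hg.le_coneEnvelope l hl
  have h2 := hk.le_coneEnvelope l hl
  rw [hs] at h1 h2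
  have key : ∀ l : List X, (∀ u ∈ l, 0 ≤ u) →
      (l.map f).sum ≤ (l.map g).sum + (l.map k).sum := by
    intro l hl
    induction l with
    | nil => simp
    | cons u t ih =>
      have := ih fun v hv => hl v (by simp [hv])
      have := hgk u (hl u (by simp))
      simp only [List.map_cons, List.sum_cons]
      linarith
  linarith [key l hl]

end RieszDecomposition

/-! ### Least cone-multiadditive majorants -/

section Sweep

variable {X : Type*} [AddCommGroup X] [Lattice X] [IsOrderedAddMonoid X] {m : ℕ}

open Function

/-- `φ` lies between `ρ` and every cone-multiadditive majorant of `ρ`, is separately subadditive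
on the cone, and separately additive in the variables `j ∈ S`. -/
structure IsPartialEnvelope (ρ : (Fin m → X) → ℝ) (S : Finset (Fin m))
    (φ : (Fin m → X) → ℝ) : Prop where
  le : ∀ x, (∀ i, 0 ≤ x i) → ρ x ≤ φ x
  le_majorant : ∀ ψ : (Fin m → X) → ℝ,
    (∀ x j, (∀ i, 0 ≤ x i) → ∀ a b, 0 ≤ a → 0 ≤ b →
      ψ (update x j (a + b)) = ψ (update x j a) + ψ (update x j b)) →
    (∀ x, (∀ i, 0 ≤ x i) → ρ x ≤ ψ x) → ∀ x, (∀ i, 0 ≤ x i) → φ x ≤ ψ x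
  sub : ∀ x j, (∀ i, 0 ≤ x i) → ∀ a b, 0 ≤ a → 0 ≤ b →
    φ (update x j (a + b)) ≤ φ (update x j a) + φ (update x j b)
  add : ∀ x, ∀ j ∈ S, (∀ i, 0 ≤ x i) → ∀ a b, 0 ≤ a → 0 ≤ b →
    φ (update x j (a + b)) = φ (update x j a) + φ (update x j b)

theorem update_nonneg_of_nonneg {x : Fin m → X} (hx : ∀ i, 0 ≤ x i) (j : Fin m) {a : X}
    (ha : 0 ≤ a) (i : Fin m) : 0 ≤ update x j a i := by
  rcases eq_or_ne i j with rfl | h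
  · simpa using ha
  · simpa [h] using hx i

theorem IsPartialEnvelope.isConeSubadditive {ρ β : (Fin m → X) → ℝ} {S : Finset (Fin m)}
    {φ : (Fin m → X) → ℝ} (h : IsPartialEnvelope ρ S φ)
    (hρ : ∀ x, (∀ i, 0 ≤ x i) → 0 ≤ ρ x)
    (hβ : ∀ x j, (∀ i, 0 ≤ x i) → ∀ a b, 0 ≤ a → 0 ≤ b →
      β (update x j (a + b)) = β (update x j a) + β (update x j b))
    (hρβ : ∀ x, (∀ i, 0 ≤ x i) → ρ x ≤ β x) {x : Fin m → X} (hx : ∀ i, 0 ≤ x i) (j : Fin m) :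
    IsConeSubadditive fun u => φ (update x j u) := by
  have hβ0 : β (update x j 0) = 0 := by
    have := hβ x j hx 0 0 le_rfl le_rfl
    rw [add_zero] at this
    linarith
  have h1 : ∀ a, 0 ≤ a → 0 ≤ φ (update x j a) := fun a ha =>
    (hρ _ (update_nonneg_of_nonneg hx j ha)).trans (h.le _ (update_nonneg_of_nonneg hx j ha))
  have h2 : ∀ a, 0 ≤ a → φ (update x j a) ≤ β (update x j a) := fun a ha =>
    h.le_majorant β hβ hρβ _ (update_nonneg_of_nonneg hx j ha)
  exact ⟨h1, le_antisymm ((h2 0 le_rfl).trans hβ0.le) (h1 0 le_rfl), h.sub x j hx,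
    fun u => β (update x j u), hβ0, hβ x j hx, h2⟩

/-- Taking the envelope in the variable `j` makes it additive there. Additivity in an earlier
variable `i` survives because the envelope respects sums of functions, by `coneEnvelope_le_add` and
`add_coneEnvelope_le`. A multiadditive majorant stays above each sum over a decomposition, hence
above the envelope. -/
theorem IsPartialEnvelope.insert {ρ β : (Fin m → X) → ℝ} {S : Finset (Fin m)}
    {φ : (Fin m → X) → ℝ} (h : IsPartialEnvelope ρ S φ)
    (hρ : ∀ x, (∀ i, 0 ≤ x i) → 0 ≤ ρ x)
    (hβ : ∀ x j, (∀ i, 0 ≤ x i) → ∀ a b, 0 ≤ a → 0 ≤ b →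
      β (update x j (a + b)) = β (update x j a) + β (update x j b))
    (hρβ : ∀ x, (∀ i, 0 ≤ x i) → ρ x ≤ β x) (j : Fin m) :
    IsPartialEnvelope ρ (insert j S)
      fun x => coneEnvelope (fun u => φ (update x j u)) (x j) := by
  have hsub : ∀ {x : Fin m → X}, (∀ i, 0 ≤ x i) →
      IsConeSubadditive fun u => φ (update x j u) :=
    fun hx => h.isConeSubadditive hρ hβ hρβ hx j
  have hself : ∀ x (_ : ∀ i, 0 ≤ x i), φ x ≤ coneEnvelope (fun u => φ (update x j u)) (x j) := by
    intro x hx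
    simpa using (hsub hx).le_coneEnvelope_self (hx j)
  have hadd : ∀ x, (∀ i, 0 ≤ x i) → ∀ a b, 0 ≤ a → 0 ≤ b →
      coneEnvelope (fun u => φ (update (update x j (a + b)) j u)) (update x j (a + b) j) =
      coneEnvelope (fun u => φ (update (update x j a) j u)) (update x j a j) +
      coneEnvelope (fun u => φ (update (update x j b) j u)) (update x j b j) := by
    intro x hx a b ha hb
    simp only [update_idem, update_self]
    exact (hsub hx).coneEnvelope_add ha hb
  constructor
  · exact fun x hx => (h.le x hx).trans (hself x hx)
  · intro ψ hψ hρψ x hx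
    refine coneEnvelope_le (hx j) fun l hl hs => ?_
    have hψ0 : ψ (update x j 0) = 0 := by
      have := hψ x j hx 0 0 le_rfl le_rfl
      rw [add_zero] at this
      linarith
    have := List.map_sum_le_of_le_additive (g := fun u => φ (update x j u))
      (h := fun u => ψ (update x j u)) hψ0 (hψ x j hx)
      (fun a ha => h.le_majorant ψ hψ hρψ _ (update_nonneg_of_nonneg hx j ha)) l hl
    simpa [hs] using this
  · intro x i hx a b ha hb
    rcases eq_or_ne i j with rfl | hij
    · exact (hadd x hx a b ha hb).le
    · simp only [update_of_ne hij.symm]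
      refine coneEnvelope_le_add (hsub (update_nonneg_of_nonneg hx i ha))
        (hsub (update_nonneg_of_nonneg hx i hb)) (fun u hu => ?_) (hx j)
      simp only [update_comm hij]
      exact h.sub _ i (update_nonneg_of_nonneg hx j hu) a b ha hb
  · intro x i hi hx a b ha hb
    rcases eq_or_ne i j with rfl | hij
    · exact hadd x hx a b ha hb
    · have hiS : i ∈ S := (Finset.mem_insert.1 hi).resolve_left hij
      have e : ∀ u, 0 ≤ u → φ (update (update x i (a + b)) j u)
          = φ (update (update x i a) j u) + φ (update (update x i b) j u) := by
        intro u hu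
        simp only [update_comm hij]
        exact h.add _ i hiS (update_nonneg_of_nonneg hx j hu) a b ha hb
      simp only [update_of_ne hij.symm]
      refine le_antisymm (coneEnvelope_le_add (hsub (update_nonneg_of_nonneg hx i ha))
        (hsub (update_nonneg_of_nonneg hx i hb)) (fun u hu => (e u hu).le) (hx j)) ?_
      exact add_coneEnvelope_le (hsub (update_nonneg_of_nonneg hx i ha))
        (hsub (update_nonneg_of_nonneg hx i hb))
        (hsub (update_nonneg_of_nonneg hx i (add_nonneg ha hb))) (fun u hu => (e u hu).ge) (hx j)

theorem exists_partialEnvelope {ρ β : (Fin m → X) → ℝ}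
    (hρ : ∀ x, (∀ i, 0 ≤ x i) → 0 ≤ ρ x)
    (hρsub : ∀ x j, (∀ i, 0 ≤ x i) → ∀ a b, 0 ≤ a → 0 ≤ b →
      ρ (update x j (a + b)) ≤ ρ (update x j a) + ρ (update x j b))
    (hβ : ∀ x j, (∀ i, 0 ≤ x i) → ∀ a b, 0 ≤ a → 0 ≤ b →
      β (update x j (a + b)) = β (update x j a) + β (update x j b))
    (hρβ : ∀ x, (∀ i, 0 ≤ x i) → ρ x ≤ β x) (S : Finset (Fin m)) :
    ∃ φ, IsPartialEnvelope ρ S φ := by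
  induction S using Finset.induction_on with
  | empty => exact ⟨ρ, fun _ _ => le_rfl, fun ψ _ h => h, hρsub, by simp⟩
  | insert j S _ ih =>
    obtain ⟨φ, hφ⟩ := ih
    exact ⟨_, hφ.insert hρ hβ hρβ j⟩

end Sweep

/-! ### Extension from the cone to multilinear maps -/

section ConeExtension

variable {X : Type*} [AddCommGroup X] [Lattice X] [IsOrderedAddMonoid X] [Module ℝ X]

theorem span_nonneg_eq_top : Submodule.span ℝ {x : X | 0 ≤ x} = ⊤ := by
  rw [eq_top_iff]
  intro x _
  rw [← posPart_sub_negPart x]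
  exact Submodule.sub_mem _ (Submodule.subset_span (posPart_nonneg x))
    (Submodule.subset_span (negPart_nonneg x))

theorem MultilinearMap.ext_of_nonneg {ι W : Type*} [Finite ι] [AddCommMonoid W] [Module ℝ W]
    {f g : MultilinearMap ℝ (fun _ : ι => X) W}
    (h : ∀ x : ι → X, (∀ i, 0 ≤ x i) → f x = g x) : f = g :=
  
  MultilinearMap.ext_of_span_eq_top (g := fun _ => ((↑) : {x : X // 0 ≤ x} → X))
    (fun _ => by rw [Subtype.range_coe_subtype, span_nonneg_eq_top]) fun x => h _ fun i => (x i).2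

variable [IsOrderedModule ℝ X]

/-- Kantorovich extension: `g p - g q` depends only on `p - q`, so `x ↦ g x⁺ - g x⁻` may be computed
from any difference of positive vectors. -/
theorem exists_linearMap_of_coneAdditive {V : Type*} [AddCommGroup V] [Module ℝ V] {g : X → V}
    (hadd : ∀ a b, 0 ≤ a → 0 ≤ b → g (a + b) = g a + g b)
    (hsmul : ∀ (c : ℝ) a, 0 ≤ c → 0 ≤ a → g (c • a) = c • g a) :
    ∃ L : X →ₗ[ℝ] V, ∀ a, 0 ≤ a → L a = g a := by
  have hwd : ∀ p q, 0 ≤ p → 0 ≤ q → g (p - q)⁺ - g (p - q)⁻ = g p - g q := by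
    intro p q hp hq
    have h : (p - q)⁺ + q = (p - q)⁻ + p := by
      have := posPart_sub_negPart (p - q)
      rw [sub_eq_iff_eq_add] at this
      rw [this]; abel
    have := congrArg g h
    rw [hadd _ _ (posPart_nonneg _) hq, hadd _ _ (negPart_nonneg _) hp] at this
    rw [sub_eq_sub_iff_add_eq_add, this]
    abel
  have hwd' : ∀ x p q, 0 ≤ p → 0 ≤ q → x = p - q → g x⁺ - g x⁻ = g p - g q := by
    rintro _ p q hp hq rfl
    exact hwd p q hp hq
  have hx : ∀ x : X, x = x⁺ - x⁻ := fun x => (posPart_sub_negPart x).symm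
  refine ⟨⟨⟨fun x => g x⁺ - g x⁻, fun x y => ?_⟩, fun c x => ?_⟩, fun a ha => ?_⟩
  · rw [hwd' (x + y) (x⁺ + y⁺) (x⁻ + y⁻) (add_nonneg (posPart_nonneg _) (posPart_nonneg _))
      (add_nonneg (negPart_nonneg _) (negPart_nonneg _))
      (by nth_rw 1 [hx x, hx y]; abel),
      hadd _ _ (posPart_nonneg _) (posPart_nonneg _),
      hadd _ _ (negPart_nonneg _) (negPart_nonneg _)]
    abel
  · simp only [RingHom.id_apply]
    rcases le_total 0 c with hc | hc
    · rw [hwd' (c • x) (c • x⁺) (c • x⁻) (smul_nonneg hc (posPart_nonneg _))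
        (smul_nonneg hc (negPart_nonneg _)) (by rw [← smul_sub, ← hx]),
        hsmul _ _ hc (posPart_nonneg _), hsmul _ _ hc (negPart_nonneg _), smul_sub]
    · have hc' : 0 ≤ -c := neg_nonneg.2 hc
      rw [hwd' (c • x) ((-c) • x⁻) ((-c) • x⁺) (smul_nonneg hc' (negPart_nonneg _))
        (smul_nonneg hc' (posPart_nonneg _)) (by rw [← smul_sub, neg_smul, ← smul_neg,
          neg_sub, ← hx]),
        hsmul _ _ hc' (posPart_nonneg _), hsmul _ _ hc' (negPart_nonneg _)]
      module
  · have h0 : g 0 = 0 := by simpa using hadd 0 0 le_rfl le_rfl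
    change g a⁺ - g a⁻ = g a
    rw [hwd' a a 0 ha le_rfl (by simp), h0, sub_zero]

/-- Additivity and nonnegativity make `h` monotone along the ray through `a`. Trapping `n * c`
between consecutive integers bounds `n * |h (c • a) - c * h a|` by `h a` for every `n`. -/
theorem coneAdditive_smul {h : X → ℝ} (h0 : ∀ a, 0 ≤ a → 0 ≤ h a)
    (hadd : ∀ a b, 0 ≤ a → 0 ≤ b → h (a + b) = h a + h b) {c : ℝ} (hc : 0 ≤ c) {a : X}
    (ha : 0 ≤ a) : h (c • a) = c * h a := by
  have hz : h 0 = 0 := by simpa using hadd 0 0 le_rfl le_rfl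
  have hnat : ∀ (n : ℕ) b, 0 ≤ b → h ((n : ℝ) • b) = n * h b := by
    intro n b hb
    induction n with
    | zero => simp [hz]
    | succ n ih =>
      push_cast
      rw [add_smul, one_smul, hadd _ _ (smul_nonneg (Nat.cast_nonneg n) hb) hb, ih]
      ring
  have hmono : ∀ s t : ℝ, 0 ≤ s → s ≤ t → h (s • a) ≤ h (t • a) := by
    intro s t hs hst
    have := hadd (s • a) ((t - s) • a) (smul_nonneg hs ha) (smul_nonneg (sub_nonneg.2 hst) ha)
    rw [← add_smul, add_sub_cancel] at this
    rw [this]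
    linarith [h0 _ (smul_nonneg (sub_nonneg.2 hst) ha)]
  have hest : ∀ n : ℕ, (n : ℝ) * |h (c • a) - c * h a| ≤ h a := by
    intro n
    have e1 : h (((n : ℝ) * c) • a) = n * h (c • a) := by
      rw [mul_smul, hnat n _ (smul_nonneg hc ha)]
    have hnc : 0 ≤ (n : ℝ) * c := by positivity
    set k := ⌊(n : ℝ) * c⌋₊
    have hk1 : (k : ℝ) ≤ n * c := Nat.floor_le hnc
    have hk2 : (n : ℝ) * c ≤ k + 1 := (Nat.lt_floor_add_one _).le
    have l1 := hmono _ _ (Nat.cast_nonneg k) hk1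
    have l2 := hmono _ _ hnc hk2
    have e3 := hnat (k + 1) a ha
    push_cast at e3
    rw [e1] at l1 l2
    rw [hnat k a ha] at l1
    rw [e3] at l2
    have ha0 := h0 a ha
    have : (n : ℝ) * |h (c • a) - c * h a| = |n * h (c • a) - n * c * h a| := by
      rw [mul_assoc, ← mul_sub, abs_mul, Nat.abs_cast]
    rw [this, abs_le]
    constructor <;> nlinarith
  by_contra hne
  have hpos : 0 < |h (c • a) - c * h a| := abs_pos.2 (sub_ne_zero.2 hne)
  obtain ⟨n, hn⟩ := exists_nat_gt (h a / |h (c • a) - c * h a|)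
  rw [div_lt_iff₀ hpos] at hn
  linarith [hest n]

/-- Induction by currying: the first variable gives a cone-additive map into forms in the remaining
ones, which then extends linearly. Nonnegativity is what supplies homogeneity. -/
theorem exists_multilinearMap_of_coneAdditive {m : ℕ} {φ : (Fin m → X) → ℝ}
    (h0 : ∀ x, (∀ i, 0 ≤ x i) → 0 ≤ φ x)
    (hadd : ∀ x j, (∀ i, 0 ≤ x i) → ∀ a b, 0 ≤ a → 0 ≤ b →
      φ (Function.update x j (a + b)) = φ (Function.update x j a) + φ (Function.update x j b)) :
    ∃ M : MultilinearMap ℝ (fun _ : Fin m => X) ℝ, ∀ x, (∀ i, 0 ≤ x i) → M x = φ x := by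
  induction m with
  | zero =>
    refine ⟨MultilinearMap.constOfIsEmpty ℝ (fun _ => X) (φ 0), fun x _ => ?_⟩
    rw [Subsingleton.elim x 0]
    rfl
  | succ m ih =>
    have hcons : ∀ {a : X} {x : Fin m → X}, 0 ≤ a → (∀ i, 0 ≤ x i) →
        ∀ i, 0 ≤ (Fin.cons a x : Fin (m + 1) → X) i := by
      intro a x ha hx i
      refine Fin.cases ?_ (fun i => ?_) i
      · simpa using ha
      · simpa using hx i
    have hex : ∀ a : X, ∃ M : MultilinearMap ℝ (fun _ : Fin m => X) ℝ,
        0 ≤ a → ∀ x, (∀ i, 0 ≤ x i) → M x = φ (Fin.cons a x) := by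
      intro a
      by_cases ha : 0 ≤ a
      · obtain ⟨M, hM⟩ := ih (φ := fun x => φ (Fin.cons a x))
          (fun x hx => h0 _ (hcons ha hx)) (fun x j hx b c hb hc => by
            simp only [Fin.cons_update]
            exact hadd _ _ (hcons ha hx) b c hb hc)
        exact ⟨M, fun _ => hM⟩
      -- Off the cone the choice is irrelevant: only positive values of the first variable enter the
      -- extension.
      · exact ⟨0, fun h => absurd h ha⟩
    choose g hg using hex
    have hφadd : ∀ x : Fin m → X, (∀ i, 0 ≤ x i) → ∀ a b, 0 ≤ a → 0 ≤ b →
        φ (Fin.cons (a + b) x) = φ (Fin.cons a x) + φ (Fin.cons b x) := by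
      intro x hx a b ha hb
      have := hadd (Fin.cons 0 x) 0 (hcons le_rfl hx) a b ha hb
      simpa only [Fin.update_cons_zero] using this
    obtain ⟨L, hL⟩ := exists_linearMap_of_coneAdditive (g := g)
      (fun a b ha hb => MultilinearMap.ext_of_nonneg fun x hx => by
        rw [add_apply, hg _ (add_nonneg ha hb) x hx, hg _ ha x hx, hg _ hb x hx,
          hφadd x hx a b ha hb])
      (fun c a hc ha => MultilinearMap.ext_of_nonneg fun x hx => by
        rw [smul_apply, hg _ (smul_nonneg hc ha) x hx, hg _ ha x hx, smul_eq_mul]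
        exact coneAdditive_smul (h := fun a => φ (Fin.cons a x))
          (fun a ha => h0 _ (hcons ha hx)) (hφadd x hx) hc ha)
    refine ⟨LinearMap.uncurryLeft L, fun x hx => ?_⟩
    rw [LinearMap.uncurryLeft_apply, hL _ (hx 0), hg _ (hx 0) (Fin.tail x) fun i => hx i.succ]
    exact congrArg φ (Fin.cons_self_tail x)

/-! ### The least positive majorant of a symmetric form -/

/-- `B` dominates `A` on the positive cone. -/
def FormDominates {m : ℕ} (B : MultilinearMap ℝ (fun _ : Fin m => X) ℝ)
    (A : MultilinearMap ℝ (fun _ : Fin m => X) ℂ) : Prop :=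
  ∀ x, (∀ i, 0 ≤ x i) → ‖A x‖ ≤ B x

/-- After the envelope has been taken in all variables the result is multiadditive. Minimality holds
among all dominating forms, symmetric or not. Since `M` with permuted arguments still dominates the
symmetric `A`, comparison for `σ` and `σ⁻¹` makes `M` itself symmetric. -/
theorem exists_least_dominating {m : ℕ} {A : MultilinearMap ℝ (fun _ : Fin m => X) ℂ}
    (hA : ∀ (σ : Equiv.Perm (Fin m)) x, A (fun i => x (σ i)) = A x)
    {B : MultilinearMap ℝ (fun _ : Fin m => X) ℝ} (hB : FormDominates B A) :
    ∃ M, IsPositiveForm M ∧ FormDominates M A ∧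
      ∀ C : MultilinearMap ℝ (fun _ : Fin m => X) ℝ, FormDominates C A →
        ∀ x, (∀ i, 0 ≤ x i) → M x ≤ C x := by
  obtain ⟨φ, hφ⟩ := exists_partialEnvelope (ρ := fun x => ‖A x‖) (β := fun x => B x)
    (fun x _ => norm_nonneg _)
    (fun x j _ a b _ _ => by
      rw [A.map_update_add]
      exact norm_add_le _ _)
    (fun x j _ a b _ _ => B.map_update_add x j a b) hB Finset.univ
  obtain ⟨M, hM⟩ := exists_multilinearMap_of_coneAdditive (φ := φ)
    (fun x hx => (norm_nonneg _).trans (hφ.le x hx))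
    (fun x j hx a b ha hb => hφ.add x j (Finset.mem_univ j) hx a b ha hb)
  have hdom : FormDominates M A := fun x hx => (hφ.le x hx).trans (hM x hx).ge
  have hmin : ∀ C : MultilinearMap ℝ (fun _ : Fin m => X) ℝ, FormDominates C A →
        ∀ x, (∀ i, 0 ≤ x i) → M x ≤ C x := by
    intro C hC x hx
    rw [hM x hx]
    exact hφ.le_majorant (fun x => C x) (fun x j _ a b _ _ => C.map_update_add x j a b) hC x hx
  have hσ : ∀ (σ : Equiv.Perm (Fin m)) x, (∀ i, 0 ≤ x i) → M x ≤ M (fun i => x (σ i)) := by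
    intro σ x hx
    have := hmin (M.domDomCongr σ) (fun y hy => by
      rw [MultilinearMap.domDomCongr_apply, ← hA σ y]
      exact hdom _ fun i => hy _) x hx
    simpa [MultilinearMap.domDomCongr_apply] using this
  refine ⟨M, ⟨fun σ x => ?_, fun x hx => (norm_nonneg _).trans (hdom x hx)⟩, hdom, hmin⟩
  have : M.domDomCongr σ = M := by
    refine MultilinearMap.ext_of_nonneg fun y hy => le_antisymm ?_ ?_
    · have := hσ σ⁻¹ (fun i => y (σ i)) fun i => hy _
      simpa [MultilinearMap.domDomCongr_apply] using this
    · simpa [MultilinearMap.domDomCongr_apply] using hσ σ y hy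
  have h2 := congrArg (fun f => f x) this
  simpa [MultilinearMap.domDomCongr_apply] using h2

end ConeExtension

/-! ### Prime ideals of a vector lattice -/

section PrimeIdeals

variable {X : Type*} [AddCommGroup X] [Lattice X] [IsOrderedAddMonoid X] [Module ℝ X]
  [IsOrderedModule ℝ X]

theorem abs_real_smul_le (c : ℝ) (v : X) : |c • v| ≤ |c| • |v| := by
  have key : ∀ (c : ℝ) (v : X), c • v ≤ |c| • |v| := by
    intro c v
    rcases le_total 0 c with h | h
    · rw [abs_of_nonneg h]
      exact smul_le_smul_of_nonneg_left (le_abs_self v) h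
    · rw [abs_of_nonpos h, ← neg_smul_neg c v]
      exact smul_le_smul_of_nonneg_left (neg_le_abs v) (by linarith)
  refine abs_le'.2 ⟨key c v, ?_⟩
  rw [← smul_neg]
  simpa using key c (-v)

theorem eq_zero_of_lattice_abs_eq_zero {x : X} (h : |x| = 0) : x = 0 :=
  le_antisymm (h ▸ le_abs_self x) (neg_nonpos.1 (h ▸ neg_le_abs x))

/-- A prime ideal of a vector lattice: a solid subspace containing one of two disjoint elements. -/
structure IsPrimeVectorIdeal (P : Submodule ℝ X) : Prop where
  solid : ∀ {x y : X}, y ∈ P → |x| ≤ |y| → x ∈ P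
  prime : ∀ {x y : X}, 0 ≤ x → 0 ≤ y → x ⊓ y = 0 → x ∈ P ∨ y ∈ P

/-- A solid subspace maximal among those avoiding `e` is prime. If disjoint `x` and `y` both lay
outside it, the ideals generated with either one would contain `e`, and taking the infimum of the
two bounds would force `e` below an element of `P`. -/
theorem exists_isPrimeVectorIdeal_notMem {e : X} (he0 : 0 ≤ e) (he : e ≠ 0) :
    ∃ P : Submodule ℝ X, IsPrimeVectorIdeal P ∧ e ∉ P := by
  let S : Set (Submodule ℝ X) := {P | (∀ x y : X, y ∈ P → |x| ≤ |y| → x ∈ P) ∧ e ∉ P}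
  have hbot : (⊥ : Submodule ℝ X) ∈ S := by
    refine ⟨fun x y hy hxy => ?_, by simpa using he⟩
    rw [Submodule.mem_bot] at hy ⊢
    subst hy
    rw [abs_zero] at hxy
    have := (abs_nonneg x).antisymm hxy
    exact eq_zero_of_lattice_abs_eq_zero this.symm
  obtain ⟨P, -, hP⟩ := zorn_le_nonempty₀ S (by
    intro c hcS hc y hy
    have hne : c.Nonempty := ⟨y, hy⟩
    have hmem : ∀ x, x ∈ sSup c ↔ ∃ Q ∈ c, x ∈ Q := fun x =>
      Submodule.mem_sSup_of_directed hne hc.directedOn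
    refine ⟨sSup c, ⟨fun x y hy hxy => ?_, ?_⟩, fun z hz => le_sSup hz⟩
    · obtain ⟨Q, hQ, hyQ⟩ := (hmem y).1 hy
      exact (hmem x).2 ⟨Q, hQ, (hcS hQ).1 x y hyQ hxy⟩
    · intro h
      obtain ⟨Q, hQ, heQ⟩ := (hmem e).1 h
      exact (hcS hQ).2 heQ) ⊥ hbot
  have hsolid := hP.prop.1
  -- By maximality, the solid subspace `I` generated by `P` and `x` must contain `e`.
  have hgen : ∀ x, 0 ≤ x → x ∉ P → ∃ p ∈ P, ∃ n : ℝ, 0 ≤ p ∧ 0 ≤ n ∧ e ≤ p + n • x := by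
    intro x hx hxP
    let I : Submodule ℝ X :=
      { carrier := {z | ∃ p ∈ P, ∃ n : ℝ, 0 ≤ p ∧ 0 ≤ n ∧ |z| ≤ p + n • x}
        zero_mem' := ⟨0, P.zero_mem, 0, le_rfl, le_rfl, by simp⟩
        add_mem' := by
          rintro z w ⟨p, hp, n, hp0, hn, hz⟩ ⟨q, hq, k, hq0, hk, hw⟩
          refine ⟨p + q, P.add_mem hp hq, n + k, add_nonneg hp0 hq0, add_nonneg hn hk, ?_⟩
          calc |z + w| ≤ |z| + |w| := abs_add_le z w
            _ ≤ (p + n • x) + (q + k • x) := add_le_add hz hw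
            _ = p + q + (n + k) • x := by module
        smul_mem' := by
          rintro c z ⟨p, hp, n, hp0, hn, hz⟩
          refine ⟨|c| • p, P.smul_mem _ hp, |c| * n, smul_nonneg (abs_nonneg c) hp0,
            mul_nonneg (abs_nonneg c) hn, ?_⟩
          calc |c • z| ≤ |c| • |z| := abs_real_smul_le c z
            _ ≤ |c| • (p + n • x) := smul_le_smul_of_nonneg_left hz (abs_nonneg c)
            _ = |c| • p + (|c| * n) • x := by module }
    have hPI : P ≤ I := fun z hz =>
      ⟨|z|, hsolid _ z hz (by rw [abs_abs]), 0, abs_nonneg z, le_rfl, by simp⟩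
    have hxI : x ∈ I := ⟨0, P.zero_mem, 1, le_rfl, zero_le_one, by simp [abs_of_nonneg hx]⟩
    have heI : e ∈ I := by
      by_contra heI
      have hIS : I ∈ S := by
        refine ⟨?_, heI⟩
        rintro z w ⟨p, hp, n, hp0, hn, hw⟩ hzw
        exact ⟨p, hp, n, hp0, hn, hzw.trans hw⟩
      exact hxP (hP.le_of_ge hIS hPI hxI)
    obtain ⟨p, hp, n, hp0, hn, h⟩ := heI
    exact ⟨p, hp, n, hp0, hn, (le_abs_self e).trans h⟩
  refine ⟨P, ⟨fun hy hxy => hsolid _ _ hy hxy, fun {x y} hx hy hxy => ?_⟩, hP.prop.2⟩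
  by_contra hcon
  rw [not_or] at hcon
  obtain ⟨p, hp, n, hp0, hn, h1⟩ := hgen x hx hcon.1
  obtain ⟨q, hq, k, hq0, hk, h2⟩ := hgen y hy hcon.2
  -- The summand `1` only ensures that `N` is positive; both `n` and `k` may vanish.
  set N : ℝ := n + k + 1
  have hN : 0 < N := by positivity
  have hx' : N⁻¹ • (e - (p + q)) ≤ x := by
    rw [inv_smul_le_iff_of_pos hN, sub_le_iff_le_add]
    refine h1.trans ?_
    have : n • x ≤ N • x := smul_le_smul_of_nonneg_right (by simp only [N]; linarith) hx
    calc p + n • x ≤ (p + q) + N • x := add_le_add (le_add_of_nonneg_right hq0) this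
      _ = _ := add_comm _ _
  have hy' : N⁻¹ • (e - (p + q)) ≤ y := by
    rw [inv_smul_le_iff_of_pos hN, sub_le_iff_le_add]
    refine h2.trans ?_
    have : k • y ≤ N • y := smul_le_smul_of_nonneg_right (by simp only [N]; linarith) hy
    calc q + k • y ≤ (p + q) + N • y := add_le_add (le_add_of_nonneg_left hp0) this
      _ = _ := add_comm _ _
  have h0 := le_inf hx' hy'
  rw [hxy, inv_smul_le_iff_of_pos hN, smul_zero, sub_nonpos] at h0
  refine hP.prop.2 (hsolid e (p + q) (P.add_mem hp hq) ?_)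
  rwa [abs_of_nonneg he0, abs_of_nonneg (add_nonneg hp0 hq0)]

theorem IsPrimeVectorIdeal.posPart_or_negPart {P : Submodule ℝ X} (hP : IsPrimeVectorIdeal P)
    (x : X) : x⁺ ∈ P ∨ x⁻ ∈ P :=
  hP.prime (posPart_nonneg x) (negPart_nonneg x) (posPart_inf_negPart_eq_zero x)

theorem IsPrimeVectorIdeal.mem_of_le {P : Submodule ℝ X} (hP : IsPrimeVectorIdeal P) {x y : X}
    (hx : 0 ≤ x) (hy : y ∈ P) (h : x ≤ y) : x ∈ P :=
  hP.solid hy (by rw [abs_of_nonneg hx]; exact h.trans (le_abs_self y))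

theorem IsPrimeVectorIdeal.mem_of_abs_le {P : Submodule ℝ X} (hP : IsPrimeVectorIdeal P)
    {x y : X} (hy : y ∈ P) (h : |x| ≤ y) : x ∈ P :=
  hP.solid hy (h.trans (le_abs_self y))

theorem eq_of_forall_sub_mem {x y : X}
    (h : ∀ P : Submodule ℝ X, IsPrimeVectorIdeal P → x - y ∈ P) : x = y := by
  by_contra hne
  obtain ⟨P, hP, he⟩ := exists_isPrimeVectorIdeal_notMem (abs_nonneg (x - y))
    (fun h => hne (sub_eq_zero.1 (eq_zero_of_lattice_abs_eq_zero h)))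
  exact he (hP.solid (h P hP) (by rw [abs_abs]))

/-- If `(x - y)⁺` were nonzero, some prime ideal would miss it; but it is at most `|x - z|` for each
`z ≤ y`. Inequalities can thus be tested in the totally ordered quotients by prime ideals. -/
theorem le_of_forall_sub_mem {x y : X}
    (h : ∀ P : Submodule ℝ X, IsPrimeVectorIdeal P → ∃ z ≤ y, x - z ∈ P) : x ≤ y := by
  by_contra hne
  obtain ⟨P, hP, he⟩ := exists_isPrimeVectorIdeal_notMem (posPart_nonneg (x - y))
    (by rw [Ne, posPart_eq_zero, sub_nonpos]; exact hne)
  obtain ⟨z, hz, hmem⟩ := h P hP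
  refine he (hP.solid hmem ?_)
  rw [abs_of_nonneg (posPart_nonneg _), posPart_def]
  exact sup_le ((sub_le_sub_left hz x).trans (le_abs_self _)) (abs_nonneg _)

end PrimeIdeals

/-! ### Polygonal decompositions -/

section Polygon

variable {X : Type*} [AddCommGroup X] [Lattice X] [IsOrderedAddMonoid X] [Module ℝ X]
  [IsOrderedModule ℝ X]

/-- The component of `x + i y` orthogonal to the direction `θ`. -/
noncomputable def crossComponent (x y : X) (θ : ℝ) : X := Real.cos θ • y - Real.sin θ • x

/-- The weight of the direction `θ` in the decomposition of `x + i y` along the directions in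
`ε ℤ`. -/
noncomputable def directionWeight (x y : X) (ε θ : ℝ) : X :=
  (crossComponent x y (θ - ε) ⊓ -crossComponent x y (θ + ε))⁺

theorem crossComponent_add_pi (x y : X) (θ : ℝ) :
    crossComponent x y (θ + Real.pi) = -crossComponent x y θ := by
  simp only [crossComponent, Real.cos_add_pi, Real.sin_add_pi]
  module

theorem directionWeight_nonneg (x y : X) (ε θ : ℝ) : 0 ≤ directionWeight x y ε θ :=
  posPart_nonneg _

/-- When `r` and `d` are nonnegative modulo an ideal, the positive part equals `r` modulo that
ideal. -/
theorem abs_posPart_add_inf_sub_le (r d : X) : |((r + d) ⊓ r)⁺ - r| ≤ d⁻ + r⁻ := by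
  have h1 : ((r + d) ⊓ r)⁺ ≤ r + r⁻ := by
    have : r + r⁻ = r⁺ := by
      rw [← sub_eq_iff_eq_add.1 (posPart_sub_negPart r)]
    rw [this]
    exact posPart_mono inf_le_right
  have h2 : r - d⁻ ≤ ((r + d) ⊓ r)⁺ := by
    refine le_trans (le_inf ?_ ?_) (le_posPart _)
    · rw [sub_le_iff_le_add, add_assoc]
      refine le_add_of_nonneg_right ?_
      have := neg_le_negPart d
      rw [neg_le_iff_add_nonneg'] at this
      exact this
    · exact sub_le_self _ (negPart_nonneg d)
  refine abs_le'.2 ⟨?_, ?_⟩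
  · rw [sub_le_iff_le_add']
    refine h1.trans (add_le_add_right (le_add_of_nonneg_left (negPart_nonneg d)) r)
  · rw [neg_sub, sub_le_iff_le_add]
    rw [sub_le_iff_le_add] at h2
    refine h2.trans ?_
    rw [add_comm]
    exact add_le_add_left (le_add_of_nonneg_right (negPart_nonneg r)) _

theorem sum_range_add_of_periodic {V : Type*} [AddCommGroup V] {f : ℕ → V} {n : ℕ}
    (hf : ∀ j, f (j + n) = f j) (k : ℕ) :
    ∑ i ∈ Finset.range n, f (k + i) = ∑ i ∈ Finset.range n, f i := by
  induction k with
  | zero => simp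
  | succ k ih =>
    rw [← ih]
    have h1 := Finset.sum_range_succ (fun i => f (k + i)) n
    have h2 := Finset.sum_range_succ' (fun i => f (k + i)) n
    rw [h1, hf k] at h2
    have h3 := add_right_cancel (b := f k) h2
    rw [h3]
    exact Finset.sum_congr rfl fun i _ => by rw [add_right_comm, add_assoc]

/-- The cross components span a two-parameter family, so their values in two neighbouring directions
determine all the others. This propagates signs around the half-circle. -/
theorem sin_smul_crossComponent (x y : X) (α ε t : ℝ) :
    Real.sin ε • crossComponent x y (α + t)
      = Real.sin t • crossComponent x y (α + ε) - Real.sin (t - ε) • crossComponent x y α := by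
  have h : ∀ a b : ℝ, Real.sin ε * a = Real.sin t * Real.cos (α + ε) - Real.sin (t - ε) * Real.cos α
      → Real.sin ε * b = Real.sin t * Real.sin (α + ε) - Real.sin (t - ε) * Real.sin α →
      Real.sin ε • (a • y - b • x) = Real.sin t • (Real.cos (α + ε) • y - Real.sin (α + ε) • x)
        - Real.sin (t - ε) • (Real.cos α • y - Real.sin α • x) := by
    intro a b ha hb
    simp only [smul_sub, smul_smul, ha, hb]
    module
  apply h
  · simp only [Real.cos_add, Real.sin_sub]; ring
  · simp only [Real.sin_add, Real.sin_sub]; ring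

theorem crossComponent_sub (x y : X) (α ε : ℝ) :
    crossComponent x y (α - ε) =
      -crossComponent x y (α + ε) + (2 * Real.cos ε) • crossComponent x y α := by
  simp only [crossComponent, Real.cos_add, Real.cos_sub, Real.sin_add, Real.sin_sub]
  module

/-- Modulo `P` every element has a sign, so `x + i y` behaves like a plane vector lying in one
sector between the directions `k ε` and `(k + 1) ε`. With polar angle `φ`, the weight of `θ` is the
modulus times the positive part of `min (sin (φ - θ + ε)) (sin (θ - φ + ε))`, a tent supported where
`|φ - θ| < ε`. Hence only the two directions bounding the sector keep a nonzero weight. -/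
theorem exists_sum_directionWeight_sub_mem {P : Submodule ℝ X} (hP : IsPrimeVectorIdeal P)
    (x y : X) {M : ℕ} (hM : 2 ≤ M) :
    ∃ k : ℕ, ∀ w : ℕ → ℝ, (∀ j, w (j + 2 * M) = w j) →
      ∑ j ∈ Finset.range (2 * M), w j • directionWeight x y (Real.pi / M) (j * (Real.pi / M))
        - (w (k + 1) • crossComponent x y (k * (Real.pi / M))
          - w k • crossComponent x y (k * (Real.pi / M) + Real.pi / M)) ∈ P := by
  set ε := Real.pi / M with hε
  set s := crossComponent x y with hs
  have hM0 : (0 : ℝ) < M := by positivity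
  have hMε : M * ε = Real.pi := by rw [hε]; field_simp
  have hM2 : (2 : ℝ) ≤ M := by exact_mod_cast hM
  have hε0 : 0 < ε := by positivity
  have hε2 : ε ≤ Real.pi / 2 := div_le_div_of_nonneg_left Real.pi_pos.le (by norm_num) hM2
  have hsin : 0 < Real.sin ε := Real.sin_pos_of_pos_of_lt_pi hε0 (by linarith [Real.pi_pos])
  have hcos : 0 ≤ Real.cos ε := Real.cos_nonneg_of_mem_Icc ⟨by linarith [Real.pi_pos], hε2⟩
  have hpi : ∀ j : ℕ, s ((j + M : ℕ) * ε) = -s (j * ε) := by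
    intro j
    rw [hs, ← crossComponent_add_pi]
    congr 1
    push_cast
    rw [add_mul, hMε]
  -- The sector is found from a sign change: the cross component changes sign after a half-turn,
  -- which is `M` steps, so there is a first step at which it becomes nonpositive modulo `P`.
  obtain ⟨k, hk1, hk2⟩ : ∃ k : ℕ, (s (k * ε))⁻ ∈ P ∧ (s ((k + 1 : ℕ) * ε))⁺ ∈ P := by
    obtain ⟨k₀, hk₀⟩ : ∃ k₀ : ℕ, (s (k₀ * ε))⁻ ∈ P := by
      rcases hP.posPart_or_negPart (s ((0 : ℕ) * ε)) with h | h
      · refine ⟨0 + M, ?_⟩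
        rwa [hpi, negPart_neg]
      · exact ⟨0, h⟩
    have hex : ∃ j : ℕ, (s ((k₀ + (j + 1) : ℕ) * ε))⁺ ∈ P := by
      refine ⟨M - 1, ?_⟩
      rwa [Nat.sub_add_cancel (by omega), hpi, posPart_neg]
    classical
    let j := Nat.find hex
    have hj : (s ((k₀ + (j + 1) : ℕ) * ε))⁺ ∈ P := Nat.find_spec hex
    refine ⟨k₀ + j, ?_, hj⟩
    rcases Nat.eq_zero_or_pos j with h0 | hpos
    · rw [h0]; exact hk₀
    · have := Nat.find_min hex (m := j - 1) (by omega)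
      rw [Nat.sub_add_cancel hpos] at this
      exact (hP.posPart_or_negPart _).resolve_left this
  have hk2' : (s (k * ε + ε))⁺ ∈ P := by
    have e : ((k + 1 : ℕ) : ℝ) * ε = k * ε + ε := by push_cast; ring
    rwa [e] at hk2
  have hneg : ∀ i : ℕ, 1 ≤ i → i ≤ M → (s ((k + i : ℕ) * ε))⁺ ∈ P := by
    intro i hi1 hiM
    have hiM' : (i : ℝ) * ε ≤ Real.pi := by
      rw [← hMε]
      exact mul_le_mul_of_nonneg_right (by exact_mod_cast hiM) hε0.le
    have hi1' : ε ≤ (i : ℝ) * ε := by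
      have : (1 : ℝ) ≤ i := by exact_mod_cast hi1
      nlinarith
    have h1 : 0 ≤ Real.sin (i * ε) :=
      Real.sin_nonneg_of_nonneg_of_le_pi (by linarith) hiM'
    have h2 : 0 ≤ Real.sin (i * ε - ε) :=
      Real.sin_nonneg_of_nonneg_of_le_pi (by linarith) (by linarith)
    have e := sin_smul_crossComponent x y (k * ε) ε (i * ε)
    have hle : s ((k + i : ℕ) * ε) ≤ (Real.sin ε)⁻¹ •
        (Real.sin (i * ε) • (s (k * ε + ε))⁺ + Real.sin (i * ε - ε) • (s (k * ε))⁻) := by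
      rw [le_inv_smul_iff_of_pos hsin]
      have e2 : ((k + i : ℕ) : ℝ) * ε = k * ε + i * ε := by push_cast; ring
      rw [e2, hs, e, sub_eq_add_neg, ← smul_neg]
      exact add_le_add (smul_le_smul_of_nonneg_left (le_posPart _) h1)
        (smul_le_smul_of_nonneg_left (neg_le_negPart _) h2)
    have hnn : 0 ≤ (Real.sin ε)⁻¹ •
        (Real.sin (i * ε) • (s (k * ε + ε))⁺ + Real.sin (i * ε - ε) • (s (k * ε))⁻) :=
      smul_nonneg (inv_nonneg.2 hsin.le) (add_nonneg (smul_nonneg h1 (posPart_nonneg _))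
        (smul_nonneg h2 (negPart_nonneg _)))
    refine hP.mem_of_le (posPart_nonneg _) (P.smul_mem _ (P.add_mem (P.smul_mem _ hk2')
      (P.smul_mem _ hk1))) (sup_le hle hnn)
  -- The other `2 * M - 2` weights vanish modulo `P`: on the first half-turn one entry of the
  -- infimum is nonpositive, and on the second the other is, after a shift by `M`.
  have hzero : ∀ i : ℕ, i < 2 * M - 2 →
      directionWeight x y ε ((k + 2 + i : ℕ) * ε) ∈ P := by
    intro i hi
    have e1 : ((k + 2 + i : ℕ) : ℝ) * ε - ε = (k + (i + 1) : ℕ) * ε := by push_cast; ring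
    have e2 : ((k + 2 + i : ℕ) : ℝ) * ε + ε = (k + (i + 3) : ℕ) * ε := by push_cast; ring
    rw [directionWeight, e1, e2]
    rcases le_or_gt (i + 1) M with h | h
    · exact hP.mem_of_le (posPart_nonneg _) (hneg (i + 1) (by omega) h) (posPart_mono inf_le_left)
    · have h3 := hneg (i + 3 - M) (by omega) (by omega)
      have e3 : k + (i + 3) = k + (i + 3 - M) + M := by omega
      rw [e3, ← hs, hpi, neg_neg]
      exact hP.mem_of_le (posPart_nonneg _) h3 (posPart_mono inf_le_right)
  -- The three-term relation writes the competing entry as `r + d` with `r = -s (k ε + ε)` and `d =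
  -- 2 cos ε • s (k ε)`. Here `d` is nonnegative modulo `P` because `M ≥ 2` gives `ε ≤ π / 2`.
  have hfst : directionWeight x y ε (k * ε) - (-s (k * ε + ε)) ∈ P := by
    rw [directionWeight, crossComponent_sub]
    refine hP.mem_of_abs_le ?_ (abs_posPart_add_inf_sub_le _ _)
    refine P.add_mem ?_ (by rw [negPart_neg]; exact hk2')
    refine hP.mem_of_le (negPart_nonneg _) (P.smul_mem (2 * Real.cos ε) hk1) ?_
    rw [negPart_def]
    refine sup_le ?_ (smul_nonneg (by positivity) (negPart_nonneg _))
    rw [← smul_neg]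
    exact smul_le_smul_of_nonneg_left (neg_le_negPart _) (by positivity)
  have hsnd : directionWeight x y ε ((k + 1 : ℕ) * ε) - s (k * ε) ∈ P := by
    have e1 : ((k + 1 : ℕ) : ℝ) * ε = k * ε + ε := by push_cast; ring
    have e2 : -crossComponent x y (k * ε + ε + ε)
        = s (k * ε) + (-(2 * Real.cos ε)) • s (k * ε + ε) := by
      have := crossComponent_sub x y (k * ε + ε) ε
      rw [add_sub_cancel_right] at this
      rw [hs, this]
      module
    rw [directionWeight, e1, add_sub_cancel_right, e2, inf_comm]
    refine hP.mem_of_abs_le ?_ (abs_posPart_add_inf_sub_le _ _)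
    refine P.add_mem ?_ hk1
    refine hP.mem_of_le (negPart_nonneg _) (P.smul_mem (2 * Real.cos ε) hk2') ?_
    rw [negPart_def, neg_smul, neg_neg]
    refine sup_le ?_ (smul_nonneg (by positivity) (posPart_nonneg _))
    exact smul_le_smul_of_nonneg_left (le_posPart _) (by positivity)
  -- Weights and coefficients have period `2 * M`, so the sum may start at `k`; its first two terms
  -- are the surviving ones.
  refine ⟨k, fun w hw => ?_⟩
  have hper : ∀ j : ℕ, w (j + 2 * M) • directionWeight x y ε ((j + 2 * M : ℕ) * ε)
      = w j • directionWeight x y ε (j * ε) := by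
    intro j
    rw [hw]
    congr 1
    have e : ((j + 2 * M : ℕ) : ℝ) * ε = j * ε + Real.pi + Real.pi := by
      push_cast; linear_combination 2 * hMε
    have e1 : (j * ε + Real.pi + Real.pi - ε) = (j * ε - ε) + Real.pi + Real.pi := by ring
    have e2 : (j * ε + Real.pi + Real.pi + ε) = (j * ε + ε) + Real.pi + Real.pi := by ring
    simp only [directionWeight, e, e1, e2, crossComponent_add_pi, neg_neg]
  rw [← sum_range_add_of_periodic hper k]
  obtain ⟨n, hn⟩ : ∃ n, 2 * M = n + 2 := ⟨2 * M - 2, by omega⟩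
  rw [hn, Finset.sum_range_succ', Finset.sum_range_succ']
  have e : ∑ i ∈ Finset.range n, w (k + (i + 1 + 1)) •
        directionWeight x y ε ((k + (i + 1 + 1) : ℕ) * ε) ∈ P := by
    refine P.sum_mem fun i hi => P.smul_mem _ ?_
    have : k + (i + 1 + 1) = k + 2 + i := by ring
    rw [this]
    exact hzero i (by have := Finset.mem_range.1 hi; omega)
  have := P.add_mem (P.add_mem e (P.smul_mem (w (k + 1)) hsnd)) (P.smul_mem (w k) hfst)
  convert this using 1
  simp only [zero_add, add_zero]
  module

/-- Modulo each prime ideal two terms remain, and what is left is the expansion of a plane vector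
along two directions at angle `ε`. Prime ideals separate points. -/
theorem sum_cos_smul_directionWeight (x y : X) {M : ℕ} (hM : 2 ≤ M) :
    ∑ j ∈ Finset.range (2 * M), Real.cos (j * (Real.pi / M)) •
      directionWeight x y (Real.pi / M) (j * (Real.pi / M)) = Real.sin (Real.pi / M) • x := by
  refine eq_of_forall_sub_mem fun P hP => ?_
  obtain ⟨k, hk⟩ := exists_sum_directionWeight_sub_mem hP x y hM
  have hM0 : (M : ℝ) ≠ 0 := by positivity
  have := hk (fun j => Real.cos (j * (Real.pi / M))) fun j => by
    rw [← Real.cos_add_two_pi (j * (Real.pi / M))]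
    congr 1; push_cast; field_simp
  convert this using 2
  push_cast
  rw [add_mul, one_mul]
  set α := k * (Real.pi / M)
  set ε := Real.pi / M
  have e : Real.sin ε = Real.sin (α + ε) * Real.cos α - Real.cos (α + ε) * Real.sin α := by
    rw [← Real.sin_sub]; congr 1; ring
  rw [e]
  simp only [crossComponent]
  module

theorem sum_sin_smul_directionWeight (x y : X) {M : ℕ} (hM : 2 ≤ M) :
    ∑ j ∈ Finset.range (2 * M), Real.sin (j * (Real.pi / M)) •
      directionWeight x y (Real.pi / M) (j * (Real.pi / M)) = Real.sin (Real.pi / M) • y := by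
  refine eq_of_forall_sub_mem fun P hP => ?_
  obtain ⟨k, hk⟩ := exists_sum_directionWeight_sub_mem hP x y hM
  have hM0 : (M : ℝ) ≠ 0 := by positivity
  have := hk (fun j => Real.sin (j * (Real.pi / M))) fun j => by
    rw [← Real.sin_add_two_pi (j * (Real.pi / M))]
    congr 1; push_cast; field_simp
  convert this using 2
  push_cast
  rw [add_mul, one_mul]
  set α := k * (Real.pi / M)
  set ε := Real.pi / M
  have e : Real.sin ε = Real.sin (α + ε) * Real.cos α - Real.cos (α + ε) * Real.sin α := by
    rw [← Real.sin_sub]; congr 1; ring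
  rw [e]
  simp only [crossComponent]
  module

/-- Modulo a prime ideal the total weight is `s (k ε) - s (k ε + ε)`. Multiplied by `cos (ε / 2)`,
it is `sin ε` times the component of `x + i y` along the bisector of the sector, which is at most
`u`. -/
theorem sum_directionWeight_le {x y u : X} (hu : u ∈ upperBounds (angularSet x y)) {M : ℕ}
    (hM : 2 ≤ M) :
    Real.cos (Real.pi / M / 2) • ∑ j ∈ Finset.range (2 * M),
      directionWeight x y (Real.pi / M) (j * (Real.pi / M)) ≤ Real.sin (Real.pi / M) • u := by
  refine le_of_forall_sub_mem fun P hP => ?_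
  obtain ⟨k, hk⟩ := exists_sum_directionWeight_sub_mem hP x y hM
  have hk1 := P.smul_mem (Real.cos (Real.pi / M / 2)) (hk (fun _ => 1) fun _ => rfl)
  simp only [one_smul] at hk1
  rw [smul_sub] at hk1
  refine ⟨_, ?_, hk1⟩
  have hM2 : (1 : ℝ) ≤ M := by exact_mod_cast (by omega : 1 ≤ M)
  have hsin : 0 ≤ Real.sin (Real.pi / M) :=
    Real.sin_nonneg_of_nonneg_of_le_pi (by positivity) (div_le_self Real.pi_pos.le hM2)
  refine le_trans (le_of_eq ?_) (smul_le_smul_of_nonneg_left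
    (hu ⟨k * (Real.pi / M) + Real.pi / M / 2, rfl⟩) hsin)
  generalize (k : ℝ) * (Real.pi / M) = α
  set δ := Real.pi / M / 2 with hδ
  have e : α + Real.pi / M = α + δ + δ := by rw [hδ]; ring
  have e' : Real.pi / M = 2 * δ := by rw [hδ]; ring
  obtain ⟨β, rfl⟩ : ∃ β, α = β - δ := ⟨α + δ, by ring⟩
  rw [e, e', sub_add_cancel, Real.sin_two_mul]
  simp only [crossComponent, Real.cos_add, Real.sin_add, Real.cos_sub, Real.sin_sub]
  module

end Polygon

/-! ### Complex multilinear forms on the complexification -/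

section ComplexExtension

variable {X : Type*} [NormedAddCommGroup X] [Lattice X] [HasSolidNorm X] [IsOrderedAddMonoid X]
  [NormedSpace ℝ X] [IsOrderedModule ℝ X] [CompleteSpace X] {m : ℕ}

local notation "𝓔" => LatticeComplexification X

namespace LatticeComplexification

theorem ofReal_re_add_I_smul_ofReal_im (z : 𝓔) :
    ofReal z.re + Complex.I • ofReal z.im = z :=
  Prod.ext
    (show z.1 + ((Complex.I).re • z.2 - (Complex.I).im • (0 : X)) = z.1 by simp)
    (show (0 : X) + ((Complex.I).re • (0 : X) + (Complex.I).im • z.2) = z.2 by simp)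

theorem span_ofReal_eq_top : Submodule.span ℂ (Set.range (ofReal : X → 𝓔)) = ⊤ := by
  rw [eq_top_iff]
  intro z _
  rw [← ofReal_re_add_I_smul_ofReal_im z]
  exact Submodule.add_mem _ (Submodule.subset_span ⟨_, rfl⟩)
    (Submodule.smul_mem _ _ (Submodule.subset_span ⟨_, rfl⟩))

theorem modulus_ofReal (x : X) : (ofReal x : 𝓔).modulus = |x| := by
  refine (isLUB_modulus (ofReal x)).unique ⟨?_, fun b hb => ?_⟩
  · rintro _ ⟨θ, rfl⟩
    change Real.cos θ • x + Real.sin θ • (0 : X) ≤ |x|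
    rw [smul_zero, add_zero]
    refine (le_abs_self _).trans ((abs_real_smul_le _ _).trans ?_)
    simpa using smul_le_smul_of_nonneg_right (Real.abs_cos_le_one θ) (abs_nonneg x)
  · have h0 := hb ⟨0, rfl⟩
    have h1 := hb ⟨Real.pi, rfl⟩
    change Real.cos 0 • x + Real.sin 0 • (0 : X) ≤ b at h0
    change Real.cos Real.pi • x + Real.sin Real.pi • (0 : X) ≤ b at h1
    exact abs_le'.2 ⟨by simpa using h0, by simpa using h1⟩

theorem norm_modulus (z : 𝓔) : ‖z.modulus‖ = ‖z‖ := rfl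

theorem norm_ofReal (x : X) : ‖(ofReal x : 𝓔)‖ = ‖x‖ := by
  rw [← norm_modulus, modulus_ofReal, norm_abs_eq_norm]

/-- The direction weights divided by `sin ε`, with `ε = π / M`, are the summands along the unit
vectors `exp (i k ε)`. The triangle inequality `|z| ≤ ∑ a k` is thereby reversed up to a factor
tending to `1`. -/
theorem exists_polygonal_decomposition (z : 𝓔) {M : ℕ} (hM : 2 ≤ M) :
    ∃ (c : ℕ → ℂ) (a : ℕ → X), (∀ k, ‖c k‖ = 1) ∧ (∀ k, 0 ≤ a k) ∧
      z = ∑ k ∈ Finset.range (2 * M), c k • ofReal (a k) ∧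
      Real.cos (Real.pi / M / 2) • ∑ k ∈ Finset.range (2 * M), a k ≤ z.modulus := by
  have hM1 : (2 : ℝ) ≤ M := by exact_mod_cast hM
  set ε := Real.pi / M
  have hε : 0 < ε := by positivity
  have hsin : 0 < Real.sin ε := Real.sin_pos_of_pos_of_lt_pi hε
    (div_lt_self Real.pi_pos (by linarith))
  have hre := sum_cos_smul_directionWeight z.re z.im hM
  have him := sum_sin_smul_directionWeight z.re z.im hM
  have hle := sum_directionWeight_le (isLUB_modulus z).1 hM
  refine ⟨fun k => Complex.exp ((k * ε : ℝ) * Complex.I),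
    fun k => (Real.sin ε)⁻¹ • directionWeight z.re z.im ε (k * ε),
    fun k => Complex.norm_exp_ofReal_mul_I _,
    fun k => smul_nonneg (inv_nonneg.2 hsin.le) (directionWeight_nonneg _ _ _ _), ?_, ?_⟩
  · have key : ∀ k : ℕ, Complex.exp ((k * ε : ℝ) * Complex.I) •
        ofReal ((Real.sin ε)⁻¹ • directionWeight z.re z.im ε (k * ε))
        = ofReal ((Real.sin ε)⁻¹ • Real.cos (k * ε) • directionWeight z.re z.im ε (k * ε))
          + Complex.I • ofReal
            ((Real.sin ε)⁻¹ • Real.sin (k * ε) • directionWeight z.re z.im ε (k * ε)) := by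
      intro k
      generalize directionWeight z.re z.im ε (k * ε) = d
      generalize (k * ε : ℝ) = t
      have h1 : ∀ (r : ℝ) (v : X), (ofReal (r • v) : 𝓔) = (r : ℂ) • ofReal v :=
        fun r v => map_smul ofReal r v
      rw [Complex.exp_mul_I, ← Complex.ofReal_cos, ← Complex.ofReal_sin]
      simp only [h1]
      module
    simp only [key]
    rw [Finset.sum_add_distrib, ← Finset.smul_sum, ← map_sum, ← map_sum, ← Finset.smul_sum,
      ← Finset.smul_sum, hre, him, inv_smul_smul₀ hsin.ne', inv_smul_smul₀ hsin.ne',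
      ofReal_re_add_I_smul_ofReal_im]
  · rw [← Finset.smul_sum, smul_comm, inv_smul_le_iff_of_pos hsin]
    exact hle

end LatticeComplexification

open LatticeComplexification

theorem restrictReal_apply (P : MultilinearMap ℂ (fun _ : Fin m => 𝓔) ℂ) (x : Fin m → X) :
    restrictReal P x = P fun i => ofReal (x i) := rfl

theorem restrictReal_injective :
    Function.Injective (restrictReal (X := X) (m := m)) := by
  intro P Q h
  refine MultilinearMap.ext_of_span_eq_top (g := fun _ => (ofReal : X → 𝓔))
    (fun _ => span_ofReal_eq_top) fun x => ?_
  exact congrArg (fun f => f x) h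

theorem restrictReal_add (P Q : MultilinearMap ℂ (fun _ : Fin m => 𝓔) ℂ) :
    restrictReal (P + Q) = restrictReal P + restrictReal Q := rfl

theorem restrictReal_smul (α : ℂ) (P : MultilinearMap ℂ (fun _ : Fin m => 𝓔) ℂ)
    (x : Fin m → X) : restrictReal (α • P) x = α * restrictReal P x := rfl

theorem MultilinearMap.mono_of_nonneg {B : MultilinearMap ℝ (fun _ : Fin m => X) ℝ}
    (hB : ∀ x, (∀ i, 0 ≤ x i) → 0 ≤ B x) {x y : Fin m → X} (hx : ∀ i, 0 ≤ x i)
    (hxy : ∀ i, x i ≤ y i) : B x ≤ B y := by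
  have hd : ∀ i, 0 ≤ (y - x) i := fun i => sub_nonneg.2 (hxy i)
  have e : B y = ∑ s : Finset (Fin m), B (s.piecewise x (y - x)) := by
    rw [← B.map_add_univ, add_sub_cancel]
  rw [e]
  have := Finset.single_le_sum (f := fun s : Finset (Fin m) => B (s.piecewise x (y - x)))
    (fun s _ => hB _ fun i => by
      by_cases hi : i ∈ s
      · simpa [hi] using hx i
      · simpa [hi] using hd i) (Finset.mem_univ Finset.univ)
  simpa using this

/-- The values of a complex form are controlled by any dominating real form at the moduli. -/
theorem norm_le_of_formDominates {R : MultilinearMap ℂ (fun _ : Fin m => 𝓔) ℂ}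
    {B : MultilinearMap ℝ (fun _ : Fin m => X) ℝ} (h : FormDominates B (restrictReal R))
    (z : Fin m → 𝓔) : ‖R z‖ ≤ B fun i => (z i).modulus := by
  have hB : ∀ x, (∀ i, 0 ≤ x i) → 0 ≤ B x := fun x hx => (norm_nonneg _).trans (h x hx)
  -- Each argument is expanded along polygonal directions. The coefficients have modulus one, so
  -- domination on the cone applies term by term, and each of the `m` arguments costs one cosine
  -- factor. The index `M + 2` keeps at least four directions.
  have key : ∀ M : ℕ, Real.cos (Real.pi / ((M + 2 : ℕ) : ℝ) / 2) ^ m * ‖R z‖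
      ≤ B fun i => (z i).modulus := by
    intro M
    have hM : 2 ≤ M + 2 := by omega
    have hM2 : (2 : ℝ) ≤ (M + 2 : ℕ) := by exact_mod_cast hM
    have hcos : 0 ≤ Real.cos (Real.pi / ((M + 2 : ℕ) : ℝ) / 2) := by
      apply Real.cos_nonneg_of_mem_Icc
      have h1 : Real.pi / ((M + 2 : ℕ) : ℝ) ≤ Real.pi :=
        div_le_self Real.pi_pos.le (by linarith)
      have h2 : 0 ≤ Real.pi / ((M + 2 : ℕ) : ℝ) := by positivity
      constructor <;> linarith [Real.pi_pos]
    choose c a hc ha hz hle using fun i => exists_polygonal_decomposition (z i) hM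
    have e1 : R z = ∑ f ∈ Fintype.piFinset fun _ : Fin m => Finset.range (2 * (M + 2)),
        (∏ i, c i (f i)) * R fun i => ofReal (a i (f i)) := by
      conv_lhs => rw [show z = fun i => ∑ k ∈ Finset.range (2 * (M + 2)), c i k • ofReal (a i k)
        from funext hz]
      rw [R.map_sum_finset]
      refine Finset.sum_congr rfl fun f _ => ?_
      rw [R.map_smul_univ, smul_eq_mul]
    have e2 : ‖R z‖ ≤ B fun i => ∑ k ∈ Finset.range (2 * (M + 2)), a i k := by
      rw [e1, B.map_sum_finset]
      refine norm_sum_le_of_le _ fun f _ => ?_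
      rw [norm_mul, norm_prod]
      simp only [hc, Finset.prod_const_one, one_mul]
      exact h (fun i => a i (f i)) fun i => ha i _
    calc Real.cos (Real.pi / ((M + 2 : ℕ) : ℝ) / 2) ^ m * ‖R z‖
        ≤ Real.cos (Real.pi / ((M + 2 : ℕ) : ℝ) / 2) ^ m *
          B fun i => ∑ k ∈ Finset.range (2 * (M + 2)), a i k := by gcongr
      _ = B fun i => Real.cos (Real.pi / ((M + 2 : ℕ) : ℝ) / 2) •
          ∑ k ∈ Finset.range (2 * (M + 2)), a i k := by
        rw [B.map_smul_univ]; simp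
      _ ≤ _ := MultilinearMap.mono_of_nonneg hB
        (fun i => smul_nonneg hcos (Finset.sum_nonneg fun k _ => ha i k)) hle
  have hlim : Filter.Tendsto
      (fun M : ℕ => Real.cos (Real.pi / ((M + 2 : ℕ) : ℝ) / 2) ^ m * ‖R z‖) Filter.atTop
      (𝓝 (Real.cos (0 / 2) ^ m * ‖R z‖)) := by
    have h1 : Filter.Tendsto (fun M : ℕ => Real.pi / ((M + 2 : ℕ) : ℝ)) Filter.atTop (𝓝 0) :=
      (tendsto_const_div_atTop_nhds_zero_nat Real.pi).comp (Filter.tendsto_add_atTop_nat 2)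
    exact (((Real.continuous_cos.tendsto _).comp (h1.div_const 2)).pow m).mul_const _
  simp only [zero_div, Real.cos_zero, one_pow, one_mul] at hlim
  exact le_of_tendsto' hlim key

/-! ### Complexification of real multilinear forms -/

theorem piecewise_im_re_update (s : Finset (Fin m)) (z : Fin m → 𝓔) (j : Fin m) (u : 𝓔) :
    s.piecewise (fun i => (Function.update z j u i).im) (fun i => (Function.update z j u i).re) =
      Function.update (s.piecewise (fun i => (z i).im) (fun i => (z i).re)) j
        (if j ∈ s then u.im else u.re) := by
  ext i
  rcases eq_or_ne i j with rfl | hij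
  · by_cases hi : i ∈ s <;> simp [hi]
  · by_cases hi : i ∈ s <;> simp [hi, hij]

theorem complexifyForm_update_add (B : MultilinearMap ℝ (fun _ : Fin m => X) ℝ) (z : Fin m → 𝓔)
    (j : Fin m) (v w : 𝓔) :
    complexifyForm B (Function.update z j (v + w)) =
      complexifyForm B (Function.update z j v) + complexifyForm B (Function.update z j w) := by
  simp only [complexifyForm]
  rw [← Finset.sum_add_distrib]
  refine Finset.sum_congr rfl fun s _ => ?_
  rw [← mul_add]
  congr 1
  have e := fun u => piecewise_im_re_update s z j u
  rw [e, e, e, ← Complex.ofReal_add, ← B.map_update_add]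
  congr 3
  split_ifs <;> rfl

theorem complexifyForm_update_real_smul (B : MultilinearMap ℝ (fun _ : Fin m => X) ℝ)
    (z : Fin m → 𝓔) (j : Fin m) (c : ℝ) (v : 𝓔) :
    complexifyForm B (Function.update z j ((c : ℂ) • v)) =
      c * complexifyForm B (Function.update z j v) := by
  simp only [complexifyForm]
  rw [Finset.mul_sum]
  refine Finset.sum_congr rfl fun s _ => ?_
  rw [mul_left_comm]
  congr 1
  have e := fun u => piecewise_im_re_update s z j u
  rw [e, e, ← Complex.ofReal_mul, ← smul_eq_mul, ← B.map_update_smul]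
  congr 3
  split_ifs <;> simp only [re_smul, im_smul, Complex.ofReal_re, Complex.ofReal_im, zero_smul,
    sub_zero, add_zero]

/-- The subsets `s` and `insert j s` are paired. Multiplying the `j`-th argument by `i` exchanges
its real and imaginary parts up to a sign, which swaps the two terms of a pair and shifts the power
of `i` by one. -/
theorem complexifyForm_update_I_smul (B : MultilinearMap ℝ (fun _ : Fin m => X) ℝ)
    (z : Fin m → 𝓔) (j : Fin m) (v : 𝓔) :
    complexifyForm B (Function.update z j (Complex.I • v)) =
      Complex.I * complexifyForm B (Function.update z j v) := by
  have e := fun s u => piecewise_im_re_update s z j u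
  have hI1 : (Complex.I • v).re = -v.im := by simp [re_smul]
  have hI2 : (Complex.I • v).im = v.re := by simp [im_smul]
  simp only [complexifyForm, e]
  rw [Finset.mul_sum]
  have hins : ∀ s : Finset (Fin m), j ∉ s → ∀ a : X,
      Function.update ((insert j s).piecewise (fun i => (z i).im) fun i => (z i).re) j a =
        Function.update (s.piecewise (fun i => (z i).im) fun i => (z i).re) j a := by
    intro s hs a
    ext i
    rcases eq_or_ne i j with rfl | hij
    · simp
    · simp [hij, Finset.piecewise]
  have hsplit : ∀ F : Finset (Fin m) → ℂ, ∑ s, F s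
      = ∑ s ∈ (Finset.univ.erase j).powerset, (F s + F (insert j s)) := by
    intro F
    have : (Finset.univ : Finset (Finset (Fin m))) =
        (insert j ((Finset.univ : Finset (Fin m)).erase j)).powerset := by
      rw [Finset.insert_erase (Finset.mem_univ j), Finset.powerset_univ]
    rw [this, Finset.sum_powerset_insert (Finset.notMem_erase _ _), Finset.sum_add_distrib]
  rw [hsplit, hsplit]
  refine Finset.sum_congr rfl fun s hs => ?_
  have hj : j ∉ s := fun h => Finset.notMem_erase j _ (Finset.mem_powerset.1 hs h)
  rw [Finset.card_insert_of_notMem hj]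
  simp only [hj, if_false, Finset.mem_insert_self, if_true, hins s hj, hI1, hI2]
  have hneg : B (Function.update (s.piecewise (fun i => (z i).im) fun i => (z i).re) j (-v.im))
      = -B (Function.update (s.piecewise (fun i => (z i).im) fun i => (z i).re) j v.im) := by
    rw [← neg_one_smul ℝ v.im, B.map_update_smul, smul_eq_mul, neg_one_mul]
  rw [hneg, pow_succ]
  push_cast
  linear_combination (-(Complex.I ^ s.card *
    (B (Function.update (s.piecewise (fun i => (z i).im) fun i => (z i).re) j v.im) : ℂ)))
      * Complex.I_mul_I

/-- The complexification of a real multilinear form as a complex multilinear map. -/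
noncomputable def complexifyMap (B : MultilinearMap ℝ (fun _ : Fin m => X) ℝ) :
    MultilinearMap ℂ (fun _ : Fin m => 𝓔) ℂ where
  toFun := complexifyForm B
  map_update_add' := by
    intro inst z j v w
    rw [Subsingleton.elim inst (instDecidableEqFin m)]
    exact complexifyForm_update_add B z j v w
  map_update_smul' := by
    intro inst z j c v
    rw [Subsingleton.elim inst (instDecidableEqFin m)]
    have : c • v = (c.re : ℂ) • v + Complex.I • (c.im : ℂ) • v := by
      rw [smul_smul, ← add_smul]
      congr 1
      rw [mul_comm, Complex.re_add_im]
    rw [this, complexifyForm_update_add, complexifyForm_update_I_smul,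
      complexifyForm_update_real_smul, complexifyForm_update_real_smul, smul_eq_mul]
    rw [← mul_assoc, ← add_mul, mul_comm Complex.I, Complex.re_add_im]

theorem complexifyMap_apply (B : MultilinearMap ℝ (fun _ : Fin m => X) ℝ) (z : Fin m → 𝓔) :
    complexifyMap B z = complexifyForm B z := rfl

theorem restrictReal_complexifyMap (B : MultilinearMap ℝ (fun _ : Fin m => X) ℝ)
    (x : Fin m → X) : restrictReal (complexifyMap B) x = B x := by
  rw [restrictReal_apply, complexifyMap_apply, complexifyForm, Finset.sum_eq_single ∅]
  · simp only [Finset.card_empty, pow_zero, one_mul, Finset.piecewise_empty]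
    rfl
  · intro s _ hs
    obtain ⟨j, hj⟩ := Finset.nonempty_iff_ne_empty.2 hs
    rw [B.map_coord_zero j, Complex.ofReal_zero, mul_zero]
    simp only [hj, Finset.piecewise_eq_of_mem]
    rfl
  · simp

theorem complexifyMap_add (B C : MultilinearMap ℝ (fun _ : Fin m => X) ℝ) :
    complexifyMap (B + C) = complexifyMap B + complexifyMap C :=
  restrictReal_injective <| MultilinearMap.ext fun x => by
    rw [restrictReal_add, add_apply, restrictReal_complexifyMap, restrictReal_complexifyMap,
      restrictReal_complexifyMap, add_apply, Complex.ofReal_add]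

theorem complexifyMap_smul (c : ℝ) (B : MultilinearMap ℝ (fun _ : Fin m => X) ℝ) :
    complexifyMap (c • B) = (c : ℂ) • complexifyMap B :=
  restrictReal_injective <| MultilinearMap.ext fun x => by
    rw [restrictReal_smul, restrictReal_complexifyMap, restrictReal_complexifyMap, smul_apply,
      smul_eq_mul, Complex.ofReal_mul]

theorem complexifyMap_injective : Function.Injective (complexifyMap (X := X) (m := m)) := by
  intro B C h
  ext x
  have := congrArg (fun P => restrictReal P x) h
  simpa only [restrictReal_complexifyMap, Complex.ofReal_inj] using this

theorem complexifyMap_sub (B C : MultilinearMap ℝ (fun _ : Fin m => X) ℝ) :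
    complexifyMap (B - C) = complexifyMap B - complexifyMap C := by
  have := complexifyMap_add (B - C) C
  rw [sub_add_cancel] at this
  rw [this, add_sub_cancel_right]

theorem eq_complexifyMap_add_I_smul (P : MultilinearMap ℂ (fun _ : Fin m => 𝓔) ℂ) :
    P = complexifyMap (realPartForm P) + Complex.I • complexifyMap (imPartForm P) :=
  restrictReal_injective <| MultilinearMap.ext fun x => by
    rw [restrictReal_add, add_apply, restrictReal_smul, restrictReal_complexifyMap,
      restrictReal_complexifyMap, mul_comm]
    exact (Complex.re_add_im _).symm

/-! ### Moduli of regular forms -/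

theorem regularForms.symm {A : MultilinearMap ℝ (fun _ : Fin m => X) ℝ}
    (hA : A ∈ regularForms X m) (σ : Equiv.Perm (Fin m)) (x : Fin m → X) :
    A (fun i => x (σ i)) = A x := by
  obtain ⟨B, C, hB, hC, rfl⟩ := hA
  rw [sub_apply, sub_apply, hB.1, hC.1]

theorem IsPositiveForm.mem_regularForms {A : MultilinearMap ℝ (fun _ : Fin m => X) ℝ}
    (hA : IsPositiveForm A) : A ∈ regularForms X m :=
  ⟨A, 0, hA, .zero, (sub_zero A).symm⟩

theorem IsRegularForm.restrictReal_symm {P : MultilinearMap ℂ (fun _ : Fin m => 𝓔) ℂ}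
    (hP : IsRegularForm P) (σ : Equiv.Perm (Fin m)) (x : Fin m → X) :
    restrictReal P (fun i => x (σ i)) = restrictReal P x :=
  Complex.ext (regularForms.symm hP.1 σ x) (regularForms.symm hP.2 σ x)

theorem symm_of_restrictReal_symm {P : MultilinearMap ℂ (fun _ : Fin m => 𝓔) ℂ}
    (hP : ∀ (σ : Equiv.Perm (Fin m)) (x : Fin m → X),
      restrictReal P (fun i => x (σ i)) = restrictReal P x)
    (σ : Equiv.Perm (Fin m)) (z : Fin m → 𝓔) : P (fun i => z (σ i)) = P z := by
  have : P.domDomCongr σ = P := restrictReal_injective <| MultilinearMap.ext fun x => hP σ x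
  exact congrArg (fun Q => Q z) this

theorem forall_cos_mul_add_sin_mul_le_iff {a b c : ℝ} :
    (∀ θ : ℝ, Real.cos θ * a + Real.sin θ * b ≤ c) ↔ ‖(⟨a, b⟩ : ℂ)‖ ≤ c := by
  constructor
  · intro h
    have h1 := h (Complex.arg ⟨a, b⟩)
    have hc := Complex.norm_mul_cos_arg ⟨a, b⟩
    have hs := Complex.norm_mul_sin_arg ⟨a, b⟩
    simp only at hc hs
    set t := Complex.arg ⟨a, b⟩
    set n := ‖(⟨a, b⟩ : ℂ)‖
    have := Real.sin_sq_add_cos_sq t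
    calc n = Real.cos t * (n * Real.cos t) + Real.sin t * (n * Real.sin t) := by
          linear_combination (-n) * this
      _ ≤ c := by rw [hc, hs]; exact h1
  · intro h θ
    refine le_trans ?_ h
    have h1 : Real.cos θ * a + Real.sin θ * b
        = (Complex.exp ((-θ : ℝ) * Complex.I) * ⟨a, b⟩).re := by
      rw [Complex.mul_re, Complex.exp_ofReal_mul_I_re, Complex.exp_ofReal_mul_I_im, Real.cos_neg,
        Real.sin_neg]
      ring
    rw [h1]
    refine (Complex.re_le_norm _).trans ?_
    rw [norm_mul, Complex.norm_exp_ofReal_mul_I, one_mul]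

/-- The order on regular forms is pointwise on the cone, and at each point the supremum over
rotations of a complex number is its absolute value. The modulus of `P` is therefore the least
regular form dominating `P`. -/
theorem mem_upperBounds_angularSet_iff {P : MultilinearMap ℂ (fun _ : Fin m => 𝓔) ℂ}
    (h₀ : realPartForm P ∈ regularForms X m) (h₁ : imPartForm P ∈ regularForms X m)
    (B : regularForms X m) :
    B ∈ upperBounds (angularSet (⟨realPartForm P, h₀⟩ : regularForms X m) ⟨imPartForm P, h₁⟩) ↔
      FormDominates B.1 (restrictReal P) := by
  have key : ∀ x : Fin m → X, ‖restrictReal P x‖ ≤ B.1 x ↔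
      ∀ θ : ℝ, Real.cos θ * realPartForm P x + Real.sin θ * imPartForm P x ≤ B.1 x :=
    fun x => forall_cos_mul_add_sin_mul_le_iff.symm
  constructor
  · intro h x hx
    rw [key]
    intro θ
    have := (h ⟨θ, rfl⟩ : IsPositiveForm _).2 x hx
    rw [sub_apply, sub_nonneg] at this
    exact this
  · rintro h _ ⟨θ, rfl⟩
    refine ⟨fun σ x => regularForms.symm (Submodule.sub_mem _ B.2 (Subtype.coe_prop _)) σ x, ?_⟩
    intro x hx
    rw [sub_apply, sub_nonneg]
    exact (key x).1 (h x hx) θ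

/-- Each part `A` of `P` is the difference `B - (B - A)`. Together with
`IsRegularForm.exists_formDominates` this identifies regularity of symmetric forms with domination
by a positive form. -/
theorem isRegularForm_of_formDominates {P : MultilinearMap ℂ (fun _ : Fin m => 𝓔) ℂ}
    (hP : ∀ (σ : Equiv.Perm (Fin m)) (x : Fin m → X),
      restrictReal P (fun i => x (σ i)) = restrictReal P x)
    {B : MultilinearMap ℝ (fun _ : Fin m => X) ℝ} (hB : IsPositiveForm B)
    (h : FormDominates B (restrictReal P)) : IsRegularForm P := by
  refine ⟨⟨B, B - realPartForm P, hB, ⟨fun σ x => ?_, fun x hx => ?_⟩, by abel⟩,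
    ⟨B, B - imPartForm P, hB, ⟨fun σ x => ?_, fun x hx => ?_⟩, by abel⟩⟩
  · rw [sub_apply, sub_apply, hB.1]
    exact congrArg (fun t => B x - Complex.re t) (hP σ x)
  · rw [sub_apply, sub_nonneg]
    exact (Complex.re_le_norm _).trans (h x hx)
  · rw [sub_apply, sub_apply, hB.1]
    exact congrArg (fun t => B x - Complex.im t) (hP σ x)
  · rw [sub_apply, sub_nonneg]
    exact (le_abs_self _).trans ((Complex.abs_im_le_norm _).trans (h x hx))

theorem IsRegularForm.exists_formDominates {P : MultilinearMap ℂ (fun _ : Fin m => 𝓔) ℂ}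
    (hP : IsRegularForm P) : ∃ B, FormDominates B (restrictReal P) := by
  obtain ⟨⟨B, C, hB, hC, h0⟩, ⟨B', C', hB', hC', h1⟩⟩ := hP
  refine ⟨B + C + (B' + C'), fun x hx => ?_⟩
  have e0 : (restrictReal P x).re = B x - C x := congrArg (fun A => A x) h0
  have e1 : (restrictReal P x).im = B' x - C' x := congrArg (fun A => A x) h1
  refine (Complex.norm_le_abs_re_add_abs_im _).trans ?_
  rw [e0, e1]
  have := hB.2 x hx
  have := hC.2 x hx
  have := hB'.2 x hx
  have := hC'.2 x hx
  simp only [add_apply]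
  refine add_le_add (abs_le.2 ⟨?_, ?_⟩) (abs_le.2 ⟨?_, ?_⟩) <;> linarith

/-- The least dominating form is the required supremum; no order completeness of `X` enters, since
the values are real. -/
theorem IsRegularForm.exists_isFormModulus {P : MultilinearMap ℂ (fun _ : Fin m => 𝓔) ℂ}
    (hP : IsRegularForm P) : ∃ B, IsFormModulus P B := by
  obtain ⟨B, hB⟩ := hP.exists_formDominates
  obtain ⟨M, hM, hdom, hmin⟩ := exists_least_dominating hP.restrictReal_symm hB
  refine ⟨⟨M, hM.mem_regularForms⟩, hP.1, hP.2, ?_, fun C hC => ?_⟩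
  · rw [mem_upperBounds_angularSet_iff]
    exact hdom
  · rw [mem_upperBounds_angularSet_iff] at hC
    refine ⟨fun σ x => regularForms.symm
      (Submodule.sub_mem _ C.2 hM.mem_regularForms) σ x, fun x hx => ?_⟩
    rw [sub_apply, sub_nonneg]
    exact hmin C.1 hC x hx

theorem IsRegularForm.isFormModulus {P : MultilinearMap ℂ (fun _ : Fin m => 𝓔) ℂ}
    (hP : IsRegularForm P) : IsFormModulus P (formModulus P) := by
  rw [formModulus, dif_pos hP.exists_isFormModulus]
  exact hP.exists_isFormModulus.choose_spec

theorem IsRegularForm.formDominates {P : MultilinearMap ℂ (fun _ : Fin m => 𝓔) ℂ}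
    (hP : IsRegularForm P) : FormDominates (formModulus P).1 (restrictReal P) := by
  obtain ⟨h₀, h₁, h⟩ := hP.isFormModulus
  exact (mem_upperBounds_angularSet_iff h₀ h₁ _).1 h.1

theorem IsRegularForm.isPositiveForm {P : MultilinearMap ℂ (fun _ : Fin m => 𝓔) ℂ}
    (hP : IsRegularForm P) : IsPositiveForm (formModulus P).1 :=
  ⟨fun σ x => regularForms.symm (formModulus P).2 σ x,
    fun x hx => (norm_nonneg _).trans (hP.formDominates x hx)⟩

theorem IsRegularForm.formModulus_le {P : MultilinearMap ℂ (fun _ : Fin m => 𝓔) ℂ}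
    (hP : IsRegularForm P) {B : MultilinearMap ℝ (fun _ : Fin m => X) ℝ}
    (hB : IsPositiveForm B) (h : FormDominates B (restrictReal P)) {x : Fin m → X}
    (hx : ∀ i, 0 ≤ x i) : (formModulus P).1 x ≤ B x := by
  obtain ⟨h₀, h₁, hlub⟩ := hP.isFormModulus
  have := hlub.2 ((mem_upperBounds_angularSet_iff h₀ h₁ ⟨B, hB.mem_regularForms⟩).2 h)
  have := (this : IsPositiveForm _).2 x hx
  rwa [sub_apply, sub_nonneg] at this

theorem isRegularForm_complexifyMap {B : MultilinearMap ℝ (fun _ : Fin m => X) ℝ}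
    (hB : IsPositiveForm B) : IsRegularForm (complexifyMap B) :=
  isRegularForm_of_formDominates (fun σ x => by simp only [restrictReal_complexifyMap, hB.1]) hB
    fun x hx => by
      rw [restrictReal_complexifyMap, Complex.norm_real, Real.norm_of_nonneg (hB.2 x hx)]

theorem formDominates_complexifyMap {B : MultilinearMap ℝ (fun _ : Fin m => X) ℝ}
    (hB : IsPositiveForm B) : FormDominates B (restrictReal (complexifyMap B)) := fun x hx => by
  rw [restrictReal_complexifyMap, Complex.norm_real, Real.norm_of_nonneg (hB.2 x hx)]

theorem formModulus_complexifyMap {B : MultilinearMap ℝ (fun _ : Fin m => X) ℝ}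
    (hB : IsPositiveForm B) : (formModulus (complexifyMap B)).1 = B := by
  refine MultilinearMap.ext_of_nonneg fun x hx => le_antisymm
    ((isRegularForm_complexifyMap hB).formModulus_le hB (formDominates_complexifyMap hB) hx) ?_
  have := (isRegularForm_complexifyMap hB).formDominates x hx
  rw [restrictReal_complexifyMap, Complex.norm_real] at this
  exact (Real.le_norm_self _).trans this

theorem IsRegularForm.add {P Q : MultilinearMap ℂ (fun _ : Fin m => 𝓔) ℂ}
    (hP : IsRegularForm P) (hQ : IsRegularForm Q) : IsRegularForm (P + Q) :=
  ⟨Submodule.add_mem _ hP.1 hQ.1, Submodule.add_mem _ hP.2 hQ.2⟩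

theorem formDominates_add {P Q : MultilinearMap ℂ (fun _ : Fin m => 𝓔) ℂ}
    {B C : MultilinearMap ℝ (fun _ : Fin m => X) ℝ} (hP : FormDominates B (restrictReal P))
    (hQ : FormDominates C (restrictReal Q)) : FormDominates (B + C) (restrictReal (P + Q)) :=
  fun x hx => (norm_add_le _ _).trans (add_le_add (hP x hx) (hQ x hx))

theorem formDominates_smul {P : MultilinearMap ℂ (fun _ : Fin m => 𝓔) ℂ}
    {B : MultilinearMap ℝ (fun _ : Fin m => X) ℝ} (hP : FormDominates B (restrictReal P))
    (α : ℂ) : FormDominates (‖α‖ • B) (restrictReal (α • P)) := fun x hx => by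
  rw [restrictReal_smul, norm_mul, smul_apply, smul_eq_mul]
  exact mul_le_mul_of_nonneg_left (hP x hx) (norm_nonneg _)

theorem formModulus_add_le {P Q : MultilinearMap ℂ (fun _ : Fin m => 𝓔) ℂ}
    (hP : IsRegularForm P) (hQ : IsRegularForm Q) {x : Fin m → X} (hx : ∀ i, 0 ≤ x i) :
    (formModulus (P + Q)).1 x ≤ (formModulus P).1 x + (formModulus Q).1 x :=
  (hP.add hQ).formModulus_le (hP.isPositiveForm.add hQ.isPositiveForm)
    (formDominates_add hP.formDominates hQ.formDominates) hx

theorem IsRegularForm.smul {P : MultilinearMap ℂ (fun _ : Fin m => 𝓔) ℂ}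
    (hP : IsRegularForm P) (α : ℂ) : IsRegularForm (α • P) :=
  isRegularForm_of_formDominates (fun σ x => by
      rw [restrictReal_smul, restrictReal_smul, hP.restrictReal_symm])
    (hP.isPositiveForm.smul (norm_nonneg α)) (formDominates_smul hP.formDominates α)

/-- One inequality holds for every scalar; applying it to `α⁻¹` and `α • P` gives the other. -/
theorem formModulus_smul {P : MultilinearMap ℂ (fun _ : Fin m => 𝓔) ℂ}
    (hP : IsRegularForm P) (α : ℂ) :
    (formModulus (α • P)).1 = ‖α‖ • (formModulus P).1 := by
  have hle : ∀ (β : ℂ) (Q : MultilinearMap ℂ (fun _ : Fin m => 𝓔) ℂ), IsRegularForm Q →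
      ∀ x : Fin m → X, (∀ i, 0 ≤ x i) →
        (formModulus (β • Q)).1 x ≤ ‖β‖ * (formModulus Q).1 x :=
    fun β Q hQ x hx => (hQ.smul β).formModulus_le (hQ.isPositiveForm.smul (norm_nonneg β))
      (formDominates_smul hQ.formDominates β) hx
  refine MultilinearMap.ext_of_nonneg fun x hx => le_antisymm (hle α P hP x hx) ?_
  rw [smul_apply, smul_eq_mul]
  rcases eq_or_ne α 0 with rfl | hα
  · simpa using (hP.smul 0).isPositiveForm.2 x hx
  · have := hle α⁻¹ (α • P) (hP.smul α) x hx
    rw [smul_smul, inv_mul_cancel₀ hα, one_smul, norm_inv,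
      le_inv_mul_iff₀ (norm_pos_iff.2 hα)] at this
    exact this

end ComplexExtension

/-! ### Symmetric forms on repeated arguments -/

section Diagonal

open Function

theorem Fin.append_update_castAdd {V : Type*} {k l : ℕ} (w : Fin k → V) (c : Fin l → V)
    (i : Fin k) (a : V) :
    Fin.append (update w i a) c = update (Fin.append w c) (Fin.castAdd l i) a := by
  ext j
  refine Fin.addCases (fun j => ?_) (fun j => ?_) j
  · rcases eq_or_ne j i with rfl | h
    · simp
    · simp [h]
  · have : Fin.natAdd k j ≠ Fin.castAdd l i := by
      intro h
      have := congrArg Fin.val h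
      simp at this
      omega
    simp [this]

variable {𝕜 V W : Type*} [CommSemiring 𝕜] [AddCommMonoid V] [Module 𝕜 V] [AddCommMonoid W]
  [Module 𝕜 W]

/-- The form `w ↦ R (w₁, …, wₖ, v, …, v)`. -/
def MultilinearMap.partialDiag {k l : ℕ} (R : MultilinearMap 𝕜 (fun _ : Fin (k + l) => V) W)
    (v : V) : MultilinearMap 𝕜 (fun _ : Fin k => V) W where
  toFun w := R (Fin.append w fun _ => v)
  map_update_add' := by
    intro inst w i a b
    rw [Subsingleton.elim inst (instDecidableEqFin k)]
    simp only [Fin.append_update_castAdd, R.map_update_add]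
  map_update_smul' := by
    intro inst w i c a
    rw [Subsingleton.elim inst (instDecidableEqFin k)]
    simp only [Fin.append_update_castAdd, R.map_update_smul]

theorem MultilinearMap.partialDiag_apply {k l : ℕ}
    (R : MultilinearMap 𝕜 (fun _ : Fin (k + l) => V) W) (v : V) (w : Fin k → V) :
    R.partialDiag v w = R (Fin.append w fun _ => v) := rfl

theorem MultilinearMap.partialDiag_symm {k l : ℕ}
    {R : MultilinearMap 𝕜 (fun _ : Fin (k + l) => V) W}
    (hR : ∀ (σ : Equiv.Perm (Fin (k + l))) x, R (fun i => x (σ i)) = R x) (v : V)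
    (σ : Equiv.Perm (Fin k)) (w : Fin k → V) :
    R.partialDiag v (fun i => w (σ i)) = R.partialDiag v w := by
  refine Eq.trans ?_ (hR (finSumFinEquiv.permCongr (Equiv.sumCongr σ (Equiv.refl (Fin l)))) _)
  rw [partialDiag_apply]
  congr 1
  ext j
  refine Fin.addCases (fun j => ?_) (fun j => ?_) j
  · simp [Equiv.permCongr_apply]
  · simp [Equiv.permCongr_apply]

/-- A symmetric form sees only the number of arguments equal to `w`: some permutation carries the
initial segment of length `s.card` onto `s`. -/
theorem MultilinearMap.map_piecewise_of_symm {m : ℕ}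
    {R : MultilinearMap 𝕜 (fun _ : Fin m => V) W}
    (hR : ∀ (σ : Equiv.Perm (Fin m)) x, R (fun i => x (σ i)) = R x) (w v : V)
    (s : Finset (Fin m)) :
    R (s.piecewise (fun _ => w) fun _ => v) = R fun i => if i.1 < s.card then w else v := by
  classical
  have hs : s.card ≤ m := by simpa using s.card_le_univ
  have hcard : Fintype.card {i : Fin m // i.1 < s.card} = Fintype.card {i : Fin m // i ∈ s} := by
    rw [Fintype.card_coe, Fintype.card_subtype, Fin.card_filter_val_lt, min_eq_right hs]
  let e := Fintype.equivOfCardEq hcard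
  rw [← hR e.extendSubtype (s.piecewise (fun _ => w) fun _ => v)]
  congr 1
  ext i
  by_cases hi : i.1 < s.card
  · have := e.extendSubtype_mem i hi
    simp [hi, this]
  · have := e.extendSubtype_not_mem i hi
    simp [hi, this]

theorem MultilinearMap.map_add_diag {m : ℕ} {R : MultilinearMap 𝕜 (fun _ : Fin m => V) W}
    (hR : ∀ (σ : Equiv.Perm (Fin m)) x, R (fun i => x (σ i)) = R x) (w v : V) :
    R (fun _ => w + v) = ∑ k ∈ Finset.range (m + 1),
      m.choose k • R fun i => if i.1 < k then w else v := by
  have h1 := R.map_add_univ (fun _ => w) fun _ => v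
  have h2 := Finset.sum_powerset_apply_card
    (fun k => R fun i : Fin m => if i.1 < k then w else v) (x := (Finset.univ : Finset (Fin m)))
  rw [Finset.card_univ, Fintype.card_fin, Finset.powerset_univ] at h2
  rw [← h2]
  refine Eq.trans h1 (Finset.sum_congr rfl fun s _ => map_piecewise_of_symm hR w v s)

theorem MultilinearMap.map_add_diag_antidiagonal
    {R : ∀ m, MultilinearMap 𝕜 (fun _ : Fin m => V) W}
    (hR : ∀ m (σ : Equiv.Perm (Fin m)) x, R m (fun i => x (σ i)) = R m x) (w v : V) (m : ℕ) :
    R m (fun _ => w + v) = ∑ p ∈ Finset.HasAntidiagonal.antidiagonal m,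
      (p.1 + p.2).choose p.1 • (R (p.1 + p.2)).partialDiag v fun _ => w := by
  rw [map_add_diag (hR m), Finset.Nat.sum_antidiagonal_eq_sum_range_succ_mk]
  refine Finset.sum_congr rfl fun k hk => ?_
  obtain ⟨l, rfl⟩ : ∃ l, m = k + l := ⟨m - k, by have := Finset.mem_range.1 hk; omega⟩
  rw [Nat.add_sub_cancel_left]
  rw [partialDiag_apply]
  refine congrArg _ (congrArg (R (k + l)) ?_)
  ext j
  refine Fin.addCases (fun j => ?_) (fun j => ?_) j
  · simp
  · simp

end Diagonal

/-! ### Bounds of positive forms -/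

section PositiveBounds

variable {X : Type*} [NormedAddCommGroup X] [Lattice X] [HasSolidNorm X] [IsOrderedAddMonoid X]
  [NormedSpace ℝ X] [IsOrderedModule ℝ X] [CompleteSpace X] {m : ℕ}

local notation "𝓔" => LatticeComplexification X

open LatticeComplexification

/-- Positive forms on a Banach lattice are bounded. -/
theorem IsPositiveForm.exists_bound {B : MultilinearMap ℝ (fun _ : Fin m => X) ℝ}
    (hB : IsPositiveForm B) : ∃ C : ℝ, ∀ x : X, 0 ≤ x → ‖x‖ ≤ 1 → B (fun _ => x) ≤ C := by
  by_contra! hcon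
  -- If `B` were unbounded, positive unit-ball vectors `x k` could be chosen with diagonal values
  -- above `2 ^ (m k) * k`. The sum of `2⁻ᵏ • x k` lies above each of its terms, so `B` would exceed
  -- every `k` there.
  choose x hx0 hx1 hx using fun k : ℕ => hcon ((2 ^ m) ^ k * k)
  have hsum : Summable fun k : ℕ => ((1 / 2 : ℝ) ^ k) • x k := by
    refine Summable.of_norm_bounded summable_geometric_two fun k => ?_
    rw [norm_smul, norm_pow, Real.norm_of_nonneg (by norm_num : (0 : ℝ) ≤ 1 / 2)]
    exact mul_le_of_le_one_right (by positivity) (hx1 k)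
  have hnn : ∀ k, 0 ≤ ((1 / 2 : ℝ) ^ k) • x k := fun k => smul_nonneg (by positivity) (hx0 k)
  have key : ∀ k : ℕ, (k : ℝ) ≤ B fun _ => ∑' k, ((1 / 2 : ℝ) ^ k) • x k := by
    intro k
    have h1 : ((1 / 2 : ℝ) ^ k) • x k ≤ ∑' k, ((1 / 2 : ℝ) ^ k) • x k :=
      hsum.le_tsum k fun j _ => hnn j
    refine le_trans ?_ (MultilinearMap.mono_of_nonneg hB.2 (fun _ => hnn k) fun _ => h1)
    rw [B.map_smul_univ (fun _ => (1 / 2 : ℝ) ^ k) fun _ => x k, Finset.prod_const,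
      Finset.card_univ, Fintype.card_fin, smul_eq_mul, ← pow_mul, mul_comm k m, pow_mul]
    calc (k : ℝ) = ((1 / 2 : ℝ) ^ m) ^ k * ((2 ^ m) ^ k * k) := by
          rw [← mul_assoc, ← mul_pow, ← mul_pow]; norm_num
      _ ≤ _ := mul_le_mul_of_nonneg_left (hx k).le (by positivity)
  obtain ⟨k, hk⟩ := exists_nat_gt (B fun _ => ∑' k, ((1 / 2 : ℝ) ^ k) • x k)
  exact absurd (key k) (not_le.2 hk)

theorem MultilinearMap.map_const_smul (B : MultilinearMap ℝ (fun _ : Fin m => X) ℝ) (c : ℝ)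
    (x : X) : B (fun _ => c • x) = c ^ m * B fun _ => x := by
  simpa using B.map_smul_univ (fun _ => c) fun _ => x

/-- Expanding the right side gives one nonnegative term per map `Fin m → Fin m`; the permutations
alone contribute the left side. -/
theorem IsPositiveForm.factorial_mul_le {B : MultilinearMap ℝ (fun _ : Fin m => X) ℝ}
    (hB : IsPositiveForm B) {x : Fin m → X} (hx : ∀ i, 0 ≤ x i) :
    (m.factorial : ℝ) * B x ≤ B fun _ => ∑ i, x i := by
  classical
  rw [B.map_sum_finset (fun _ j => x j) fun _ => Finset.univ]
  have hinj : Function.Injective fun σ : Equiv.Perm (Fin m) => (σ : Fin m → Fin m) :=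
    DFunLike.coe_injective
  calc (m.factorial : ℝ) * B x = ∑ σ : Equiv.Perm (Fin m), B fun i => x (σ i) := by
        simp [hB.1, Fintype.card_perm]
    _ = ∑ f ∈ Finset.univ.image fun σ : Equiv.Perm (Fin m) => (σ : Fin m → Fin m),
          B fun i => x (f i) := by
        rw [Finset.sum_image fun _ _ _ _ h => hinj h]
    _ ≤ _ := Finset.sum_le_sum_of_subset_of_nonneg (by intro f _; simp)
        fun f _ _ => hB.2 _ fun i => hx _

/-- Bounds on the diagonal become bounds in all arguments. For unit arguments the sum of the moduli
has norm at most `m`, so scaling to radius `ρ` and `IsPositiveForm.factorial_mul_le` give `C * (m /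
ρ) ^ m / m!`. The estimate `m ^ m / m! ≤ e ^ m` finishes. -/
theorem norm_le_of_diagonal_bound {Q : MultilinearMap ℂ (fun _ : Fin m => 𝓔) ℂ}
    {D : MultilinearMap ℝ (fun _ : Fin m => X) ℝ} (hD : IsPositiveForm D)
    (hQ : FormDominates D (restrictReal Q)) {ρ C : ℝ} (hρ : 0 < ρ)
    (hC : ∀ y : X, 0 ≤ y → ‖y‖ ≤ ρ → D (fun _ => y) ≤ C) (w : Fin m → 𝓔) :
    ‖Q w‖ ≤ C * (Real.exp 1 / ρ) ^ m * ∏ i, ‖w i‖ := by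
  have hC0 : 0 ≤ C := (hD.2 _ fun _ => le_rfl).trans (hC 0 le_rfl (by simpa using hρ.le))
  have hunit : ∀ w : Fin m → 𝓔, (∀ i, ‖w i‖ ≤ 1) → ‖Q w‖ ≤ C * (Real.exp 1 / ρ) ^ m := by
    intro w hw
    refine (norm_le_of_formDominates hQ w).trans ?_
    set S : X := ∑ i, (w i).modulus with hS
    have hS0 : 0 ≤ S := Finset.sum_nonneg fun i _ => modulus_nonneg _
    have hSn : ‖S‖ ≤ m := by
      refine (norm_sum_le_of_le Finset.univ (f := fun i => (w i).modulus) (n := fun _ => (1 : ℝ)) fun i _ => hw i).trans ?_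
      simp
    have h1 := hD.factorial_mul_le (x := fun i => (w i).modulus) fun i => modulus_nonneg _
    rw [← hS] at h1
    have h2 : D (fun _ => S) ≤ (m / ρ) ^ m * C := by
      rcases Nat.eq_zero_or_pos m with rfl | hm
      · have : (fun _ : Fin 0 => S) = fun _ => (0 : X) := Subsingleton.elim _ _
        rw [this]
        simpa using hC 0 le_rfl (by simpa using hρ.le)
      · have hm' : (0 : ℝ) < m := by exact_mod_cast hm
        have e : S = (m / ρ) • (ρ / m) • S := by
          rw [smul_smul]
          have : (m / ρ) * (ρ / m) = 1 := by field_simp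
          rw [this, one_smul]
        rw [e, MultilinearMap.map_const_smul]
        refine mul_le_mul_of_nonneg_left (hC _ (smul_nonneg (by positivity) hS0) ?_)
          (by positivity)
        rw [norm_smul, Real.norm_of_nonneg (by positivity)]
        calc ρ / m * ‖S‖ ≤ ρ / m * m := by gcongr
          _ = ρ := by field_simp
    have hfac : (0 : ℝ) < m.factorial := by exact_mod_cast m.factorial_pos
    have h3 := Real.pow_div_factorial_le_exp (m : ℝ) (Nat.cast_nonneg m) m
    have h4 : Real.exp m = Real.exp 1 ^ m := by rw [← Real.exp_nat_mul, mul_one]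
    calc D (fun i => (w i).modulus) ≤ ((m / ρ) ^ m * C) / m.factorial := by
          rw [le_div_iff₀ hfac, mul_comm]
          exact h1.trans h2
      _ = C * ((m : ℝ) ^ m / m.factorial) * (1 / ρ) ^ m := by
          rw [div_pow, div_pow, one_pow]; ring
      _ ≤ C * Real.exp m * (1 / ρ) ^ m := by gcongr
      _ = C * (Real.exp 1 / ρ) ^ m := by rw [h4, div_pow, div_pow, one_pow]; ring
  have e : w = fun i => ((‖w i‖ : ℝ) : ℂ) • ((‖w i‖⁻¹ : ℝ) : ℂ) • w i := by
    ext1 i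
    rcases eq_or_ne (w i) 0 with h | h
    · rw [h, smul_zero, smul_zero]
    · rw [smul_smul, ← Complex.ofReal_mul, mul_inv_cancel₀ (norm_ne_zero_iff.2 h),
        Complex.ofReal_one, one_smul]
  have h5 := hunit (fun i => ((‖w i‖⁻¹ : ℝ) : ℂ) • w i) fun i => by
    rw [norm_smul, Complex.norm_real, norm_inv, norm_norm]
    exact inv_mul_le_one
  conv_lhs => rw [e]
  rw [Q.map_smul_univ, norm_smul, norm_prod]
  simp only [Complex.norm_real, norm_norm]
  rw [mul_comm]
  exact mul_le_mul_of_nonneg_right h5 (Finset.prod_nonneg fun i _ => norm_nonneg _)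

theorem IsPositiveForm.abs_apply_le {B : MultilinearMap ℝ (fun _ : Fin m => X) ℝ}
    (hB : IsPositiveForm B) (x : Fin m → X) : |B x| ≤ B fun i => |x i| := by
  have := norm_le_of_formDominates (formDominates_complexifyMap hB) fun i => ofReal (x i)
  rw [← restrictReal_apply, restrictReal_complexifyMap, Complex.norm_real] at this
  simpa only [modulus_ofReal, Real.norm_eq_abs] using this

/-! ### The regular norm -/

/-- The supremum over the complex unit ball is controlled by positive vectors, because the
complexified modulus at `z` is at most its value at `|z|`. -/
theorem regularNorm_le {P : MultilinearMap ℂ (fun _ : Fin m => 𝓔) ℂ} (hP : IsRegularForm P)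
    {D : MultilinearMap ℝ (fun _ : Fin m => X) ℝ} (hD : IsPositiveForm D)
    (h : FormDominates D (restrictReal P)) {C : ℝ}
    (hC : ∀ x : X, 0 ≤ x → ‖x‖ ≤ 1 → D (fun _ => x) ≤ C) :
    regularNorm P ≤ ENNReal.ofReal C := by
  refine iSup₂_le fun z hz => ?_
  rw [← ofReal_norm]
  refine ENNReal.ofReal_le_ofReal ?_
  have h1 := norm_le_of_formDominates (formDominates_complexifyMap hP.isPositiveForm) fun _ => z
  exact h1.trans ((hP.formModulus_le hD h fun _ => modulus_nonneg z).trans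
    (hC _ (modulus_nonneg z) hz))

theorem ofReal_apply_le_regularNorm (P : MultilinearMap ℂ (fun _ : Fin m => 𝓔) ℂ) {x : X}
    (hx : ‖x‖ ≤ 1) : ENNReal.ofReal ((formModulus P).1 fun _ => x) ≤ regularNorm P := by
  refine le_trans ?_ (le_iSup₂ (f := fun (z : 𝓔) (_ : ‖z‖ ≤ 1) =>
    ‖complexifyForm (formModulus P).1 fun _ => z‖ₑ) (ofReal x) (by rwa [norm_ofReal]))
  have := restrictReal_complexifyMap (formModulus P).1 fun _ => x
  rw [restrictReal_apply, complexifyMap_apply] at this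
  rw [this, ← ofReal_norm, Complex.norm_real]
  exact ENNReal.ofReal_le_ofReal (Real.le_norm_self _)

end PositiveBounds

/-! ### Root test -/

section RootTest

open Filter

theorem eventually_mul_pow_le_one_of_lt {a : ℕ → ℝ≥0∞} {c s : ℝ≥0∞} (hs0 : s ≠ 0)
    (hsc : s < c) (h : c ≤ (limsup (fun m : ℕ => a m ^ (1 / (m : ℝ))) atTop)⁻¹) :
    ∀ᶠ m in atTop, a m * s ^ m ≤ 1 := by
  have hs : s ≠ ∞ := hsc.ne_top
  have h1 : limsup (fun m : ℕ => a m ^ (1 / (m : ℝ))) atTop < s⁻¹ := by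
    rw [ENNReal.lt_inv_iff_lt_inv]
    exact hsc.trans_le h
  -- The index `m = 0` is excluded because there the exponent `1 / m` is `0`.
  filter_upwards [eventually_lt_of_limsup_lt h1, eventually_ge_atTop 1] with m hm hm1
  have hm0 : (0 : ℝ) < m := by exact_mod_cast hm1
  have h2 : a m ≤ (s⁻¹) ^ m := by
    have := ENNReal.rpow_le_rpow hm.le hm0.le
    rwa [← ENNReal.rpow_mul, one_div, inv_mul_cancel₀ hm0.ne', ENNReal.rpow_one,
      ENNReal.rpow_natCast] at this
  calc a m * s ^ m ≤ (s⁻¹) ^ m * s ^ m := by gcongr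
    _ = 1 := by rw [← mul_pow, ENNReal.inv_mul_cancel hs0 hs, one_pow]

/-- Between `s` and `c` a further `t` is inserted: a bound `K` at radius `t` becomes `K * (s / t) ^
m` at radius `s`, which is eventually at most `1`. -/
theorem le_inv_limsup_of_forall_bound {a : ℕ → ℝ≥0∞} {c : ℝ≥0∞}
    (h : ∀ s : NNReal, 0 < s → (s : ℝ≥0∞) < c →
      ∃ K : NNReal, ∀ᶠ m in atTop, a m * (s : ℝ≥0∞) ^ m ≤ K) :
    c ≤ (limsup (fun m : ℕ => a m ^ (1 / (m : ℝ))) atTop)⁻¹ := by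
  refine le_of_forall_lt fun s' hs' => ?_
  obtain ⟨s, hs's, hsc⟩ := ENNReal.lt_iff_exists_nnreal_btwn.1 hs'
  refine hs's.trans_le ?_
  have hs0 : 0 < s := by
    have := (zero_le (a := s')).trans_lt hs's
    exact_mod_cast this
  obtain ⟨t, hst, htc⟩ := ENNReal.lt_iff_exists_nnreal_btwn.1 hsc
  have hst' : s < t := by exact_mod_cast hst
  have ht0 : 0 < t := hs0.trans hst'
  obtain ⟨K, hK⟩ := h t ht0 htc
  rw [ENNReal.le_inv_iff_le_inv]
  have hq : s / t < 1 := (div_lt_one ht0).2 hst'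
  have hlim : Tendsto (fun m : ℕ => K * (s / t) ^ m) atTop (𝓝 0) := by
    simpa using (tendsto_pow_atTop_nhds_zero_of_lt_one zero_le hq).const_mul K
  refine limsup_le_of_le (by isBoundedDefault) ?_
  filter_upwards [hK, hlim.eventually (ge_mem_nhds one_pos), eventually_ge_atTop 1]
    with m hm hm2 hm1
  have hm0 : (0 : ℝ) < m := by exact_mod_cast hm1
  have hsne : (s : ℝ≥0∞) ≠ 0 := by exact_mod_cast hs0.ne'
  have h1 : a m * (s : ℝ≥0∞) ^ m ≤ 1 := by
    have e : (s : ℝ≥0∞) = t * ((s / t : NNReal) : ℝ≥0∞) := by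
      rw [← ENNReal.coe_mul, mul_div_cancel₀ _ ht0.ne']
    rw [e, mul_pow, ← mul_assoc]
    calc a m * (t : ℝ≥0∞) ^ m * ((s / t : NNReal) : ℝ≥0∞) ^ m
        ≤ K * ((s / t : NNReal) : ℝ≥0∞) ^ m := by gcongr
      _ ≤ 1 := by exact_mod_cast hm2
  have h2 : a m ≤ ((s : ℝ≥0∞)⁻¹) ^ m := by
    calc a m = a m * (s : ℝ≥0∞) ^ m * ((s : ℝ≥0∞)⁻¹) ^ m := by
          rw [mul_assoc, ← mul_pow, ENNReal.mul_inv_cancel hsne ENNReal.coe_ne_top, one_pow,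
            mul_one]
      _ ≤ 1 * ((s : ℝ≥0∞)⁻¹) ^ m := by gcongr
      _ = _ := one_mul _
  calc a m ^ (1 / (m : ℝ)) ≤ (((s : ℝ≥0∞)⁻¹) ^ m) ^ (1 / (m : ℝ)) :=
        ENNReal.rpow_le_rpow h2 (by positivity)
    _ = (s : ℝ≥0∞)⁻¹ := by
        rw [← ENNReal.rpow_natCast, ← ENNReal.rpow_mul, one_div, mul_inv_cancel₀ hm0.ne',
          ENNReal.rpow_one]

end RootTest

/-! ### Sums of multilinear forms -/

section FormSeries

open Finset.HasAntidiagonal (antidiagonal sigmaAntidiagonalEquivProd)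

/-- The pointwise sum of a pointwise summable sequence of multilinear forms. -/
noncomputable def MultilinearMap.tsumOfSummable {𝕜 V : Type*} [RCLike 𝕜] [AddCommMonoid V]
    [Module 𝕜 V] {k : ℕ} (F : ℕ → MultilinearMap 𝕜 (fun _ : Fin k => V) 𝕜)
    (h : ∀ w, Summable fun l => F l w) : MultilinearMap 𝕜 (fun _ : Fin k => V) 𝕜 where
  toFun w := ∑' l, F l w
  map_update_add' w i a b := by
    simp only [MultilinearMap.map_update_add]
    exact (h _).tsum_add (h _)
  map_update_smul' w i c a := by
    simp only [MultilinearMap.map_update_smul, smul_eq_mul]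
    exact tsum_mul_left

/-- Rearrangement of a double series from diagonals to rows. Nonnegativity of `H` turns summability
of its diagonal sums into absolute summability of the double series. -/
theorem hasSum_tsum_of_summable_antidiagonal {G : Type*} [NormedAddCommGroup G]
    [CompleteSpace G] {F : ℕ × ℕ → G} {H : ℕ × ℕ → ℝ} (hFH : ∀ p, ‖F p‖ ≤ H p)
    (hH : Summable fun m => ∑ p ∈ antidiagonal m, H p) :
    HasSum (fun k => ∑' l, F (k, l)) (∑' m, ∑ p ∈ antidiagonal m, F p) := by
  have hH0 : ∀ p, 0 ≤ H p := fun p => (norm_nonneg _).trans (hFH p)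
  have hHs : Summable H := by
    rw [← (sigmaAntidiagonalEquivProd (A := ℕ)).summable_iff, summable_sigma_of_nonneg]
    · refine ⟨fun m => Summable.of_finite, ?_⟩
      convert hH using 2 with m
      rw [tsum_fintype]
      exact Finset.sum_coe_sort (antidiagonal m) H
    · exact fun _ => hH0 _
  have hFs : Summable F := Summable.of_norm_bounded hHs hFH
  have h1 : ∑' m, ∑ p ∈ antidiagonal m, F p = ∑' p, F p := by
    rw [← (sigmaAntidiagonalEquivProd (A := ℕ)).tsum_eq F,
      Summable.tsum_sigma (f := fun c => F (sigmaAntidiagonalEquivProd c))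
        ((sigmaAntidiagonalEquivProd (A := ℕ)).summable_iff.2 hFs)]
    refine tsum_congr fun m => ?_
    rw [tsum_fintype]
    exact (Finset.sum_coe_sort (antidiagonal m) F).symm
  rw [h1]
  exact hFs.hasSum.prod_fiberwise fun k => (hFs.prod_factor k).hasSum

end FormSeries

/-! ### Dominated families and their re-expansion at other points -/

section DominatedFamilies

open Finset.HasAntidiagonal (antidiagonal)

/-- The `l`-th summand of the `k`-th Taylor coefficient at `v` of `∑ₘ Rₘ`. -/
def shiftTerm {𝕜 V : Type*} [RCLike 𝕜] [AddCommMonoid V] [Module 𝕜 V]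
    (R : ∀ m : ℕ, MultilinearMap 𝕜 (fun _ : Fin m => V) 𝕜) (v : V) (k l : ℕ) :
    MultilinearMap 𝕜 (fun _ : Fin k => V) 𝕜 :=
  ((k + l).choose k : 𝕜) • (R (k + l)).partialDiag v

theorem shiftTerm_apply {𝕜 V : Type*} [RCLike 𝕜] [AddCommMonoid V] [Module 𝕜 V]
    (R : ∀ m : ℕ, MultilinearMap 𝕜 (fun _ : Fin m => V) 𝕜) (v : V) (k l : ℕ) (w : Fin k → V) :
    shiftTerm R v k l w = ((k + l).choose k : 𝕜) * R (k + l) (Fin.append w fun _ => v) := rfl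

theorem sum_antidiagonal_shiftTerm {𝕜 V : Type*} [RCLike 𝕜] [AddCommMonoid V] [Module 𝕜 V]
    {R : ∀ m : ℕ, MultilinearMap 𝕜 (fun _ : Fin m => V) 𝕜}
    (hR : ∀ m (σ : Equiv.Perm (Fin m)) x, R m (fun i => x (σ i)) = R m x) (w v : V) (m : ℕ) :
    ∑ p ∈ antidiagonal m, shiftTerm R v p.1 p.2 (fun _ => w) = R m fun _ => w + v := by
  rw [MultilinearMap.map_add_diag_antidiagonal hR]
  refine Finset.sum_congr rfl fun p _ => ?_
  rw [shiftTerm_apply, nsmul_eq_mul]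
  rfl

variable {X : Type*} [NormedAddCommGroup X] [Lattice X] [HasSolidNorm X] [IsOrderedAddMonoid X]
  [NormedSpace ℝ X] [IsOrderedModule ℝ X] [CompleteSpace X]

local notation "𝓔" => LatticeComplexification X

open LatticeComplexification

/-- A sequence of symmetric complex forms `Rₘ` dominated by positive forms `Bₘ` whose diagonal
values are bounded on every ball of radius less than `r`. -/
structure IsDominatedFamily (r : ℝ) (R : ∀ m : ℕ, MultilinearMap ℂ (fun _ : Fin m => 𝓔) ℂ)
    (B : ∀ m : ℕ, MultilinearMap ℝ (fun _ : Fin m => X) ℝ) : Prop where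
  pos : ∀ m, IsPositiveForm (B m)
  symm : ∀ m (σ : Equiv.Perm (Fin m)) z, R m (fun i => z (σ i)) = R m z
  dom : ∀ m, FormDominates (B m) (restrictReal (R m))
  bound : ∀ s, 0 < s → s < r → ∃ C, ∀ m (y : X), 0 ≤ y → ‖y‖ ≤ s → B m (fun _ => y) ≤ C

variable {r : ℝ} {R : ∀ m : ℕ, MultilinearMap ℂ (fun _ : Fin m => LatticeComplexification X) ℂ}
  {B : ∀ m : ℕ, MultilinearMap ℝ (fun _ : Fin m => X) ℝ}

namespace IsDominatedFamily

/-- A diagonal bound at the intermediate radius `s` gains the factor `(t / s) ^ m` at radius `t`, by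
homogeneity. -/
theorem geometric_bound (h : IsDominatedFamily r R B) {t : ℝ} (ht0 : 0 ≤ t) (ht : t < r) :
    ∃ C q, 0 ≤ C ∧ 0 ≤ q ∧ q < 1 ∧
      ∀ m (y : X), 0 ≤ y → ‖y‖ ≤ t → B m (fun _ => y) ≤ C * q ^ m := by
  set s := (t + r) / 2
  have hts : t < s := by simp only [s]; linarith
  have hs0 : 0 < s := ht0.trans_lt hts
  obtain ⟨C, hC⟩ := h.bound s hs0 (by simp only [s]; linarith)
  have hC0 : 0 ≤ C := ((h.pos 0).2 _ fun _ => le_rfl).trans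
    (hC 0 0 le_rfl (by simpa using hs0.le))
  refine ⟨C, t / s, hC0, by positivity, (div_lt_one hs0).2 hts, fun m y hy hyt => ?_⟩
  have e : y = (t / s) • (s / t) • y := by
    rcases eq_or_lt_of_le ht0 with h0 | hpos
    · have : y = 0 := by
        rw [← norm_le_zero_iff, h0]; exact hyt
      rw [this, smul_zero, smul_zero]
    · rw [smul_smul]
      have : t / s * (s / t) = 1 := by field_simp
      rw [this, one_smul]
  rw [e, MultilinearMap.map_const_smul, mul_comm]
  refine mul_le_mul_of_nonneg_right (hC m _ (smul_nonneg (by positivity) hy) ?_) (by positivity)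
  rw [norm_smul, Real.norm_of_nonneg (by positivity)]
  rcases eq_or_lt_of_le ht0 with h0 | hpos
  · rw [← h0]; simpa using hs0.le
  · calc s / t * ‖y‖ ≤ s / t * t := by gcongr
      _ = s := by field_simp

theorem summable_diagonal (h : IsDominatedFamily r R B) {y : X} (hy : 0 ≤ y) (hyr : ‖y‖ < r) :
    Summable fun m => B m fun _ => y := by
  obtain ⟨C, q, hC, hq0, hq1, hb⟩ := h.geometric_bound (norm_nonneg y) hyr
  exact Summable.of_nonneg_of_le (fun m => (h.pos m).2 _ fun _ => hy)
    (fun m => hb m y hy le_rfl) ((summable_geometric_of_lt_one hq0 hq1).mul_left C)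

theorem shiftTerm_nonneg (h : IsDominatedFamily r R B) {u : X} (hu : 0 ≤ u) {k l : ℕ}
    {x : Fin k → X} (hx : ∀ i, 0 ≤ x i) : 0 ≤ shiftTerm B u k l x := by
  rw [shiftTerm_apply]
  refine mul_nonneg (Nat.cast_nonneg _) ((h.pos _).2 _ fun i => ?_)
  refine Fin.addCases (fun j => ?_) (fun j => ?_) i
  · simpa using hx j
  · simpa using hu

theorem shiftTerm_diagonal_le (h : IsDominatedFamily r R B) {x u : X} (hx : 0 ≤ x)
    (hu : 0 ≤ u) (k l : ℕ) :
    shiftTerm B u k l (fun _ => x) ≤ B (k + l) fun _ => x + u := by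
  rw [← sum_antidiagonal_shiftTerm (fun m => (h.pos m).1) x u (k + l)]
  exact Finset.single_le_sum (f := fun p : ℕ × ℕ => shiftTerm B u p.1 p.2 fun _ => x)
    (fun p _ => h.shiftTerm_nonneg hu fun _ => hx) (a := (k, l)) (by simp)

/-- All arguments are raised to their sum `S`, and `S` is scaled by `δ` so that `δ • S + u` stays
inside the ball, at the price of `δ⁻¹ ^ k`. Each term is then one nonnegative summand of the
binomial expansion of `B (k + l)` at `δ • S + u`. -/
theorem summable_shiftTerm_of_nonneg (h : IsDominatedFamily r R B) {u : X} (hu : 0 ≤ u)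
    (hur : ‖u‖ < r) {k : ℕ} {x : Fin k → X} (hx : ∀ i, 0 ≤ x i) :
    Summable fun l => shiftTerm B u k l x := by
  set S : X := ∑ i, x i
  have hS : 0 ≤ S := Finset.sum_nonneg fun i _ => hx i
  have hxS : ∀ i, x i ≤ S := fun i => Finset.single_le_sum (fun j _ => hx j) (Finset.mem_univ i)
  obtain ⟨δ, hδ0, hδ⟩ : ∃ δ : ℝ, 0 < δ ∧ ‖u‖ + δ * ‖S‖ < r := by
    refine ⟨(r - ‖u‖) / (2 * (‖S‖ + 1)), by have := sub_pos.2 hur; positivity, ?_⟩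
    have h1 : (r - ‖u‖) / (2 * (‖S‖ + 1)) * ‖S‖ = (r - ‖u‖) / 2 * (‖S‖ / (‖S‖ + 1)) := by
      field_simp
    have h2 : ‖S‖ / (‖S‖ + 1) ≤ 1 := (div_le_one (by positivity)).2 (by linarith)
    rw [h1]
    nlinarith
  have hnorm : ‖δ • S + u‖ < r := by
    refine (norm_add_le _ _).trans_lt ?_
    rw [norm_smul, Real.norm_of_nonneg hδ0.le]
    linarith
  have hδS : 0 ≤ δ • S := smul_nonneg hδ0.le hS
  have hsum := h.summable_diagonal (add_nonneg hδS hu) hnorm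
  have hsum' : Summable fun l => (δ⁻¹) ^ k * B (k + l) fun _ => δ • S + u := by
    refine Summable.mul_left _ ?_
    have := (summable_nat_add_iff k).2 hsum
    refine this.congr fun l => ?_
    rw [add_comm k l]
  refine Summable.of_nonneg_of_le (fun l => h.shiftTerm_nonneg hu hx) (fun l => ?_) hsum'
  have h1 : shiftTerm B u k l x ≤ shiftTerm B u k l fun _ => S :=
    MultilinearMap.mono_of_nonneg (fun x hx => h.shiftTerm_nonneg hu hx) hx hxS
  have h2 : shiftTerm B u k l (fun _ => S) = (δ⁻¹) ^ k * shiftTerm B u k l fun _ => δ • S := by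
    rw [MultilinearMap.map_const_smul, ← mul_assoc, ← mul_pow, inv_mul_cancel₀ hδ0.ne', one_pow,
      one_mul]
  refine h1.trans (h2.le.trans ?_)
  gcongr
  exact h.shiftTerm_diagonal_le hδS hu k l

theorem shiftTerm_symm {𝕜 V : Type*} [RCLike 𝕜] [AddCommMonoid V] [Module 𝕜 V]
    {R : ∀ m : ℕ, MultilinearMap 𝕜 (fun _ : Fin m => V) 𝕜}
    (hR : ∀ m (σ : Equiv.Perm (Fin m)) x, R m (fun i => x (σ i)) = R m x) (v : V) (k l : ℕ)
    (σ : Equiv.Perm (Fin k)) (w : Fin k → V) :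
    shiftTerm R v k l (fun i => w (σ i)) = shiftTerm R v k l w :=
  congrArg (fun t => ((k + l).choose k : 𝕜) * t)
    (MultilinearMap.partialDiag_symm (hR (k + l)) v σ w)

theorem isPositiveForm_shiftTerm (h : IsDominatedFamily r R B) {u : X} (hu : 0 ≤ u) (k l : ℕ) :
    IsPositiveForm (shiftTerm B u k l) :=
  ⟨fun σ x => shiftTerm_symm (fun m => (h.pos m).1) u k l σ x,
    fun _ hx => h.shiftTerm_nonneg hu hx⟩

theorem summable_shiftTerm_real (h : IsDominatedFamily r R B) {u : X} (hu : 0 ≤ u)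
    (hur : ‖u‖ < r) {k : ℕ} (x : Fin k → X) : Summable fun l => shiftTerm B u k l x :=
  Summable.of_norm_bounded (h.summable_shiftTerm_of_nonneg hu hur fun i => abs_nonneg (x i))
    fun l => (h.isPositiveForm_shiftTerm hu k l).abs_apply_le x

theorem norm_shiftTerm_le (h : IsDominatedFamily r R B) (v : 𝓔) {k l : ℕ} (w : Fin k → 𝓔) :
    ‖shiftTerm R v k l w‖ ≤ shiftTerm B v.modulus k l fun i => (w i).modulus := by
  rw [shiftTerm_apply, shiftTerm_apply, norm_mul, RCLike.norm_natCast]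
  refine mul_le_mul_of_nonneg_left ?_ (Nat.cast_nonneg _)
  refine (norm_le_of_formDominates (h.dom _) _).trans (le_of_eq ?_)
  congr 1
  ext i
  refine Fin.addCases (fun j => ?_) (fun j => ?_) i
  · simp
  · simp

theorem summable_shiftTerm (h : IsDominatedFamily r R B) {v : 𝓔} (hv : ‖v‖ < r) {k : ℕ}
    (w : Fin k → 𝓔) : Summable fun l => shiftTerm R v k l w :=
  Summable.of_norm_bounded (h.summable_shiftTerm_of_nonneg (modulus_nonneg v) hv
    fun i => modulus_nonneg (w i)) fun _ => h.norm_shiftTerm_le v w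

/-- The `k`-th Taylor form at `v` of `∑ₘ Rₘ`. -/
noncomputable def shift (h : IsDominatedFamily r R B) {v : 𝓔} (hv : ‖v‖ < r) (k : ℕ) :
    MultilinearMap ℂ (fun _ : Fin k => 𝓔) ℂ :=
  MultilinearMap.tsumOfSummable (shiftTerm R v k) fun w => h.summable_shiftTerm hv w

/-- The `k`-th Taylor form at `|v|` of `∑ₘ Bₘ`. -/
noncomputable def shiftMajorant (h : IsDominatedFamily r R B) {v : 𝓔} (hv : ‖v‖ < r) (k : ℕ) :
    MultilinearMap ℝ (fun _ : Fin k => X) ℝ :=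
  MultilinearMap.tsumOfSummable (shiftTerm B v.modulus k) fun x =>
    h.summable_shiftTerm_real (modulus_nonneg v) hv x

theorem shift_apply (h : IsDominatedFamily r R B) {v : 𝓔} (hv : ‖v‖ < r) (k : ℕ)
    (w : Fin k → 𝓔) : h.shift hv k w = ∑' l, shiftTerm R v k l w := rfl

theorem shiftMajorant_apply (h : IsDominatedFamily r R B) {v : 𝓔} (hv : ‖v‖ < r) (k : ℕ)
    (x : Fin k → X) : h.shiftMajorant hv k x = ∑' l, shiftTerm B v.modulus k l x := rfl

theorem shift_symm (h : IsDominatedFamily r R B) {v : 𝓔} (hv : ‖v‖ < r) (k : ℕ)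
    (σ : Equiv.Perm (Fin k)) (w : Fin k → 𝓔) :
    h.shift hv k (fun i => w (σ i)) = h.shift hv k w :=
  tsum_congr fun l => shiftTerm_symm h.symm v k l σ w

theorem isPositiveForm_shiftMajorant (h : IsDominatedFamily r R B) {v : 𝓔} (hv : ‖v‖ < r)
    (k : ℕ) : IsPositiveForm (h.shiftMajorant hv k) :=
  ⟨fun σ x => tsum_congr fun l => (h.isPositiveForm_shiftTerm (modulus_nonneg v) k l).1 σ x,
    fun _ hx => tsum_nonneg fun _ => h.shiftTerm_nonneg (modulus_nonneg v) hx⟩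

theorem formDominates_shiftMajorant (h : IsDominatedFamily r R B) {v : 𝓔} (hv : ‖v‖ < r)
    (k : ℕ) : FormDominates (h.shiftMajorant hv k) (restrictReal (h.shift hv k)) := by
  intro x hx
  rw [restrictReal_apply, shift_apply, shiftMajorant_apply]
  refine tsum_of_norm_bounded
    (h.summable_shiftTerm_of_nonneg (modulus_nonneg v) hv hx).hasSum fun l => ?_
  refine (h.norm_shiftTerm_le v _).trans (le_of_eq ?_)
  simp only [modulus_ofReal, abs_of_nonneg (hx _)]

theorem isRegularForm_shift (h : IsDominatedFamily r R B) {v : 𝓔} (hv : ‖v‖ < r) (k : ℕ) :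
    IsRegularForm (h.shift hv k) :=
  isRegularForm_of_formDominates (fun σ x => h.shift_symm hv k σ fun i => ofReal (x i))
    (h.isPositiveForm_shiftMajorant hv k) (h.formDominates_shiftMajorant hv k)

theorem hasSum_shiftMajorant (h : IsDominatedFamily r R B) {v : 𝓔} (hv : ‖v‖ < r) {y : X}
    (hy : 0 ≤ y) (hvy : ‖y + v.modulus‖ < r) :
    HasSum (fun k => h.shiftMajorant hv k fun _ => y)
      (∑' m, B m fun _ => y + v.modulus) := by
  have hs := h.summable_diagonal (add_nonneg hy (modulus_nonneg v)) hvy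
  simp only [← sum_antidiagonal_shiftTerm (fun m => (h.pos m).1) y v.modulus] at hs ⊢
  exact hasSum_tsum_of_summable_antidiagonal
    (F := fun p => shiftTerm B v.modulus p.1 p.2 fun _ => y)
    (fun p => (Real.norm_of_nonneg (h.shiftTerm_nonneg (modulus_nonneg v) fun _ => hy)).le) hs

theorem summable_apply (h : IsDominatedFamily r R B) {v : 𝓔} (hv : ‖v‖ < r) :
    Summable fun m => R m fun _ => v :=
  Summable.of_norm_bounded (h.summable_diagonal (modulus_nonneg v) hv)
    fun m => norm_le_of_formDominates (h.dom m) _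

/-- The binomial formula expands each `R m` at `w + v`. Convergence of the majorant series at `|w| +
|v|` permits collecting the terms by degree in `w`. -/
theorem hasSum_shift (h : IsDominatedFamily r R B) {v w : 𝓔} (hv : ‖v‖ < r)
    (hvw : ‖w.modulus + v.modulus‖ < r) :
    HasSum (fun k => h.shift hv k fun _ => w) (∑' m, R m fun _ => w + v) := by
  have hs := h.summable_diagonal (add_nonneg (modulus_nonneg w) (modulus_nonneg v)) hvw
  simp only [← sum_antidiagonal_shiftTerm (fun m => (h.pos m).1) w.modulus v.modulus] at hs
  simp only [← sum_antidiagonal_shiftTerm h.symm w v]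
  exact hasSum_tsum_of_summable_antidiagonal
    (F := fun p => shiftTerm R v p.1 p.2 fun _ => w)
    (fun p => h.norm_shiftTerm_le v _) hs

/-- The bound is uniform in `k`: each majorant is one nonnegative term of the series for `∑ B m` at
`y + |v|`, itself below a geometric series. -/
theorem shiftMajorant_le (h : IsDominatedFamily r R B) {v : 𝓔} {ρ : ℝ} (hρ0 : 0 ≤ ρ)
    (hv : ‖v‖ < r) (hρ : ρ + ‖v‖ < r) : ∃ C, ∀ k (y : X), 0 ≤ y → ‖y‖ ≤ ρ →
      h.shiftMajorant hv k (fun _ => y) ≤ C := by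
  obtain ⟨C, q, hC, hq0, hq1, hb⟩ :=
    h.geometric_bound (add_nonneg hρ0 (norm_nonneg v)) hρ
  refine ⟨∑' m, C * q ^ m, fun k y hy hyρ => ?_⟩
  have hn : ‖y + v.modulus‖ ≤ ρ + ‖v‖ :=
    (norm_add_le _ _).trans (add_le_add hyρ (norm_modulus v).le)
  have hs := h.hasSum_shiftMajorant hv hy (hn.trans_lt hρ)
  refine (le_hasSum hs k fun j _ => (h.isPositiveForm_shiftMajorant hv j).2 _ fun _ => hy).trans ?_
  have hyv := add_nonneg hy (modulus_nonneg v)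
  exact (h.summable_diagonal hyv (hn.trans_lt hρ)).tsum_le_tsum (fun m => hb m _ hyv hn)
    ((summable_geometric_of_lt_one hq0 hq1).mul_left C)

theorem shift_zero (h : IsDominatedFamily r R B) (h0 : ‖(0 : 𝓔)‖ < r) (k : ℕ) :
    h.shift h0 k = R k := by
  ext w
  rw [shift_apply, tsum_eq_single 0]
  · rw [shiftTerm_apply]
    have : (Fin.append w fun _ : Fin 0 => (0 : 𝓔)) = w := by
      ext1 i
      exact Fin.append_left w _ i
    simp only [Nat.choose_self, add_zero, Nat.cast_one, one_mul]
    exact congrArg (R k) this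
  · intro l hl
    rw [shiftTerm_apply, (R (k + l)).map_coord_zero (Fin.natAdd k ⟨0, Nat.pos_of_ne_zero hl⟩)
      (Fin.append_right w (fun _ => 0) _), mul_zero]

end IsDominatedFamily

end DominatedFamilies

/-! ### Sums of dominated families are regularly holomorphic -/

section Construction

variable {X : Type*} [NormedAddCommGroup X] [Lattice X] [HasSolidNorm X] [IsOrderedAddMonoid X]
  [NormedSpace ℝ X] [IsOrderedModule ℝ X] [CompleteSpace X]

local notation "𝓔" => LatticeComplexification X

open LatticeComplexification

theorem extendZero_apply {E : Type*} {U : Set E} (f : U → ℂ) {z : E} (hz : z ∈ U) :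
    extendZero f z = f ⟨z, hz⟩ := dif_pos hz

/-- The frontier point on the ray from `z₀` through `z` realises the bound; at the centre any
direction will do. In the zero space the frontier is empty, so nontriviality is needed. -/
theorem infEDist_frontier_ball_le [Nontrivial 𝓔] {z₀ z : 𝓔} {r : ℝ} (hr : 0 < r)
    (hz : ‖z - z₀‖ < r) :
    Metric.infEDist z (frontier (Metric.ball z₀ r)) ≤ ENNReal.ofReal (r - ‖z - z₀‖) := by
  obtain ⟨d, hd1, hd⟩ : ∃ d : 𝓔, ‖d‖ = 1 ∧ z - z₀ = (‖z - z₀‖ : ℂ) • d := by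
    rcases eq_or_ne (z - z₀) 0 with h | h
    · obtain ⟨x, hx⟩ := exists_ne (0 : 𝓔)
      refine ⟨((‖x‖⁻¹ : ℝ) : ℂ) • x, ?_, by rw [h]; simp⟩
      rw [norm_smul, Complex.norm_real, norm_inv, norm_norm,
        inv_mul_cancel₀ (norm_ne_zero_iff.2 hx)]
    · refine ⟨((‖z - z₀‖⁻¹ : ℝ) : ℂ) • (z - z₀), ?_, ?_⟩
      · rw [norm_smul, Complex.norm_real, norm_inv, norm_norm,
          inv_mul_cancel₀ (norm_ne_zero_iff.2 h)]
      · rw [smul_smul, ← Complex.ofReal_mul, mul_inv_cancel₀ (norm_ne_zero_iff.2 h),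
          Complex.ofReal_one, one_smul]
  have hw : z₀ + (r : ℂ) • d ∈ frontier (Metric.ball z₀ r) := by
    rw [frontier_ball z₀ hr.ne', mem_sphere_iff_norm, add_sub_cancel_left, norm_smul, hd1,
      mul_one, Complex.norm_real, Real.norm_of_nonneg hr.le]
  refine (Metric.infEDist_le_edist_of_mem hw).trans (le_of_eq ?_)
  rw [edist_dist, dist_eq_norm]
  congr 1
  have e : z - (z₀ + (r : ℂ) • d) = ((‖z - z₀‖ - r : ℝ) : ℂ) • d := by
    rw [Complex.ofReal_sub, sub_smul, ← hd]
    abel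
  rw [e, norm_smul, hd1, mul_one, Complex.norm_real, Real.norm_eq_abs, abs_sub_comm,
    abs_of_pos (sub_pos.2 hz)]

theorem le_infEDist_frontier_ball (z₀ : 𝓔) (r : ℝ) :
    ENNReal.ofReal r ≤ Metric.infEDist z₀ (frontier (Metric.ball z₀ r)) := by
  refine Metric.le_infEDist.2 fun w hw => ?_
  have := Metric.frontier_ball_subset_sphere hw
  rw [edist_comm, edist_dist, Metric.mem_sphere.1 this]

namespace IsDominatedFamily

variable {r : ℝ} {R : ∀ m : ℕ, MultilinearMap ℂ (fun _ : Fin m => LatticeComplexification X) ℂ}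
  {B : ∀ m : ℕ, MultilinearMap ℝ (fun _ : Fin m => X) ℝ}
  {z₀ z : LatticeComplexification X} {f : Metric.ball z₀ r → ℂ}

/-- The shifted majorants are bounded on the ball of radius `ρ`, half the distance from `z` to the
sphere. Passing from diagonal bounds to multilinear norms costs a factor `e ^ k`, hence convergence
is claimed only up to `ρ / e`. -/
theorem exists_hasFPowerSeriesOnBall (h : IsDominatedFamily r R B)
    (hf : ∀ z : Metric.ball z₀ r, HasSum (fun m => R m fun _ => z.1 - z₀) (f z))
    (hz : ‖z - z₀‖ < r) : ∃ (p : FormalMultilinearSeries ℂ (LatticeComplexification X) ℂ)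
      (ρ : ℝ≥0∞), HasFPowerSeriesOnBall (extendZero f) p z ρ ∧
        ∀ k, (p k).toMultilinearMap = h.shift hz k := by
  set ρ := (r - ‖z - z₀‖) / 2 with hρ
  have hρ0 : 0 < ρ := by have := sub_pos.2 hz; positivity
  have hρr : ρ + ‖z - z₀‖ < r := by rw [hρ]; linarith
  obtain ⟨C, hC⟩ := h.shiftMajorant_le hρ0.le hz hρr
  have hC0 : 0 ≤ C := ((h.isPositiveForm_shiftMajorant hz 0).2 _ fun _ => le_rfl).trans
    (hC 0 0 le_rfl (by simpa using hρ0.le))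
  have hb := fun k => norm_le_of_diagonal_bound (h.isPositiveForm_shiftMajorant hz k)
    (h.formDominates_shiftMajorant hz k) hρ0 (hC k)
  let p : FormalMultilinearSeries ℂ 𝓔 ℂ := fun k => (h.shift hz k).mkContinuous _ (hb k)
  have hρe : 0 < ρ / Real.exp 1 := by positivity
  have hρe' : ρ / Real.exp 1 ≤ ρ := div_le_self hρ0.le (Real.one_le_exp zero_le_one)
  refine ⟨p, ENNReal.ofReal (ρ / Real.exp 1), ⟨?_, ENNReal.ofReal_pos.2 hρe, ?_⟩, fun k => rfl⟩
  · refine p.le_radius_of_bound C fun k => ?_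
    have h1 : ‖p k‖ ≤ C * (Real.exp 1 / ρ) ^ k :=
      MultilinearMap.mkContinuous_norm_le _ (by positivity) _
    rw [Real.coe_toNNReal _ hρe.le]
    calc ‖p k‖ * (ρ / Real.exp 1) ^ k
        ≤ C * (Real.exp 1 / ρ) ^ k * (ρ / Real.exp 1) ^ k := by gcongr
      _ = C * ((Real.exp 1 / ρ) * (ρ / Real.exp 1)) ^ k := by rw [mul_pow]; ring
      _ = C := by
        have : Real.exp 1 / ρ * (ρ / Real.exp 1) = 1 := by
          have := Real.exp_pos 1
          field_simp
        rw [this, one_pow, mul_one]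
  · intro w hw
    rw [Metric.mem_eball, edist_zero_right, ← ofReal_norm,
      ENNReal.ofReal_lt_ofReal_iff hρe] at hw
    have hwρ : ‖w‖ < ρ := hw.trans_le hρe'
    have hsum : ‖w.modulus + (z - z₀).modulus‖ < r := by
      refine (norm_add_le _ _).trans_lt ?_
      rw [norm_modulus, norm_modulus]
      linarith
    have hmem : z + w ∈ Metric.ball z₀ r := by
      rw [mem_ball_iff_norm, add_sub_right_comm]
      refine (norm_add_le _ _).trans_lt ?_
      linarith
    have h2 := h.hasSum_shift hz hsum
    have h3 := (hf ⟨z + w, hmem⟩).tsum_eq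
    have e : z + w - z₀ = w + (z - z₀) := by abel
    simp only [e] at h3
    rw [extendZero_apply f hmem, ← h3]
    exact h2

/-- The `k`-th derivative is the sum of the power series coefficient over all permutations of its
arguments; symmetry makes this `k!` equal terms. -/
theorem taylorForm_eq_shift (h : IsDominatedFamily r R B)
    (hf : ∀ z : Metric.ball z₀ r, HasSum (fun m => R m fun _ => z.1 - z₀) (f z))
    (hz : ‖z - z₀‖ < r) (k : ℕ) : taylorForm f z k = h.shift hz k := by
  obtain ⟨p, ρ, hp, hpk⟩ := h.exists_hasFPowerSeriesOnBall hf hz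
  ext w
  have h1 := hp.iteratedFDeriv_eq_sum_of_completeSpace w
  have h2 : ∀ σ : Equiv.Perm (Fin k), p k (fun i => w (σ i)) = h.shift hz k w := by
    intro σ
    rw [← h.shift_symm hz k σ w, ← hpk]
    rfl
  simp only [h2, Finset.sum_const, Finset.card_univ, Fintype.card_perm, Fintype.card_fin] at h1
  change (k.factorial : ℂ)⁻¹ * iteratedFDeriv ℂ k (extendZero f) z w = _
  rw [h1, nsmul_eq_mul, ← mul_assoc, inv_mul_cancel₀, one_mul]
  exact_mod_cast k.factorial_ne_zero

theorem taylorForm_center (h : IsDominatedFamily r R B) (hr : 0 < r)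
    (hf : ∀ z : Metric.ball z₀ r, HasSum (fun m => R m fun _ => z.1 - z₀) (f z)) (k : ℕ) :
    taylorForm f z₀ k = R k := by
  have h0 : ‖(0 : 𝓔)‖ < r := by simpa using hr
  have hz : ‖z₀ - z₀‖ < r := by simpa using hr
  rw [h.taylorForm_eq_shift hf hz k, ← h.shift_zero h0 k]
  congr 1
  exact sub_self z₀

/-- At each `z` the Taylor forms are the shifted forms, so regularity and convergence come from the
shifted majorants. These are bounded on every ball of radius less than `r - ‖z - z₀‖`, which yields
the radius condition. -/
theorem isRegularlyHolomorphicOfBoundedType (h : IsDominatedFamily r R B) (hr : 0 < r)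
    (hf : ∀ z : Metric.ball z₀ r, HasSum (fun m => R m fun _ => z.1 - z₀) (f z)) :
    IsRegularlyHolomorphicOfBoundedType (Metric.ball z₀ r) f where
  holomorphic z hz := by
    rw [mem_ball_iff_norm] at hz
    obtain ⟨p, ρ, hp, -⟩ := h.exists_hasFPowerSeriesOnBall hf hz
    exact ⟨p, ρ, hp⟩
  regular z hz m := by
    rw [mem_ball_iff_norm] at hz
    rw [h.taylorForm_eq_shift hf hz]
    exact h.isRegularForm_shift hz m
  convergent z hz := by
    rw [mem_ball_iff_norm] at hz
    filter_upwards [Metric.ball_mem_nhds z (sub_pos.2 hz)] with w hw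
    rw [mem_ball_iff_norm] at hw
    simp only [h.taylorForm_eq_shift hf hz]
    have hsum : ‖(w - z).modulus + (z - z₀).modulus‖ < r := by
      refine (norm_add_le _ _).trans_lt ?_
      rw [norm_modulus, norm_modulus]
      linarith
    refine Summable.of_nonneg_of_le
      (fun m => (h.isRegularForm_shift hz m).isPositiveForm.2 _ fun _ => modulus_nonneg _)
      (fun m => ?_) (h.hasSum_shiftMajorant hz (modulus_nonneg (w - z)) hsum).summable
    exact (h.isRegularForm_shift hz m).formModulus_le (h.isPositiveForm_shiftMajorant hz m)
      (h.formDominates_shiftMajorant hz m) fun _ => modulus_nonneg _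
  radius z hz := by
    rw [mem_ball_iff_norm] at hz
    rw [regularRadius]
    simp only [h.taylorForm_eq_shift hf hz]
    refine le_inv_limsup_of_forall_bound fun s hs0 hs => ?_
    have hs0' : (0 : ℝ) < s := hs0
    obtain ⟨C, hC⟩ : ∃ C, ∀ k (y : X), 0 ≤ y → ‖y‖ ≤ s →
        h.shiftMajorant hz k (fun _ => y) ≤ C := by
      -- In the zero space the frontier is empty and `s` is arbitrary, but then every `y` is zero.
      rcases subsingleton_or_nontrivial 𝓔 with hE | hE
      · obtain ⟨C, hC⟩ := h.shiftMajorant_le le_rfl hz (by rwa [zero_add])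
        refine ⟨C, fun k y hy _ => hC k y hy ?_⟩
        rw [← norm_ofReal, Subsingleton.elim (ofReal y) 0, norm_zero]
      · refine h.shiftMajorant_le s.2 hz ?_
        have := hs.trans_le (infEDist_frontier_ball_le hr hz)
        rw [← ENNReal.ofReal_coe_nnreal, ENNReal.ofReal_lt_ofReal_iff (sub_pos.2 hz)] at this
        change (s : ℝ) + _ < r
        linarith
    refine ⟨C.toNNReal, Filter.Eventually.of_forall fun k => ?_⟩
    have h1 := regularNorm_le (h.isRegularForm_shift hz k) (h.isPositiveForm_shiftMajorant hz k)
      (h.formDominates_shiftMajorant hz k) (C := C / (s : ℝ) ^ k) fun x hx hx1 => by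
        rw [le_div_iff₀ (by positivity), mul_comm, ← MultilinearMap.map_const_smul]
        refine hC k _ (smul_nonneg hs0'.le hx) ?_
        rw [norm_smul, Real.norm_of_nonneg hs0'.le]
        exact mul_le_of_le_one_right hs0'.le hx1
    calc regularNorm (h.shift hz k) * (s : ℝ≥0∞) ^ k
        ≤ ENNReal.ofReal (C / (s : ℝ) ^ k) * (s : ℝ≥0∞) ^ k := by gcongr
      _ = ENNReal.ofReal (C / (s : ℝ) ^ k * (s : ℝ) ^ k) := by
        rw [ENNReal.ofReal_mul' (by positivity), ENNReal.ofReal_pow hs0'.le,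
          ENNReal.ofReal_coe_nnreal]
      _ = ENNReal.ofReal C := by rw [div_mul_cancel₀ _ (by positivity)]

end IsDominatedFamily

end Construction

/-! ### The complex vector lattice of functions of bounded type on a ball -/

section BoundedType

variable {X : Type*} [NormedAddCommGroup X] [Lattice X] [HasSolidNorm X] [IsOrderedAddMonoid X]
  [NormedSpace ℝ X] [IsOrderedModule ℝ X] [CompleteSpace X]

local notation "𝓔" => LatticeComplexification X

open LatticeComplexification

namespace IsDominatedFamily

variable {r : ℝ} {R S : ∀ m : ℕ, MultilinearMap ℂ (fun _ : Fin m => LatticeComplexification X) ℂ}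
  {B C : ∀ m : ℕ, MultilinearMap ℝ (fun _ : Fin m => X) ℝ}

theorem zero (r : ℝ) : IsDominatedFamily (X := X) r (fun _ => 0) fun _ => 0 where
  pos _ := .zero
  symm _ _ _ := rfl
  dom _ x _ := by simp [restrictReal_apply]
  bound _ _ _ := ⟨0, fun _ _ _ _ => le_rfl⟩

theorem add (h : IsDominatedFamily r R B) (k : IsDominatedFamily r S C) :
    IsDominatedFamily r (fun m => R m + S m) fun m => B m + C m where
  pos m := (h.pos m).add (k.pos m)
  symm m σ z := by rw [add_apply, add_apply, h.symm, k.symm]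
  dom m := formDominates_add (h.dom m) (k.dom m)
  bound s hs0 hs := by
    obtain ⟨a, ha⟩ := h.bound s hs0 hs
    obtain ⟨b, hb⟩ := k.bound s hs0 hs
    exact ⟨a + b, fun m y hy hys => add_le_add (ha m y hy hys) (hb m y hy hys)⟩

theorem smul (h : IsDominatedFamily r R B) (α : ℂ) :
    IsDominatedFamily r (fun m => α • R m) fun m => ‖α‖ • B m where
  pos m := (h.pos m).smul (norm_nonneg α)
  symm m σ z := by rw [smul_apply, smul_apply, h.symm]
  dom m := formDominates_smul (h.dom m) α
  bound s hs0 hs := by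
    obtain ⟨a, ha⟩ := h.bound s hs0 hs
    exact ⟨‖α‖ * a, fun m y hy hys => mul_le_mul_of_nonneg_left (ha m y hy hys) (norm_nonneg α)⟩

/-- Any positive family below a multiple of the majorants defines a new function of bounded type. It
is used with `c = 1` for the modulus and `c = 2` for the span. -/
theorem complexifyMap_of_le (h : IsDominatedFamily r R B) (hC : ∀ m, IsPositiveForm (C m))
    {c : ℝ} (hc : 0 ≤ c) (hle : ∀ m (x : Fin m → X), (∀ i, 0 ≤ x i) → C m x ≤ c * B m x) :
    IsDominatedFamily r (fun m => complexifyMap (C m)) C where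
  pos := hC
  symm m := symm_of_restrictReal_symm (isRegularForm_complexifyMap (hC m)).restrictReal_symm
  dom m := formDominates_complexifyMap (hC m)
  bound s hs0 hs := by
    obtain ⟨a, ha⟩ := h.bound s hs0 hs
    exact ⟨c * a, fun m y hy hys => (hle m _ fun _ => hy).trans
      (mul_le_mul_of_nonneg_left (ha m y hy hys) hc)⟩

/-- The function `∑ₘ Rₘ (z - z₀)` on the ball with centre `z₀`. -/
noncomputable def toFun (_ : IsDominatedFamily r R B) (z₀ : LatticeComplexification X) :
    Metric.ball z₀ r → ℂ :=
  fun z => ∑' m, R m fun _ => z.1 - z₀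

theorem hasSum_toFun (h : IsDominatedFamily r R B) (z₀ : LatticeComplexification X)
    (z : Metric.ball z₀ r) : HasSum (fun m => R m fun _ => z.1 - z₀) (h.toFun z₀ z) :=
  (h.summable_apply (mem_ball_iff_norm.1 z.2)).hasSum

end IsDominatedFamily

variable {z₀ : LatticeComplexification X} {r : ℝ} {f g : Metric.ball z₀ r → ℂ}

/-- Only the radius condition at the centre is used. The root test bounds all terms of large degree
by `1` at radius `s`; the finitely many others are bounded because positive forms are. -/
theorem IsRegularlyHolomorphicOfBoundedType.isDominatedFamily (hr : 0 < r)
    (hf : IsRegularlyHolomorphicOfBoundedType (Metric.ball z₀ r) f) :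
    IsDominatedFamily r (taylorForm f z₀) fun m => (formModulus (taylorForm f z₀ m)).1 := by
  have hz₀ : z₀ ∈ Metric.ball z₀ r := Metric.mem_ball_self hr
  have hreg := hf.regular z₀ hz₀
  refine ⟨fun m => (hreg m).isPositiveForm,
    fun m => symm_of_restrictReal_symm (hreg m).restrictReal_symm,
    fun m => (hreg m).formDominates, fun s hs0 hs => ?_⟩
  have hscale : ∀ m (y : X), (formModulus (taylorForm f z₀ m)).1 (fun _ => y)
      = s ^ m * (formModulus (taylorForm f z₀ m)).1 fun _ => s⁻¹ • y := by
    intro m y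
    rw [← MultilinearMap.map_const_smul, smul_inv_smul₀ hs0.ne']
  have hunit : ∀ y : X, ‖y‖ ≤ s → ‖s⁻¹ • y‖ ≤ 1 := by
    intro y hy
    rw [norm_smul, norm_inv, Real.norm_of_nonneg hs0.le]
    exact (inv_mul_le_iff₀ hs0).2 (by simpa using hy)
  have hev := eventually_mul_pow_le_one_of_lt (ENNReal.ofReal_pos.2 hs0).ne'
    ((ENNReal.ofReal_lt_ofReal_iff hr).2 hs)
    ((le_infEDist_frontier_ball z₀ r).trans (hf.radius z₀ hz₀))
  obtain ⟨N, hN⟩ := Filter.eventually_atTop.1 hev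
  choose K hK using fun m => (hreg m).isPositiveForm.exists_bound
  refine ⟨1 + ∑ m ∈ Finset.range N, |s ^ m * K m|, fun m y hy hys => ?_⟩
  have hsum : 0 ≤ ∑ m ∈ Finset.range N, |s ^ m * K m| :=
    Finset.sum_nonneg fun _ _ => abs_nonneg _
  rw [hscale]
  rcases lt_or_ge m N with hm | hm
  · have h1 : s ^ m * (formModulus (taylorForm f z₀ m)).1 (fun _ => s⁻¹ • y) ≤ s ^ m * K m :=
      mul_le_mul_of_nonneg_left (hK m _ (smul_nonneg (inv_nonneg.2 hs0.le) hy) (hunit y hys))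
        (by positivity)
    have h2 := Finset.single_le_sum (f := fun m => |s ^ m * K m|) (fun _ _ => abs_nonneg _)
      (Finset.mem_range.2 hm)
    have h3 := le_abs_self (s ^ m * K m)
    linarith
  · have h1 : ENNReal.ofReal (s ^ m * (formModulus (taylorForm f z₀ m)).1 fun _ => s⁻¹ • y)
        ≤ ENNReal.ofReal 1 := by
      rw [ENNReal.ofReal_mul (by positivity), mul_comm, ENNReal.ofReal_pow hs0.le,
        ENNReal.ofReal_one]
      exact le_trans (by gcongr; exact ofReal_apply_le_regularNorm _ (hunit y hys)) (hN m hm)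
    have h2 := (ENNReal.ofReal_le_ofReal_iff zero_le_one).1 h1
    linarith

/-- The Taylor series at the centre sums to an analytic function on the whole ball that agrees with
`f` near `z₀`. The ball is connected, so the identity theorem applies. -/
theorem IsRegularlyHolomorphicOfBoundedType.hasSum (hr : 0 < r)
    (hf : IsRegularlyHolomorphicOfBoundedType (Metric.ball z₀ r) f) (z : Metric.ball z₀ r) :
    HasSum (fun m => taylorForm f z₀ m fun _ => z.1 - z₀) (f z) := by
  have hz₀ : z₀ ∈ Metric.ball z₀ r := Metric.mem_ball_self hr
  have h := hf.isDominatedFamily hr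
  have hg := h.isRegularlyHolomorphicOfBoundedType hr (h.hasSum_toFun z₀)
  have heq : extendZero f =ᶠ[𝓝 z₀] extendZero (h.toFun z₀) := by
    obtain ⟨p, ρ, hp⟩ := hf.holomorphic z₀ hz₀
    filter_upwards [Metric.ball_mem_nhds z₀ hr, Metric.eball_mem_nhds z₀ hp.r_pos] with w hw hwρ
    have hy : w - z₀ ∈ Metric.eball (0 : 𝓔) ρ := by
      rwa [Metric.mem_eball, edist_zero_right, ← edist_eq_enorm_sub]
    have h1 := hp.hasSum_iteratedFDeriv hy
    rw [add_sub_cancel] at h1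
    rw [extendZero_apply (h.toFun z₀) hw]
    exact h1.unique (h.hasSum_toFun z₀ ⟨w, hw⟩)
  have hE := hf.holomorphic.eqOn_of_preconnected_of_eventuallyEq hg.holomorphic
    (convex_ball z₀ r).isPreconnected hz₀ heq z.2
  rw [extendZero_apply f z.2, extendZero_apply (h.toFun z₀) z.2] at hE
  rw [show f z = h.toFun z₀ z from hE]
  exact h.hasSum_toFun z₀ z

variable (z₀ r) in
/-- The complex vector space of regularly holomorphic functions of bounded type on a ball. -/
def boundedTypeSubmodule (hr : 0 < r) : Submodule ℂ (Metric.ball z₀ r → ℂ) where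
  carrier := {f | IsRegularlyHolomorphicOfBoundedType (Metric.ball z₀ r) f}
  zero_mem' := (IsDominatedFamily.zero r).isRegularlyHolomorphicOfBoundedType hr
    fun _ => by simp
  add_mem' hf hg := ((hf.isDominatedFamily hr).add
    (hg.isDominatedFamily hr)).isRegularlyHolomorphicOfBoundedType hr
      fun z => (hf.hasSum hr z).add (hg.hasSum hr z)
  smul_mem' α _ hf := ((hf.isDominatedFamily hr).smul α).isRegularlyHolomorphicOfBoundedType hr
    fun z => (hf.hasSum hr z).mul_left α

variable {hr : 0 < r}

/-! ### Taylor forms at the centre as coordinates on the function space -/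

theorem taylorForm_add (f g : boundedTypeSubmodule z₀ r hr) (m : ℕ) :
    taylorForm (f + g).1 z₀ m = taylorForm f.1 z₀ m + taylorForm g.1 z₀ m :=
  ((f.2.isDominatedFamily hr).add (g.2.isDominatedFamily hr)).taylorForm_center hr
    (fun z => (f.2.hasSum hr z).add (g.2.hasSum hr z)) m

theorem taylorForm_smul (α : ℂ) (f : boundedTypeSubmodule z₀ r hr) (m : ℕ) :
    taylorForm (α • f).1 z₀ m = α • taylorForm f.1 z₀ m :=
  ((f.2.isDominatedFamily hr).smul α).taylorForm_center hr
    (fun z => (f.2.hasSum hr z).mul_left α) m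

theorem taylorForm_sub (f g : boundedTypeSubmodule z₀ r hr) (m : ℕ) :
    taylorForm (f - g).1 z₀ m = taylorForm f.1 z₀ m - taylorForm g.1 z₀ m := by
  rw [eq_sub_iff_add_eq, ← taylorForm_add, sub_add_cancel]

theorem eq_of_taylorForm_eq {f g : boundedTypeSubmodule z₀ r hr}
    (h : ∀ m, taylorForm f.1 z₀ m = taylorForm g.1 z₀ m) : f = g := by
  ext z
  have h1 := f.2.hasSum hr z
  simp only [h] at h1
  exact h1.unique (g.2.hasSum hr z)

theorem isRegularForm_taylorForm (f : boundedTypeSubmodule z₀ r hr) (m : ℕ) :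
    IsRegularForm (taylorForm f.1 z₀ m) :=
  f.2.regular z₀ (Metric.mem_ball_self hr) m

theorem exists_taylorForm_eq_complexifyMap (f : boundedTypeSubmodule z₀ r hr)
    {C : ∀ m : ℕ, MultilinearMap ℝ (fun _ : Fin m => X) ℝ} (hC : ∀ m, IsPositiveForm (C m))
    {c : ℝ} (hc : 0 ≤ c) (hle : ∀ m (x : Fin m → X), (∀ i, 0 ≤ x i) →
      C m x ≤ c * (formModulus (taylorForm f.1 z₀ m)).1 x) :
    ∃ g : boundedTypeSubmodule z₀ r hr,
      (∀ m, taylorForm g.1 z₀ m = complexifyMap (C m)) ∧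
      ∀ z : Metric.ball z₀ r, HasSum (fun m => complexifyForm (C m) fun _ => z.1 - z₀) (g.1 z) := by
  have h := (f.2.isDominatedFamily hr).complexifyMap_of_le hC hc hle
  exact ⟨⟨h.toFun z₀, h.isRegularlyHolomorphicOfBoundedType hr (h.hasSum_toFun z₀)⟩,
    h.taylorForm_center hr (h.hasSum_toFun z₀), h.hasSum_toFun z₀⟩

theorem exists_modulus (f : boundedTypeSubmodule z₀ r hr) :
    ∃ g : boundedTypeSubmodule z₀ r hr,
      (∀ m, taylorForm g.1 z₀ m = complexifyMap (formModulus (taylorForm f.1 z₀ m)).1) ∧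
      ∀ z : Metric.ball z₀ r, HasSum (fun m =>
        complexifyForm (formModulus (taylorForm f.1 z₀ m)).1 fun _ => z.1 - z₀) (g.1 z) :=
  exists_taylorForm_eq_complexifyMap f (fun m => (isRegularForm_taylorForm f m).isPositiveForm)
    zero_le_one fun _ _ _ => (one_mul _).ge

theorem isPositiveForm_of_complexifyMap_eq_modulus {m : ℕ}
    {P : MultilinearMap ℂ (fun _ : Fin m => 𝓔) ℂ} (hP : IsRegularForm P)
    {C : MultilinearMap ℝ (fun _ : Fin m => X) ℝ}
    (h : complexifyMap (formModulus P).1 = complexifyMap C) : IsPositiveForm C :=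
  complexifyMap_injective h ▸ hP.isPositiveForm

/-- Functions whose coefficients are complexified positive forms are fixed by `μ`. This gives
idempotence and, with subadditivity of the form modulus, the triangle axiom. -/
theorem isArchimedeanModulus_of_taylorForm
    {μ : boundedTypeSubmodule z₀ r hr → boundedTypeSubmodule z₀ r hr}
    (hμ : ∀ f m, taylorForm (μ f).1 z₀ m
      = complexifyMap (formModulus (taylorForm f.1 z₀ m)).1) : IsArchimedeanModulus μ := by
  have hfix : ∀ f : boundedTypeSubmodule z₀ r hr,
      (∀ m, ∃ C, IsPositiveForm C ∧ taylorForm f.1 z₀ m = complexifyMap C) → μ f = f := by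
    intro f hf
    refine eq_of_taylorForm_eq fun m => ?_
    obtain ⟨C, hC, e⟩ := hf m
    rw [hμ, e, formModulus_complexifyMap hC]
  have hpos : ∀ (f : boundedTypeSubmodule z₀ r hr) m,
      IsPositiveForm (formModulus (taylorForm f.1 z₀ m)).1 :=
    fun f m => (isRegularForm_taylorForm f m).isPositiveForm
  refine ⟨fun f => hfix _ fun m => ⟨_, hpos f m, hμ f m⟩, fun α f => ?_, fun f g => ?_, ?_,
    fun f g h => ?_⟩
  · refine eq_of_taylorForm_eq fun m => ?_
    rw [taylorForm_smul, hμ, hμ, taylorForm_smul, formModulus_smul (isRegularForm_taylorForm f m),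
      complexifyMap_smul]
  · have hadd : μ (μ f + μ g) = μ f + μ g := hfix _ fun m =>
      ⟨_, (hpos f m).add (hpos g m), by rw [taylorForm_add, hμ, hμ, complexifyMap_add]⟩
    rw [hadd]
    refine hfix _ fun m => ⟨(formModulus (taylorForm f.1 z₀ m)).1 +
      (formModulus (taylorForm g.1 z₀ m)).1 - (formModulus (taylorForm (f + g).1 z₀ m)).1,
      ⟨fun σ x => ?_, fun x hx => ?_⟩, ?_⟩
    · simp only [sub_apply, add_apply, (hpos _ m).1]
    · rw [sub_apply, add_apply, sub_nonneg, taylorForm_add]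
      exact formModulus_add_le (isRegularForm_taylorForm f m) (isRegularForm_taylorForm g m) hx
    · rw [taylorForm_sub, taylorForm_add, hμ, hμ, hμ, complexifyMap_sub, complexifyMap_add]
  · rw [eq_top_iff]
    intro f _
    -- A real family `A m` bounded by the coefficients of `f` is the difference of the positive
    -- families `|Rₘ| + A m` and `|Rₘ|`, the first being at most `2 |Rₘ|`. Both define functions
    -- fixed by `μ`, hence elements of its range.
    have hpart : ∀ A : ∀ m, MultilinearMap ℝ (fun _ : Fin m => X) ℝ,
        (∀ m, A m ∈ regularForms X m) →
        (∀ m (x : Fin m → X), |A m x| ≤ ‖restrictReal (taylorForm f.1 z₀ m) x‖) →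
        ∃ k ∈ Submodule.span ℂ (Set.range μ), ∀ m, taylorForm k.1 z₀ m = complexifyMap (A m) := by
      intro A hA hle
      have hle' : ∀ m (x : Fin m → X), (∀ i, 0 ≤ x i) →
          |A m x| ≤ (formModulus (taylorForm f.1 z₀ m)).1 x := fun m x hx =>
        (hle m x).trans ((isRegularForm_taylorForm f m).formDominates x hx)
      have hp : ∀ m, IsPositiveForm ((formModulus (taylorForm f.1 z₀ m)).1 + A m) := fun m =>
        ⟨fun σ x => by rw [add_apply, add_apply, (hpos f m).1, regularForms.symm (hA m)],
          fun x hx => by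
            rw [add_apply]
            linarith [(abs_le.1 (hle' m x hx)).1]⟩
      obtain ⟨k, hk, -⟩ := exists_taylorForm_eq_complexifyMap f hp zero_le_two fun m x hx => by
        rw [add_apply, two_mul]
        linarith [(abs_le.1 (hle' m x hx)).2]
      refine ⟨k - μ f, Submodule.sub_mem _ (Submodule.subset_span ⟨k, ?_⟩)
        (Submodule.subset_span ⟨f, rfl⟩), fun m => ?_⟩
      · exact hfix k fun m => ⟨_, hp m, hk m⟩
      · rw [taylorForm_sub, hk, hμ, ← complexifyMap_sub, add_sub_cancel_left]
    obtain ⟨k₀, hk₀, h₀⟩ := hpart (fun m => realPartForm (taylorForm f.1 z₀ m))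
      (fun m => (isRegularForm_taylorForm f m).1) fun m x => Complex.abs_re_le_norm _
    obtain ⟨k₁, hk₁, h₁⟩ := hpart (fun m => imPartForm (taylorForm f.1 z₀ m))
      (fun m => (isRegularForm_taylorForm f m).2) fun m x => Complex.abs_im_le_norm _
    have e : f = k₀ + Complex.I • k₁ := eq_of_taylorForm_eq fun m => by
      rw [taylorForm_add, taylorForm_smul, h₀, h₁]
      exact eq_complexifyMap_add_I_smul _
    rw [e]
    exact Submodule.add_mem _ hk₀ (Submodule.smul_mem _ _ hk₁)
  · refine eq_of_taylorForm_eq fun m => ?_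
    -- Being a value of `μ`, the difference `μ g - k • μ f` has positive coefficients. So `k` times
    -- the modulus of the coefficient of `f` stays below that of `g` on the cone for all `k`, and
    -- the Archimedean property of `ℝ` makes it vanish.
    have hk : ∀ k : ℕ, IsPositiveForm ((formModulus (taylorForm g.1 z₀ m)).1 -
        (k : ℝ) • (formModulus (taylorForm f.1 z₀ m)).1) := by
      intro k
      refine isPositiveForm_of_complexifyMap_eq_modulus
        (isRegularForm_taylorForm (μ g - (k : ℂ) • μ f) m) ?_
      rw [← hμ, h k, taylorForm_sub, taylorForm_smul, hμ, hμ, complexifyMap_sub,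
        complexifyMap_smul, Complex.ofReal_natCast]
    have h0 : taylorForm (0 : boundedTypeSubmodule z₀ r hr).1 z₀ m = 0 := by
      have := taylorForm_smul (0 : ℂ) f m
      rwa [zero_smul, zero_smul] at this
    rw [h0]
    refine restrictReal_injective (MultilinearMap.ext_of_nonneg fun x hx => ?_)
    have hdom := (isRegularForm_taylorForm f m).formDominates x hx
    have hle : (formModulus (taylorForm f.1 z₀ m)).1 x ≤ 0 := by
      by_contra hlt
      rw [not_le] at hlt
      obtain ⟨k, hk'⟩ := exists_nat_gt
        ((formModulus (taylorForm g.1 z₀ m)).1 x / (formModulus (taylorForm f.1 z₀ m)).1 x)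
      rw [div_lt_iff₀ hlt] at hk'
      have := (hk k).2 x hx
      rw [sub_apply, smul_apply, smul_eq_mul] at this
      linarith
    have : restrictReal (taylorForm f.1 z₀ m) x = 0 := norm_le_zero_iff.1 (hdom.trans hle)
    rw [this]
    rfl

end BoundedType

/-- On the open ball `U` with centre `z₀` and radius `r` in the complex Banach lattice `X_ℂ`, the
regularly holomorphic functions of bounded type form a complex vector space `G`, on which
`|f| = ∑ₘ |(1 / m!) d^m f(z₀)|` is well defined and is an Archimedean modulus. -/
theorem proposition4p5 {X : Type*} [NormedAddCommGroup X] [Lattice X] [HasSolidNorm X]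
    [IsOrderedAddMonoid X] [NormedSpace ℝ X] [IsOrderedModule ℝ X] [CompleteSpace X]
    (z₀ : LatticeComplexification X) (r : ℝ) (hr : 0 < r) :
    ∃ (G : Submodule ℂ (Metric.ball z₀ r → ℂ)) (μ : G → G),
      (∀ f : Metric.ball z₀ r → ℂ,
        f ∈ G ↔ IsRegularlyHolomorphicOfBoundedType (Metric.ball z₀ r) f) ∧
      (∀ f : G,
        (∀ m : ℕ, IsFormModulus (taylorForm f.1 z₀ m) (formModulus (taylorForm f.1 z₀ m))) ∧
        ∀ z : Metric.ball z₀ r,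
          HasSum (fun m : ℕ =>
            complexifyForm
              (formModulus (taylorForm f.1 z₀ m) : MultilinearMap ℝ (fun _ : Fin m => X) ℝ)
              fun _ => (z : LatticeComplexification X) - z₀)
            ((μ f).1 z)) ∧
      IsArchimedeanModulus μ := by
  choose μ hμ hsum using exists_modulus (z₀ := z₀) (r := r) (hr := hr)
  exact ⟨boundedTypeSubmodule z₀ r hr, μ, fun _ => Iff.rfl,
    fun f => ⟨fun m => (isRegularForm_taylorForm f m).isFormModulus, hsum f⟩,
    isArchimedeanModulus_of_taylorForm hμ⟩
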